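/- **Setting.** Let $q$ be a prime power and let $\mathbf X\in\{\mathbf L,\mathbf U,\mathbf{Sp},\mathbf O^+,\mathbf O^-\}$. Put $u=2$ if $\mathbf X=\mathbf U$ and $u=1$ otherwise, let $V=(\mathbb F_{q^u})^d$ with $d>8$, and let $G$ be $\mathrm{GL}_d(q)$, $\mathrm{GU}_d(q)$, $\mathrm{Sp}_d(q)$, $\mathrm{GO}^+_d(q)$, $\mathrm{GO}^-_d(q)$ respectively (the full isometry group of a nondegenerate form if $\mathbf X\neq\mathbf L$). Let $d=e_1+e_2$ with $2\le e_2\le e_1$, where both $e_i$ are odd if $\mathbf X=\mathbf U$ and both are even if $\mathbf X\in\{\mathbf{Sp},\mathbf O^\pm\}$. An element $g\in\mathrm{GL}(V)$ is an *$e$-stingray element* if $V=U_g\oplus F_g$, where $F_g$ is the fixed point space of $g$ and $U_g$ is a $g$-invariant $e$-dimensional subspace on which $g$ acts irreducibly and nontrivially. For $i=1,2$ let $r_i$ be a primitive prime divisor of $(q^u)^{e_i}-1$ (a prime dividing $(q^u)^{e_i}-1$ but no $(q^u)^j-1$ with $1\le j<e_i$), and let $g_i\in G$ be an $e_i$-stingray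 element of order $r_i$. A *stingray duo* in $g_1^G\times g_2^G$ is a pair $(g,g')$ in this product of conjugacy classes with $V=U_g\oplus U_{g'}$. Let $\mathcal{AC}_6$ be the set of normalisers $N_G(R)$, where $d=s^n$ for a prime $s$ dividing $q^u-1$ and some $n\ge1$, and $R\le G$ is extraspecial of order $s^{1+2n}$ and exponent $s\gcd(2,s)$, or $s=2$ and $R\cong 4\circ2^{1+2n}$ is of symplectic type, of order $2^{2+2n}$ and exponent $4$. Let $\mathcal S_6$ be the set of stingray duos $(g,g')$ in $g_1^G\times g_2^G$ such that $\langle g,g'\rangle$ is contained in a member of $\mathcal{AC}_6$, but leaves invariant no proper nonzero subspace of $V$, no decomposition of $V$ as a direct sum of at least two nonzero subspaces (which may be permuted), no extension field structure on $V$ (that is, it normalises no field $K\subseteq\mathrm{End}(V)$ of prime degree over the scalars), and no subfield structure on $V$ (that is, in no basis is each of its elements a scalar multiple of a matrix over a proper subfield of $\mathbb F_{q^u}$). Put $$\mathrm{Prob}_6=\frac{|\mathcal S_6|}{\#\{\text{stingray duos in }g_1^G\times g_2^G\}}.$$ **Statement.** (a) $\mathrm{Prob}_6=0$ if any of the following holds: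 (i) $d$ is not of the form $2^n$ with $n\ge4$, or $q$ is not an odd prime; (ii) $(e_1,e_2)\notin\{(d/2,d/2),(d-2,2)\}$; (iii) $\mathbf X\in\{\mathbf U,\mathbf O^-\}$. (b) If $\mathrm{Prob}_6>0$, then $d=2^n$ for some $n\ge4$, $q$ is an odd prime, $\mathbf X\in\{\mathbf L,\mathbf{Sp},\mathbf O^+\}$, and one of the following holds. (i) $(e_1,e_2)=(d/2,d/2)$, $r_1=r_2$ is $e_1+1=2^{n-1}+1$ or $2e_1+1=2^n+1$, and $$\mathrm{Prob}_6<\begin{cases}\frac{45}{1024}\,q^{-d^2/4}&\text{if }\mathbf X=\mathbf L,\\ \frac{45}{1024}\,q^{-d^2/4+23d/10}&\text{if }\mathbf X\in\{\mathbf{Sp},\mathbf O^+\}.\end{cases}$$ (ii) $(e_1,e_2)=(d-2,2)$, $d\ge32$, $q\ge5$, $q\ne7$, $n$ is an odd prime, either $n\ge7$, or $n=5$ and $q\ge11$, $r_1=e_1+1=2^n-1$, $r_2$ is an odd prime divisor of $q+1$, and $$\mathrm{Prob}_6<\begin{cases}\frac{45}{640}\,q^{-\frac{59}{25}d+8}&\text{if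 }\mathbf X=\mathbf L,\\ 5.3\cdot10^{-3}\,q^{-d+3}&\text{if }\mathbf X\in\{\mathbf{Sp},\mathbf O^+\}\text{ and }d\ge128\text{ or }q\ge19,\\ 6.9\,q^{-d+3}&\text{if }\mathbf X\in\{\mathbf{Sp},\mathbf O^+\},\ d=32\text{ and }q\in\{11,13,17\}.\end{cases}$$ (c) Suppose that $d=2^n$ with $n\ge4$, that $q$ is an odd prime, and that $\mathbf X\in\{\mathbf L,\mathbf{Sp},\mathbf O^+\}$ with $q\equiv1\pmod 4$ if $\mathbf X=\mathbf L$. Let $\mathcal M_6$ be the set of the subgroups $M=N_G(R)=R.M_0$ of $G$ in the following table. | $\mathbf X$ | $R$ | $M_0$ | |---|---|---| | $\mathbf L$ | $(q-1)\circ 2^{1+2n}$ (containing all scalars) | $\mathrm{Sp}_{2n}(2)$ | | $\mathbf{Sp}$ | $2_-^{1+2n}$ | $\mathrm{SO}^-_{2n}(2)$ if $q\equiv\pm1\ (8)$, $\Omega^-_{2n}(2)$ if $q\equiv\pm3\ (8)$ | | $\mathbf O^+$ | $2_+^{1+2n}$ | $\mathrm{SO}^+_{2n}(2)$ if $q\equiv\pm1\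 (8)$, $\Omega^+_{2n}(2)$ if $q\equiv\pm3\ (8)$ | Then $\mathcal M_6$ is non-empty, its members are conjugate under $N_{\mathrm{GL}(V)}(G)$, they form a single $G$-conjugacy class if $\mathbf X=\mathbf L$ or $q\equiv\pm3\pmod 8$, and for each $(g,g')\in\mathcal S_6$ the group $\langle g,g'\rangle$ is contained in some $M\in\mathcal M_6$. (Here $\mathrm{SO}^\pm_{2n}(2)$ denotes the full isometry group of the quadratic form.) -/

import Mathlib

namespace Stingray

/-! ### Classical groups -/

/-- The types of classical groups: linear, unitary, symplectic, and even-dimensional orthogonal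
of plus and of minus type. -/
inductive ClassicalType
  | L
  | U
  | Sp
  | OPlus
  | OMinus

section Forms

variable {F V : Type*} [Field F] [AddCommGroup V] [Module F V]

/-- The group of all linear automorphisms of `V` that preserve the function `P` of two vectors
(used for alternating and for hermitian forms). -/
def formIsometries (P : V → V → F) : Subgroup (V ≃ₗ[F] V) where
  carrier := {g | ∀ v w, P (g v) (g w) = P v w}
  one_mem' := fun _ _ => rfl
  mul_mem' := by
    intro a b ha hb v w
    exact (ha (b v) (b w)).trans (hb v w)
  inv_mem' := by
    intro a ha v w
    have h := ha (a⁻¹ v) (a⁻¹ w)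
    have e : ∀ x, a (a⁻¹ x) = x := fun x => a.apply_symm_apply x
    rw [e, e] at h
    exact h.symm

/-- The isometry group of a quadratic form. -/
def quadraticIsometries (Q : QuadraticForm F V) : Subgroup (V ≃ₗ[F] V) where
  carrier := {g | ∀ v, Q (g v) = Q v}
  one_mem' := fun _ => rfl
  mul_mem' := by
    intro a b ha hb v
    exact (ha (b v)).trans (hb v)
  inv_mem' := by
    intro a ha v
    have h := ha (a⁻¹ v)
    have e : ∀ x, a (a⁻¹ x) = x := fun x => a.apply_symm_apply x
    rw [e] at h
    exact h.symm

/-- Nondegeneracy of a quadratic form on an even-dimensional space (in any characteristic):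
its polar form has trivial radical. -/
def QuadraticNondegenerate (Q : QuadraticForm F V) : Prop :=
  ∀ v, (∀ w, QuadraticMap.polar Q v w = 0) → v = 0

/-- There is a totally singular subspace of half the dimension of the space. -/
def HasHalfSingular (Q : QuadraticForm F V) : Prop :=
  ∃ W : Submodule F V, 2 * Module.finrank F W = Module.finrank F V ∧ ∀ w ∈ W, Q w = 0

/-- A nondegenerate quadratic form of plus type on a space of even dimension. -/
def IsPlusType (Q : QuadraticForm F V) : Prop :=
  Even (Module.finrank F V) ∧ QuadraticNondegenerate Q ∧ HasHalfSingular Q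

/-- A nondegenerate quadratic form of minus type on a space of even dimension. -/
def IsMinusType (Q : QuadraticForm F V) : Prop :=
  Even (Module.finrank F V) ∧ QuadraticNondegenerate Q ∧ ¬ HasHalfSingular Q

/-- `G` is the full classical group of type `X` with parameter `q` on `V`, namely the general
linear group or the full isometry group of a nondegenerate form of type `X`. The field `F` has
`q` elements, except that it has `q ^ 2` elements in the unitary case. -/
def IsClassicalGroup (q : ℕ) (G : Subgroup (V ≃ₗ[F] V)) : ClassicalType → Prop
  | .L => Nat.card F = q ∧ G = ⊤
  | .U => Nat.card F = q ^ 2 ∧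
      ∃ (σ : F →+* F) (B : V →ₗ[F] V →ₛₗ[σ] F), (∀ x, σ x = x ^ q) ∧
        (∀ v w, B w v = σ (B v w)) ∧ (∀ v, (∀ w, B v w = 0) → v = 0) ∧
        G = formIsometries (fun v w => B v w)
  | .Sp => Nat.card F = q ∧
      ∃ B : V →ₗ[F] V →ₗ[F] F, (∀ v, B v v = 0) ∧ (∀ v, (∀ w, B v w = 0) → v = 0) ∧
        G = formIsometries (fun v w => B v w)
  | .OPlus => Nat.card F = q ∧
      ∃ Q : QuadraticForm F V, IsPlusType Q ∧ G = quadraticIsometries Q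
  | .OMinus => Nat.card F = q ∧
      ∃ Q : QuadraticForm F V, IsMinusType Q ∧ G = quadraticIsometries Q

end Forms

/-- The parity conditions on `e₁, e₂` for stingray duos in the classical groups of type `X`. -/
def ParityCondition (e₁ e₂ : ℕ) : ClassicalType → Prop
  | .L => True
  | .U => Odd e₁ ∧ Odd e₂
  | .Sp => Even e₁ ∧ Even e₂
  | .OPlus => Even e₁ ∧ Even e₂
  | .OMinus => Even e₁ ∧ Even e₂

/-! ### Stingray elements and stingray duos -/

/-- `r` is a primitive prime divisor of `Q ^ e - 1`. -/
def IsPpd (Q e r : ℕ) : Prop :=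
  r.Prime ∧ r ∣ Q ^ e - 1 ∧ ∀ i, 1 ≤ i → i < e → ¬ r ∣ Q ^ i - 1

section Duos

variable {F V : Type*} [Field F] [AddCommGroup V] [Module F V]

/-- The fixed point subspace of `g`. -/
def fixedSpace (g : V ≃ₗ[F] V) : Submodule F V :=
  LinearMap.ker ((g : V →ₗ[F] V) - LinearMap.id)

/-- `g` is a stingray element with associated subspace `U`: the space is the direct sum of `U`
and the fixed point space of `g`, and `g` leaves `U` invariant and acts on it irreducibly and
nontrivially. -/
def IsStingrayOn (g : V ≃ₗ[F] V) (U : Submodule F V) : Prop :=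
  IsCompl U (fixedSpace g) ∧ (∀ u ∈ U, g u ∈ U) ∧ (∃ u ∈ U, g u ≠ u) ∧
    ∀ W : Submodule F V, W ≤ U → (∀ w ∈ W, g w ∈ W) → W = ⊥ ∨ W = U

/-- `g` is an `e`-stingray element. -/
def IsStingray (e : ℕ) (g : V ≃ₗ[F] V) : Prop :=
  ∃ U : Submodule F V, IsStingrayOn g U ∧ Module.finrank F U = e

/-- `(g, g')` is an `(e₁, e₂)`-stingray duo on `V`. -/
def IsStingrayDuo (e₁ e₂ : ℕ) (g g' : V ≃ₗ[F] V) : Prop :=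
  e₁ + e₂ = Module.finrank F V ∧ e₂ ≤ e₁ ∧
    ∃ U U' : Submodule F V, IsStingrayOn g U ∧ Module.finrank F U = e₁ ∧
      IsStingrayOn g' U' ∧ Module.finrank F U' = e₂ ∧ IsCompl U U'

/-- The conjugacy class `g ^ G`. -/
def conjClass (G : Subgroup (V ≃ₗ[F] V)) (g : V ≃ₗ[F] V) : Set (V ≃ₗ[F] V) :=
  {x | ∃ h ∈ G, x = h * g * h⁻¹}

/-- The set of `(e₁, e₂)`-stingray duos in `g₁ ^ G × g₂ ^ G`. -/
def duos (G : Subgroup (V ≃ₗ[F] V)) (e₁ e₂ : ℕ) (g₁ g₂ : V ≃ₗ[F] V) :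
    Set ((V ≃ₗ[F] V) × (V ≃ₗ[F] V)) :=
  {p | p.1 ∈ conjClass G g₁ ∧ p.2 ∈ conjClass G g₂ ∧ IsStingrayDuo e₁ e₂ p.1 p.2}

/-! ### The Aschbacher categories preceding the sixth

Containment of `H` in a member of one of the categories is expressed by the invariance of the
corresponding structure under `H`. The fourth category (tensor decompositions) is not listed, since
the corresponding family of subgroups is taken to be empty. -/

/-- `H` leaves invariant a proper nonzero subspace. -/
def PreservesSubspace (H : Subgroup (V ≃ₗ[F] V)) : Prop :=
  ∃ W : Submodule F V, W ≠ ⊥ ∧ W ≠ ⊤ ∧ ∀ h ∈ H, ∀ w ∈ W, h w ∈ W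

/-- `H` permutes the summands of a direct decomposition of `V` into `b ≥ 2` nonzero subspaces. -/
def PreservesDecomposition (H : Subgroup (V ≃ₗ[F] V)) : Prop :=
  ∃ (b : ℕ) (W : Fin b → Submodule F V), 2 ≤ b ∧ DirectSum.IsInternal W ∧ (∀ i, W i ≠ ⊥) ∧
    ∀ h ∈ H, ∀ i, ∃ j, (W i).map (h : V →ₗ[F] V) = W j

/-- `H` leaves invariant an extension field structure on `V`: it normalises a field `K` of
endomorphisms of `V` which has prime degree over the scalars. -/
def PreservesExtensionField (H : Subgroup (V ≃ₗ[F] V)) : Prop :=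
  ∃ K : Subalgebra F (Module.End F V), IsField K ∧ (Module.finrank F K).Prime ∧
    ∀ h ∈ H, ∀ k ∈ K, (h : V →ₗ[F] V) ∘ₗ k ∘ₗ ((h⁻¹ : V ≃ₗ[F] V) : V →ₗ[F] V) ∈ K

/-- `H` leaves invariant a subfield structure on `V`: there are a proper subfield `F₀` of `F` and a
basis of `V` such that each element of `H` is, up to a nonzero scalar, represented in this basis by
a matrix over `F₀`. -/
def PreservesSubfield (H : Subgroup (V ≃ₗ[F] V)) : Prop :=
  ∃ (F₀ : Subfield F) (B : Module.Basis (Fin (Module.finrank F V)) F V), F₀ ≠ ⊤ ∧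
    ∀ h ∈ H, ∃ c : F, c ≠ 0 ∧ ∀ i j, c * B.repr (h (B j)) i ∈ F₀

end Duos

/-! ### Groups of symplectic type and the sixth category -/

/-- `R` is an extraspecial `s`-group of order `s ^ (1 + 2 * n)` and exponent `s * gcd 2 s`. -/
def IsExtraspecial (s n : ℕ) (R : Type*) [Group R] : Prop :=
  Nat.card R = s ^ (1 + 2 * n) ∧ Nat.card (Subgroup.center R) = s ∧
    commutator R = Subgroup.center R ∧ (∀ x : R, x ^ s ∈ Subgroup.center R) ∧
    Monoid.exponent R = s * Nat.gcd 2 s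

/-- `R` is a group of symplectic type of order `2 ^ (2 + 2 * n)` and exponent `4`, that is, a
central product of a cyclic group of order `4` and an extraspecial group of order
`2 ^ (1 + 2 * n)`. -/
def IsFourCircExtraspecial (n : ℕ) (R : Type*) [Group R] : Prop :=
  Nat.card R = 2 ^ (2 + 2 * n) ∧ IsCyclic (Subgroup.center R) ∧
    Nat.card (Subgroup.center R) = 4 ∧ Nat.card (commutator R) = 2 ∧ Monoid.exponent R = 4

/-- The extraspecial group of order `2 ^ (1 + 2 * n)` of plus type: it has an elementary abelian
subgroup of order `2 ^ (n + 1)`. -/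
def IsExtraspecialPlus (n : ℕ) (R : Type*) [Group R] : Prop :=
  IsExtraspecial 2 n R ∧ ∃ A : Subgroup R, Nat.card A = 2 ^ (n + 1) ∧ ∀ x ∈ A, x ^ 2 = 1

/-- The extraspecial group of order `2 ^ (1 + 2 * n)` of minus type. -/
def IsExtraspecialMinus (n : ℕ) (R : Type*) [Group R] : Prop :=
  IsExtraspecial 2 n R ∧ ¬ ∃ A : Subgroup R, Nat.card A = 2 ^ (n + 1) ∧ ∀ x ∈ A, x ^ 2 = 1

section CategorySix

variable {F V : Type*} [Field F] [AddCommGroup V] [Module F V]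

/-- `M` belongs to the sixth Aschbacher category of `G`: the dimension of `V` is a power `s ^ n`
of a prime divisor `s` of `|F| - 1`, and `M` is the normaliser in `G` of a subgroup `R` of `G` that
is extraspecial of order `s ^ (1 + 2 * n)`, or (with `s = 2`) of symplectic type of order
`2 ^ (2 + 2 * n)`. -/
def IsCategorySix (G M : Subgroup (V ≃ₗ[F] V)) : Prop :=
  ∃ (s n : ℕ) (R : Subgroup (V ≃ₗ[F] V)), s.Prime ∧ s ∣ Nat.card F - 1 ∧ 1 ≤ n ∧
    Module.finrank F V = s ^ n ∧ R ≤ G ∧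
    (IsExtraspecial s n R ∨ (s = 2 ∧ IsFourCircExtraspecial n R)) ∧
    M = G ⊓ Subgroup.normalizer (R : Set (V ≃ₗ[F] V))

/-- The stingray duos in `g₁ ^ G × g₂ ^ G` that generate a subgroup contained in a member of the
sixth category, but in no member of the preceding families. -/
def duosSix (G : Subgroup (V ≃ₗ[F] V)) (e₁ e₂ : ℕ) (g₁ g₂ : V ≃ₗ[F] V) :
    Set ((V ≃ₗ[F] V) × (V ≃ₗ[F] V)) :=
  {p | p ∈ duos G e₁ e₂ g₁ g₂ ∧
    (∃ M, IsCategorySix G M ∧ Subgroup.closure {p.1, p.2} ≤ M) ∧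
    ¬ PreservesSubspace (Subgroup.closure {p.1, p.2}) ∧
    ¬ PreservesDecomposition (Subgroup.closure {p.1, p.2}) ∧
    ¬ PreservesExtensionField (Subgroup.closure {p.1, p.2}) ∧
    ¬ PreservesSubfield (Subgroup.closure {p.1, p.2})}

/-- The proportion `Prob₆(g₁, g₂, X)`. -/
noncomputable def probSix (G : Subgroup (V ≃ₗ[F] V)) (e₁ e₂ : ℕ) (g₁ g₂ : V ≃ₗ[F] V) : ℝ :=
  ((duosSix G e₁ e₂ g₁ g₂).ncard : ℝ) / ((duos G e₁ e₂ g₁ g₂).ncard : ℝ)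

/-- `M = R.T`: the subgroup `R` is normal in `M` with quotient isomorphic to the subgroup `T` of
`K`. -/
def IsExtensionBy (M R : Subgroup (V ≃ₗ[F] V)) {K : Type*} [Group K] (T : Subgroup K) : Prop :=
  R ≤ M ∧ ∃ φ : M →* K, φ.range = T ∧ φ.ker = R.subgroupOf M

/-- The space of dimension `2 * n` over the field with two elements. -/
abbrev Space2 (n : ℕ) : Type := Fin (2 * n) → ZMod 2

/-- `M` is an extension of `R` by `SO(Q) = GO(Q)` if `q ≡ ±1 (mod 8)`, and by `Ω(Q)`, the derived
subgroup of `SO(Q)`, if `q ≡ ±3 (mod 8)`. -/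
def IsOrthogonalExtension (q n : ℕ) (M R : Subgroup (V ≃ₗ[F] V))
    (Q : QuadraticForm (ZMod 2) (Space2 n)) : Prop :=
  ((q % 8 = 1 ∨ q % 8 = 7) →
      IsExtensionBy M R (⊤ : Subgroup (quadraticIsometries Q))) ∧
    ((q % 8 = 3 ∨ q % 8 = 5) →
      IsExtensionBy M R (commutator (quadraticIsometries Q)))

/-- The subgroups `M = N_G(R) = R.M₀` of `G` in the following table, where `q` is an odd prime and
`d = 2 ^ n`.
* type `L`, `q ≡ 1 (mod 4)`: `R = (q - 1) ∘ 2 ^ (1 + 2n)` and `M₀ = Sp_{2n}(2)`;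
* type `Sp`: `R = 2_- ^ (1 + 2n)`, and `M₀` is `SO^-_{2n}(2)` if `q ≡ ±1 (mod 8)` and
  `Ω^-_{2n}(2)` if `q ≡ ±3 (mod 8)`;
* type `OPlus`: `R = 2_+ ^ (1 + 2n)`, and `M₀` is `SO^+_{2n}(2)` if `q ≡ ±1 (mod 8)` and
  `Ω^+_{2n}(2)` if `q ≡ ±3 (mod 8)`.

In type `L` the group `R` is the product of the group of all scalars and `4 ∘ 2 ^ (1 + 2n)`. -/
def IsTableSubgroup (q n : ℕ) (G M : Subgroup (V ≃ₗ[F] V)) : ClassicalType → Prop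
  | .L => q % 4 = 1 ∧ ∃ R₀ R : Subgroup (V ≃ₗ[F] V), R ≤ G ∧ IsFourCircExtraspecial n R₀ ∧
      R = R₀ ⊔ Subgroup.center (V ≃ₗ[F] V) ∧
      M = G ⊓ Subgroup.normalizer (R : Set (V ≃ₗ[F] V)) ∧
      ∃ φ : M →* Matrix.symplecticGroup (Fin n) (ZMod 2),
        Function.Surjective φ ∧ φ.ker = R.subgroupOf M
  | .Sp => ∃ R : Subgroup (V ≃ₗ[F] V), R ≤ G ∧ IsExtraspecialMinus n R ∧
      M = G ⊓ Subgroup.normalizer (R : Set (V ≃ₗ[F] V)) ∧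
      ∃ Q : QuadraticForm (ZMod 2) (Space2 n), IsMinusType Q ∧ IsOrthogonalExtension q n M R Q
  | .OPlus => ∃ R : Subgroup (V ≃ₗ[F] V), R ≤ G ∧ IsExtraspecialPlus n R ∧
      M = G ⊓ Subgroup.normalizer (R : Set (V ≃ₗ[F] V)) ∧
      ∃ Q : QuadraticForm (ZMod 2) (Space2 n), IsPlusType Q ∧ IsOrthogonalExtension q n M R Q
  | .U => False
  | .OMinus => False

/-- The subgroup `x * M * x⁻¹`. -/
def conjSubgroup (x : V ≃ₗ[F] V) (M : Subgroup (V ≃ₗ[F] V)) : Subgroup (V ≃ₗ[F] V) :=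
  M.map (MulAut.conj x).toMonoidHom

end CategorySix

end Stingray

/-! The set of duos in question is empty, so the proportion is always 0; parts (a) and (b) and the
containment claim in (c) follow from this. The rest of (c) is a construction and a conjugacy theorem
for normalisers of 2-groups of symplectic type.

Emptiness. Let `R` be extraspecial or of symplectic type in dimension d = s^n. Commutators act as
scalars, and representatives of the d² cosets of Z(R) are linearly independent by Dedekind's theorem
on characters, so they form a basis of End(V). An element `g` of the normaliser permutes this basis
up to scalars. Hence the centraliser of `g` in End(V) has dimension at most the number of orbits of
`g` on R/Z(R). If `g` has prime order r and fixes s^k < d² cosets, Burnside's lemma gives (d² + (r -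
1)s^k)/r orbits, which is at most 2d²/(r + 1) because r divides d²/s^k - 1. An e-stingray element,
however, centralises all endomorphisms of its fixed space and one more projection, so this dimension
is at least (d - e)² + 1. For 2 ≤ e ≤ d/2, e < r and d > 8 the bounds are incompatible
(`stingray_arithmetic`). The second member of a duo has e₂ ≤ d/2, so it normalises no such `R`
(`IsHeisenberg.not_mem_normalizer_of_isStingray`).

Table subgroups. Modulo scalars such a 2-group is a symplectic space `E` over F₂; choosing
representatives `w a` gives a frame, and in the extraspecial case squaring gives a quadratic form on
`E`. Two frames over isometric spaces are intertwined by some `T`, found as a common eigenvector of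
the commuting operators T ↦ w'(φ a) T w(a) (`exists_intertwiner`). Uniqueness of the `R`-invariant
form up to scalars makes `T` a similarity, and the question is which multipliers are squares.
Multipliers are killed by commutators, and 1 + w a has multiplier 2 and induces the transvection at
`a`. Since transvections generate the orthogonal group over F₂, the quotient is the full group or
its derived subgroup according to whether 2 is a square, that is, q ≡ ±1 or ±3 (mod 8)
(`IsQuadraticFrame.exists_hom_normalizer`). The same multiplier 2 fuses the classes in `G` when 2 is
not a square. In type `L` all scalars are present, only the alternating form survives, and the
quotient is the symplectic group. Existence comes from explicit translation and sign operators on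
functions on F₂^n, tensored with a quaternion group acting on a plane in the symplectic case. -/

set_option linter.unusedSectionVars false

namespace Stingray

open scoped commutatorElement

/-! ### Groups of symplectic type span the endomorphism algebra -/

section Spanning

variable {F V : Type*} [Field F] [AddCommGroup V] [Module F V]

/-- The endomorphism underlying a linear automorphism. -/
abbrev toEnd (x : V ≃ₗ[F] V) : Module.End F V := (x : V →ₗ[F] V)

lemma toEnd_mul (x y : V ≃ₗ[F] V) : toEnd (x * y) = toEnd x * toEnd y := rfl

lemma toEnd_one : toEnd (1 : V ≃ₗ[F] V) = 1 := rfl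

lemma toEnd_injective : Function.Injective (toEnd : (V ≃ₗ[F] V) → Module.End F V) :=
  LinearEquiv.toLinearMap_injective

lemma toEnd_mul_inv (x : V ≃ₗ[F] V) : toEnd x * toEnd x⁻¹ = 1 := by
  rw [← toEnd_mul, mul_inv_cancel, toEnd_one]

lemma toEnd_inv_mul (x : V ≃ₗ[F] V) : toEnd x⁻¹ * toEnd x = 1 := by
  rw [← toEnd_mul, inv_mul_cancel, toEnd_one]

lemma toEnd_ne_zero [Nontrivial V] (x : V ≃ₗ[F] V) : toEnd x ≠ 0 := by
  intro h
  have := toEnd_mul_inv x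
  rw [h, zero_mul] at this
  exact zero_ne_one this

/-- The hypotheses on a subgroup of `GL(V)` shared by the extraspecial groups and the groups of
symplectic type of the sixth category. -/
structure IsHeisenberg (s n : ℕ) (R : Subgroup (V ≃ₗ[F] V)) : Prop where
  prime : s.Prime
  dvd : s ∣ Nat.card F - 1
  finrank : Module.finrank F V = s ^ n
  card_commutator : Nat.card (commutator R) = s
  commutator_le : commutator R ≤ Subgroup.center R
  index : (Subgroup.center R).index = s ^ (2 * n)
  card_center : ∃ k, Nat.card (Subgroup.center R) = s ^ k

lemma IsHeisenberg.of_isExtraspecial {s n : ℕ} {R : Subgroup (V ≃ₗ[F] V)} (hs : s.Prime)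
    (hdvd : s ∣ Nat.card F - 1) (hV : Module.finrank F V = s ^ n) (hR : IsExtraspecial s n R) :
    IsHeisenberg s n R := by
  obtain ⟨h1, h2, h3, -, -⟩ := hR
  refine ⟨hs, hdvd, hV, by rw [h3, h2], h3.le, ?_, 1, by rw [h2, pow_one]⟩
  have := Subgroup.card_mul_index (Subgroup.center R)
  rw [h1, h2, pow_add, pow_one] at this
  exact Nat.eq_of_mul_eq_mul_left hs.pos this

/-- Conjugation preserves `N` and the identity, so it fixes the only other element of `N`. -/
lemma le_center_of_card_two {R : Type*} [Group R] (N : Subgroup R) [N.Normal]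
    (hN : Nat.card N = 2) : N ≤ Subgroup.center R := by
  have : Finite N := Nat.finite_of_card_ne_zero (by omega)
  intro x hx
  rw [Subgroup.mem_center_iff]
  intro y
  by_cases h1 : x = 1
  · simp [h1]
  have hy : y * x * y⁻¹ ∈ N := Subgroup.Normal.conj_mem inferInstance x hx y
  have key : y * x * y⁻¹ = x := by
    obtain ⟨a, b, hab, hu⟩ := Nat.card_eq_two_iff.mp hN
    have all : ∀ z : N, z = a ∨ z = b := fun z => by
      have : z ∈ ({a, b} : Set N) := hu ▸ Set.mem_univ z
      simpa using this
    have hne : y * x * y⁻¹ ≠ 1 := by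
      intro h
      apply h1
      have := congrArg (fun t => y⁻¹ * t * y) h
      simpa [mul_assoc] using this
    have e1 := all ⟨x, hx⟩
    have e2 := all ⟨_, hy⟩
    have e3 := all 1
    have : (⟨y * x * y⁻¹, hy⟩ : N) = ⟨x, hx⟩ := by
      have n1 : (⟨x, hx⟩ : N) ≠ 1 := fun h => h1 (congrArg Subtype.val h)
      have n2 : (⟨y * x * y⁻¹, hy⟩ : N) ≠ 1 := fun h => hne (congrArg Subtype.val h)
      grind
    exact congrArg Subtype.val this
  calc y * x = y * x * y⁻¹ * y := by group
    _ = x * y := by rw [key]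

/-- The centre has order 4 and the commutator subgroup order 2, so the commutators are central by
normality, not through equality with the centre. -/
lemma IsHeisenberg.of_isFourCircExtraspecial {n : ℕ} {R : Subgroup (V ≃ₗ[F] V)}
    (hdvd : 2 ∣ Nat.card F - 1) (hV : Module.finrank F V = 2 ^ n)
    (hR : IsFourCircExtraspecial n R) : IsHeisenberg 2 n R := by
  obtain ⟨h1, -, h2, h3, -⟩ := hR
  refine ⟨Nat.prime_two, hdvd, hV, h3, le_center_of_card_two _ h3, ?_, 2, by rw [h2]; rfl⟩
  have := Subgroup.card_mul_index (Subgroup.center R)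
  rw [h1, h2, pow_add] at this
  exact Nat.eq_of_mul_eq_mul_left (by norm_num) this

variable [FiniteDimensional F V] [Finite F]

/-- A nontrivial linear automorphism whose order divides `|F| - 1` has an eigenvalue `≠ 1`. -/
lemma exists_eigenvalue_ne_one {s : ℕ} (hs : s.Prime) (hdvd : s ∣ Nat.card F - 1)
    (z : Module.End F V) (hz : z ^ s = 1) (hz1 : z ≠ 1) :
    ∃ μ : F, μ ≠ 1 ∧ ∃ v : V, v ≠ 0 ∧ z v = μ • v := by
  have := Fintype.ofFinite F
  classical
  obtain ⟨ω, hω⟩ : ∃ ω : Fˣ, orderOf ω = s := by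
    have : Fact s.Prime := ⟨hs⟩
    apply exists_prime_orderOf_dvd_card
    rwa [Fintype.card_units, ← Nat.card_eq_fintype_card]
  -- As `s` divides |F| - 1, the polynomial X^s - 1 splits into distinct linear factors over `F`.
  have hprim : IsPrimitiveRoot (ω : F) s := by
    rw [IsPrimitiveRoot.coe_units_iff, ← hω]; exact IsPrimitiveRoot.orderOf ω
  have hprod := Polynomial.X_pow_sub_one_eq_prod hs.pos hprim
  by_contra hcon
  push Not at hcon
  have h1 : (1 : F) ∈ Polynomial.nthRootsFinset s (1 : F) := by
    simp [Polynomial.mem_nthRootsFinset hs.pos]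
  rw [← Finset.mul_prod_erase _ _ h1] at hprod
  -- If no `μ ≠ 1` were an eigenvalue, all factors z - μ with `μ ≠ 1` would be injective, and so
  -- would their product; then z^s - 1 = 0 leaves z = 1.
  have hinj : Function.Injective (Polynomial.aeval z (∏ x ∈ (Polynomial.nthRootsFinset s
      (1 : F)).erase 1, (Polynomial.X - Polynomial.C x))) := by
    refine Finset.prod_induction _
      (fun f : Polynomial F => Function.Injective (Polynomial.aeval z f)) ?_ ?_ ?_
    · intro a b ha hb
      rw [map_mul]
      exact ha.comp hb
    · rw [map_one]
      exact Function.injective_id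
    · intro μ hμ
      rw [injective_iff_map_eq_zero]
      intro v hv
      by_contra hv0
      refine hcon μ (Finset.ne_of_mem_erase hμ) v hv0 ?_
      simpa [sub_eq_zero, Algebra.algebraMap_eq_smul_one] using hv
  apply hz1
  have h0 := congrArg (Polynomial.aeval z) hprod
  rw [mul_comm, map_mul] at h0
  have hl : Polynomial.aeval z (Polynomial.X ^ s - 1 : Polynomial F) = 0 := by simp [hz]
  rw [hl] at h0
  ext v
  have h2 := LinearMap.congr_fun h0 v
  rw [LinearMap.zero_apply, Module.End.mul_apply] at h2
  have h3 := (injective_iff_map_eq_zero _).mp hinj _ h2.symm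
  simpa [sub_eq_zero] using h3

/-- The commutator subgroup is cyclic of prime order; at this stage its generator is only known to
have some eigenvalue `μ ≠ 1`. That it is the scalar `μ` needs the dimension count of
`IsHeisenberg.exists_scalar_of_mem_commutator`. -/
lemma IsHeisenberg.commutator_scalar_aux {s n : ℕ} {R : Subgroup (V ≃ₗ[F] V)}
    (h : IsHeisenberg s n R) [Nontrivial V] :
    ∃ (z : R) (μ : F), z ∈ commutator R ∧ μ ≠ 1 ∧ μ ^ s = 1 ∧ z ^ s = 1 ∧
      (∀ x ∈ commutator R, ∃ k : ℕ, x = z ^ k) ∧ ∃ v : V, v ≠ 0 ∧ (z : V ≃ₗ[F] V) v = μ • v := by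
  have : Fact s.Prime := ⟨h.prime⟩
  have hfin : Finite (commutator R) :=
    Nat.finite_of_card_ne_zero (by rw [h.card_commutator]; exact h.prime.ne_zero)
  have hcyc : IsCyclic (commutator R) := isCyclic_of_prime_card h.card_commutator
  obtain ⟨z, hz⟩ := hcyc.exists_generator
  have hzs : z ^ s = 1 := by rw [← h.card_commutator]; exact pow_card_eq_one'
  have hz1 : z ≠ 1 := by
    rintro rfl
    have : Subsingleton (commutator R) := ⟨fun a b => by
      have ha := hz a
      have hb := hz b
      simp only [Subgroup.zpowers_one_eq_bot, Subgroup.mem_bot] at ha hb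
      rw [ha, hb]⟩
    have h1 := Nat.card_unique (α := commutator R)
    rw [h.card_commutator] at h1
    exact h.prime.one_lt.ne' h1
  have hzs' : toEnd ((z : R) : V ≃ₗ[F] V) ^ s = 1 := by
    have : ((z : R) : V ≃ₗ[F] V) ^ s = 1 := by
      rw [← Subgroup.coe_pow, ← Subgroup.coe_pow, hzs]; rfl
    rw [← toEnd_one, ← this]
    exact (map_pow (LinearEquiv.automorphismGroup.toLinearMapMonoidHom (R := F) (M := V)) _ _).symm
  obtain ⟨μ, hμ, v, hv, hzv⟩ := exists_eigenvalue_ne_one h.prime h.dvd _ hzs' (by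
    intro h1
    apply hz1
    exact Subtype.ext (Subtype.ext (toEnd_injective h1)))
  refine ⟨z, μ, z.2, hμ, ?_, by rw [← Subgroup.coe_pow, hzs]; rfl, ?_, v, hv, hzv⟩
  · have hpow : ∀ k : ℕ, (toEnd ((z : R) : V ≃ₗ[F] V) ^ k) v = μ ^ k • v := by
      intro k
      induction k with
      | zero => simp
      | succ k ih =>
        rw [pow_succ, Module.End.mul_apply, show toEnd ((z : R) : V ≃ₗ[F] V) v = μ • v from hzv,
          map_smul, ih, smul_smul, pow_succ']
    have := hpow s
    rw [hzs', Module.End.one_apply] at this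
    have h2 : (μ ^ s - 1) • v = 0 := by rw [sub_smul, ← this, one_smul, sub_self]
    exact sub_eq_zero.mp ((smul_eq_zero.mp h2).resolve_right hv)
  · intro x hx
    have hx' := hz ⟨x, hx⟩
    rw [← mem_powers_iff_mem_zpowers] at hx'
    obtain ⟨k, hk⟩ := hx'
    exact ⟨k, by rw [← Subgroup.coe_pow]; exact (congrArg Subtype.val hk).symm⟩

/-- Representatives of the cosets of the centre of a Heisenberg group, restricted to an
eigenspace of the commutator subgroup, are linearly independent. -/
lemma linearIndependent_domRestrict_out {R : Subgroup (V ≃ₗ[F] V)} (W : Submodule F V)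
    (hW : W ≠ ⊥) (hinv : ∀ x ∈ R, ∀ w ∈ W, x w ∈ W) (hcent : commutator R ≤ Subgroup.center R)
    (hscal : ∀ t ∈ commutator R, ∃ c : F, (c = 1 → t = 1) ∧
      ∀ w ∈ W, (t : V ≃ₗ[F] V) w = c • w) :
    LinearIndependent F (fun x : R ⧸ Subgroup.center R =>
      (toEnd ((Quotient.out x : R) : V ≃ₗ[F] V)).domRestrict W) := by
  obtain ⟨v, hvW, hv⟩ := Submodule.exists_mem_ne_zero_of_ne_bot hW
  choose! c hc1 hc using hscal
  have huniq : ∀ {a b : F}, a • v = b • v → a = b := fun {a b} hab => by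
    have h2 : (a - b) • v = 0 := by rw [sub_smul, hab, sub_self]
    exact sub_eq_zero.mp ((smul_eq_zero.mp h2).resolve_right hv)
  have hcomm : ∀ x y : R, ⁅x, y⁆ ∈ commutator R := fun x y =>
    Subgroup.commutator_mem_commutator (Subgroup.mem_top x) (Subgroup.mem_top y)
  have hmul : ∀ t ∈ commutator R, ∀ u ∈ commutator R, c (t * u) = c t * c u := by
    intro t ht u hu
    apply huniq
    rw [← hc _ (mul_mem ht hu) v hvW, mul_smul]
    change (t : V ≃ₗ[F] V) ((u : V ≃ₗ[F] V) v) = _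
    rw [hc u hu v hvW, map_smul, hc t ht v hvW, smul_comm]
  have hone : c 1 = 1 := by
    apply huniq
    rw [← hc 1 (one_mem _) v hvW, one_smul]; rfl
  -- Conjugating `x` by `y` multiplies its restriction to `W` by the scalar of a commutator. As
  -- commutators are central, this scalar is a character in `y`.
  let χ : R → (R →* F) := fun x =>
    { toFun := fun y => c ⁅y, x⁆
      map_one' := by rw [commutatorElement_one_left, hone]
      map_mul' := fun y y' => by
        rw [← hmul _ (hcomm _ _) _ (hcomm _ _)]
        congr 1
        have h1 := Subgroup.mem_center_iff.mp (hcent (hcomm y' x))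
        have h2 := h1 y
        have h3 := h1 (y * x * y⁻¹ * x⁻¹)
        calc ⁅y * y', x⁆ = y * ⁅y', x⁆ * x * y⁻¹ * x⁻¹ := by
              simp only [commutatorElement_def]; group
          _ = ⁅y', x⁆ * (y * x * y⁻¹ * x⁻¹) := by rw [h2]; group
          _ = ⁅y, x⁆ * ⁅y', x⁆ := by rw [← h3]; simp only [commutatorElement_def] }
  -- If two characters agree, every `g` has the same commutator with both representatives, so these
  -- differ by a central element.
  have hχinj : Function.Injective (fun x : R ⧸ Subgroup.center R => χ (Quotient.out x)) := by
    intro x y hxy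
    rw [← Quotient.out_eq x, ← Quotient.out_eq y]
    refine QuotientGroup.eq.mpr ?_
    rw [Subgroup.mem_center_iff]
    intro g
    have h1 : c ⁅g, x.out⁆ = c ⁅g, y.out⁆ := DFunLike.congr_fun hxy g
    set a := x.out
    set b := y.out
    have h2 : c (⁅g, a⁆⁻¹ * ⁅g, b⁆) = 1 := by
      rw [hmul _ (inv_mem (hcomm _ _)) _ (hcomm _ _), ← h1,
        ← hmul _ (inv_mem (hcomm _ _)) _ (hcomm _ _), inv_mul_cancel, hone]
    have h3 := hc1 _ (mul_mem (inv_mem (hcomm _ _)) (hcomm _ _)) h2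
    have h4 : ⁅g, a⁆ = ⁅g, b⁆ := inv_mul_eq_one.mp h3
    simp only [commutatorElement_def] at h4
    have h5 := Subgroup.mem_center_iff.mp (hcent (hcomm g a)) a
    simp only [commutatorElement_def] at h5
    have h6 : g * a * g⁻¹ = g * a * g⁻¹ * a⁻¹ * a := by group
    have h7 : g * b * g⁻¹ = g * b * g⁻¹ * b⁻¹ * b := by group
    have h8 : (g * a * g⁻¹)⁻¹ * (g * b * g⁻¹) = a⁻¹ * b := by
      rw [h6, h7, ← h4]; group
    have h9 : g * (a⁻¹ * b) * g⁻¹ = a⁻¹ * b := (Eq.trans (by group) h8)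
    calc g * (a⁻¹ * b) = g * (a⁻¹ * b) * g⁻¹ * g := by group
      _ = a⁻¹ * b * g := by rw [h9]
  have hind := (linearIndependent_monoidHom R F).comp _ hχinj
  rw [linearIndependent_iff'] at hind ⊢
  intro S a ha i hi
  obtain ⟨ℓ, hℓ⟩ : ∃ ℓ : Module.Dual F V, ℓ (((Quotient.out i : R) : V ≃ₗ[F] V) v) ≠ 0 :=
    Module.Projective.exists_dual_ne_zero F (by simpa using hv)
  -- Evaluating the relation at `y⁻¹ v` and applying `y`, then `ℓ`, turns it into a relation between
  -- distinct characters. The choice of `ℓ` keeps the factor at `i` nonzero.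
  have hsum : ∑ x ∈ S, (a x * ℓ (((Quotient.out x : R) : V ≃ₗ[F] V) v)) •
      ((fun f => f : (R →* F) → R → F) ∘ fun x => χ (Quotient.out x)) x = 0 := by
    funext y
    have hy : ((y⁻¹ : R) : V ≃ₗ[F] V) v ∈ W := hinv _ (y⁻¹).2 v hvW
    have h1 := LinearMap.congr_fun ha ⟨_, hy⟩
    have h2 := congrArg (fun w => ℓ ((y : V ≃ₗ[F] V) w)) h1
    simp only [LinearMap.sum_apply, LinearMap.smul_apply, map_sum, map_smul,
      LinearMap.zero_apply, map_zero] at h2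
    simp only [Finset.sum_apply, Pi.smul_apply, Function.comp_apply, smul_eq_mul, Pi.zero_apply]
    rw [← h2]
    refine Finset.sum_congr rfl fun x _ => ?_
    have h3 : (y : V ≃ₗ[F] V) (((toEnd ((Quotient.out x : R) : V ≃ₗ[F] V)).domRestrict W)
        ⟨_, hy⟩) = c ⁅y, x.out⁆ • ((Quotient.out x : R) : V ≃ₗ[F] V) v := by
      rw [← hc _ (hcomm y x.out) _ (hinv _ (Quotient.out x : R).2 v hvW)]
      have h4 : y * x.out * y⁻¹ = ⁅y, x.out⁆ * x.out := by
        rw [commutatorElement_def]; group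
      exact congrArg (fun t : R => (t : V ≃ₗ[F] V) v) h4
    rw [h3, map_smul, smul_eq_mul]
    simp only [χ, MonoidHom.coe_mk, OneHom.coe_mk]
    ring
  have h1 := hind S _ hsum i hi
  exact (mul_eq_zero.mp h1).resolve_right hℓ

lemma mem_commutator (R : Type*) [Group R] (x y : R) : ⁅x, y⁆ ∈ commutator R :=
  Subgroup.commutator_mem_commutator (Subgroup.mem_top x) (Subgroup.mem_top y)

variable {s n : ℕ} {R : Subgroup (V ≃ₗ[F] V)}

/-- The commutators of a Heisenberg group are scalars. -/
lemma IsHeisenberg.exists_scalar_of_mem_commutator (h : IsHeisenberg s n R) :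
    ∀ t ∈ commutator R, ∃ c : F, (c = 1 → t = 1) ∧ ∀ v, (t : V ≃ₗ[F] V) v = c • v := by
  have : Nontrivial V := Module.nontrivial_of_finrank_pos (R := F) (by
    rw [h.finrank]; exact pow_pos h.prime.pos _)
  obtain ⟨z, μ, hz, hμ, hμs, hzs, hgen, v, hv, hzv⟩ := h.commutator_scalar_aux
  -- Since `z` is central, its `μ`-eigenspace is `R`-invariant; that it is all of `V` follows by
  -- counting dimensions.
  let W : Submodule F V := Module.End.eigenspace (toEnd (z : V ≃ₗ[F] V)) μ
  have hmemW : ∀ w, w ∈ W ↔ (z : V ≃ₗ[F] V) w = μ • w := fun w => Module.End.mem_eigenspace_iff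
  have hpow : ∀ k : ℕ, ∀ w ∈ W, ((z ^ k : R) : V ≃ₗ[F] V) w = μ ^ k • w := by
    intro k
    induction k with
    | zero => intro w _; simp
    | succ k ih =>
      intro w hw
      rw [pow_succ, Subgroup.coe_mul]
      change ((z ^ k : R) : V ≃ₗ[F] V) ((z : V ≃ₗ[F] V) w) = _
      rw [(hmemW w).mp hw, map_smul, ih w hw, smul_smul, pow_succ']
  have hscal : ∀ t ∈ commutator R, ∃ c : F, (c = 1 → t = 1) ∧
      ∀ w ∈ W, (t : V ≃ₗ[F] V) w = c • w := by
    intro t ht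
    obtain ⟨k, rfl⟩ := hgen t ht
    refine ⟨μ ^ k, fun hk => ?_, hpow k⟩
    -- Because `μ` has order exactly `s`, a power of `z` acting trivially on `W` is trivial.
    have ho : orderOf μ = s := by
      have : Fact s.Prime := ⟨h.prime⟩
      exact orderOf_eq_prime hμs hμ
    obtain ⟨m, rfl⟩ := ho ▸ orderOf_dvd_of_pow_eq_one hk
    rw [pow_mul, hzs, one_pow]
  have hW : W ≠ ⊥ := fun hb => hv (by simpa [hb] using (hmemW v).mpr hzv)
  have hinv : ∀ x ∈ R, ∀ w ∈ W, x w ∈ W := by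
    intro x hx w hw
    rw [hmemW] at hw ⊢
    have h1 := Subgroup.mem_center_iff.mp (h.commutator_le hz) ⟨x, hx⟩
    have h2 := congrArg (fun t : R => (t : V ≃ₗ[F] V) w) h1
    change x ((z : V ≃ₗ[F] V) w) = (z : V ≃ₗ[F] V) (x w) at h2
    rw [← h2, hw, map_smul]
  have hind := linearIndependent_domRestrict_out W hW hinv h.commutator_le hscal
  have hfi : Finite (R ⧸ Subgroup.center R) := Nat.finite_of_card_ne_zero (by
    rw [← Subgroup.index_eq_card, h.index]; exact pow_ne_zero _ h.prime.ne_zero)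
  have := Fintype.ofFinite (R ⧸ Subgroup.center R)
  -- There are s^(2n) independent maps in Hom(W, V), whose dimension is dim W · s^n; hence dim W ≥
  -- s^n = dim V.
  have hle := hind.fintype_card_le_finrank
  rw [Module.finrank_linearMap, ← Nat.card_eq_fintype_card, ← Subgroup.index_eq_card, h.index,
    h.finrank, two_mul, pow_add] at hle
  have hle' := Nat.le_of_mul_le_mul_right hle (pow_pos h.prime.pos _)
  have htop : W = ⊤ := by
    apply Submodule.eq_top_of_finrank_eq
    rw [h.finrank]
    exact le_antisymm (h.finrank ▸ Submodule.finrank_le W) hle'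
  intro t ht
  obtain ⟨c, hc1, hc⟩ := hscal t ht
  exact ⟨c, hc1, fun v => hc v (htop ▸ Submodule.mem_top)⟩

/-- Coset representatives of the centre of a Heisenberg group form a basis of `End(V)`. -/
lemma IsHeisenberg.linearIndependent_out (h : IsHeisenberg s n R) :
    LinearIndependent F (fun x : R ⧸ Subgroup.center R =>
      toEnd ((Quotient.out x : R) : V ≃ₗ[F] V)) := by
  have : Nontrivial V := Module.nontrivial_of_finrank_pos (R := F) (by
    rw [h.finrank]; exact pow_pos h.prime.pos _)
  have hind := linearIndependent_domRestrict_out (R := R) (⊤ : Submodule F V) top_ne_bot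
    (fun _ _ _ _ => Submodule.mem_top) h.commutator_le
    (fun t ht => by
      obtain ⟨c, hc1, hc⟩ := h.exists_scalar_of_mem_commutator t ht
      exact ⟨c, hc1, fun v _ => hc v⟩)
  refine LinearIndependent.of_comp (LinearMap.lcomp F V (⊤ : Submodule F V).subtype) ?_
  exact hind

lemma IsHeisenberg.finite_quotient (h : IsHeisenberg s n R) :
    Finite (R ⧸ Subgroup.center R) := Nat.finite_of_card_ne_zero (by
  rw [← Subgroup.index_eq_card, h.index]; exact pow_ne_zero _ h.prime.ne_zero)

lemma IsHeisenberg.card_quotient (h : IsHeisenberg s n R) :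
    Nat.card (R ⧸ Subgroup.center R) = Module.finrank F (Module.End F V) := by
  rw [← Subgroup.index_eq_card, h.index, Module.finrank_linearMap, h.finrank]
  ring

/-- The basis of `End(V)` that consists of coset representatives of the centre. -/
noncomputable def IsHeisenberg.basis (h : IsHeisenberg s n R) :
    Module.Basis (R ⧸ Subgroup.center R) F (Module.End F V) :=
  have := h.finite_quotient
  have := Fintype.ofFinite (R ⧸ Subgroup.center R)
  have : Nonempty (R ⧸ Subgroup.center R) := ⟨1⟩
  basisOfLinearIndependentOfCardEqFinrank h.linearIndependent_out
    (by rw [← Nat.card_eq_fintype_card]; exact h.card_quotient)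

lemma IsHeisenberg.basis_apply (h : IsHeisenberg s n R) (x : R ⧸ Subgroup.center R) :
    h.basis x = toEnd ((Quotient.out x : R) : V ≃ₗ[F] V) := by
  simp [IsHeisenberg.basis]

/-- A Heisenberg group spans `End(V)`. -/
lemma IsHeisenberg.span_eq_top (h : IsHeisenberg s n R) :
    Submodule.span F (toEnd '' (R : Set (V ≃ₗ[F] V))) = ⊤ := by
  rw [eq_top_iff, ← h.basis.span_eq]
  apply Submodule.span_mono
  rintro _ ⟨x, rfl⟩
  rw [h.basis_apply]
  exact ⟨_, (Quotient.out x : R).2, rfl⟩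

end Spanning

/-! ### Endomorphisms commuting with a spanning set -/

section Scalars

variable {F V : Type*} [Field F] [AddCommGroup V] [Module F V]

/-- An endomorphism commuting with a set that spans `End(V)` is a scalar. -/
lemma exists_scalar_of_commute {R : Set (V ≃ₗ[F] V)}
    (hR : Submodule.span F (toEnd '' R) = ⊤) (D : Module.End F V)
    (hD : ∀ x ∈ R, D * toEnd x = toEnd x * D) : ∃ c : F, D = c • (1 : Module.End F V) := by
  have hall : ∀ T : Module.End F V, D * T = T * D := by
    intro T
    have hT : T ∈ Submodule.span F (toEnd '' R) := hR ▸ Submodule.mem_top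
    induction hT using Submodule.span_induction with
    | mem x hx => obtain ⟨y, hy, rfl⟩ := hx; exact hD y hy
    | zero => simp
    | add a b _ _ ha hb => rw [mul_add, add_mul, ha, hb]
    | smul c a _ ha => rw [mul_smul_comm, smul_mul_assoc, ha]
  have hc : D ∈ Subalgebra.center F (Module.End F V) :=
    Subalgebra.mem_center_iff.mpr fun T => (hall T).symm
  have hc' : D ∈ (⊥ : Subalgebra F (Module.End F V)) := by
    rwa [Algebra.IsCentral.center_eq_bot] at hc
  obtain ⟨c, hc⟩ := Algebra.mem_bot.mp hc'
  exact ⟨c, by rw [← hc, Algebra.algebraMap_eq_smul_one]⟩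

end Scalars

section Heisenberg

variable {F V : Type*} [Field F] [AddCommGroup V] [Module F V] [FiniteDimensional F V] [Finite F]
  {s n : ℕ} {R : Subgroup (V ≃ₗ[F] V)}

lemma IsHeisenberg.nontrivial (h : IsHeisenberg s n R) : Nontrivial V :=
  Module.nontrivial_of_finrank_pos (R := F) (by rw [h.finrank]; exact pow_pos h.prime.pos _)

/-- The central elements of a Heisenberg group are scalars. -/
lemma IsHeisenberg.exists_scalar_of_mem_center (h : IsHeisenberg s n R) {x : R}
    (hx : x ∈ Subgroup.center R) : ∃ c : F, toEnd (x : V ≃ₗ[F] V) = c • 1 :=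
  exists_scalar_of_commute h.span_eq_top _ fun y hy =>
    congrArg (fun t : R => toEnd (t : V ≃ₗ[F] V)) (Subgroup.mem_center_iff.mp hx ⟨y, hy⟩).symm

end Heisenberg

/-! ### Monomial transformations and orbit counting -/

section Monomial

/-- The dimension of the space of fixed points of a monomial transformation is at most the number
of orbits on the set of coordinates. -/
lemma finrank_fixed_le_card_orbits {F A X : Type*} [Field F] [AddCommGroup A] [Module F A]
    [Finite X] (b : Module.Basis X F A) (σ : Equiv.Perm X) (L : A →ₗ[F] A) (c : X → F)
    (hc : ∀ x, c x ≠ 0) (hL : ∀ x, L (b x) = c x • b (σ x)) :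
    Module.finrank F (LinearMap.ker (L - LinearMap.id)) ≤
      Nat.card (MulAction.orbitRel.Quotient (Subgroup.zpowers σ) X) := by
  classical
  have := Fintype.ofFinite X
  have hfin : Module.Finite F A := Module.Finite.of_basis b
  have := Fintype.ofFinite (MulAction.orbitRel.Quotient (Subgroup.zpowers σ) X)
  -- Along an orbit each coordinate of a fixed vector determines the next and vanishes with it, so
  -- one coordinate from each orbit determines the vector.
  have hcoord : ∀ a ∈ LinearMap.ker (L - LinearMap.id), ∀ x,
      b.repr a (σ x) = c x * b.repr a x := by
    intro a ha x
    have h1 : L a = a := by simpa [sub_eq_zero] using ha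
    have h2 : L a = ∑ y, (b.repr a y * c y) • b (σ y) := by
      conv_lhs => rw [← b.sum_repr a]
      rw [map_sum]
      refine Finset.sum_congr rfl fun y _ => ?_
      rw [map_smul, hL, smul_smul]
    have h3 : b.repr (L a) (σ x) = c x * b.repr a x := by
      rw [h2, map_sum, Finsupp.finsetSum_apply, Finset.sum_eq_single x]
      · simp [mul_comm]
      · intro y _ hy
        simp [hy]
      · simp
    rwa [h1] at h3
  let Φ : LinearMap.ker (L - LinearMap.id) →ₗ[F]
      (MulAction.orbitRel.Quotient (Subgroup.zpowers σ) X → F) :=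
    { toFun := fun a o => b.repr a (Quotient.out o)
      map_add' := fun a a' => by ext o; simp
      map_smul' := fun t a => by ext o; simp }
  have hinj : Function.Injective Φ := by
    rw [injective_iff_map_eq_zero]
    rintro ⟨a, ha⟩ h0
    have hz : ∀ x, b.repr a (σ x) = 0 ↔ b.repr a x = 0 := fun x => by
      rw [hcoord a ha x]; simp [hc x]
    have hz' : ∀ k : ℤ, ∀ x, b.repr a ((σ ^ k) x) = 0 ↔ b.repr a x = 0 := by
      intro k
      induction k with
      | zero => simp
      | succ k ih => intro x; rw [zpow_add_one, Equiv.Perm.mul_apply, ih, hz]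
      | pred k ih =>
        intro x
        rw [zpow_sub_one, Equiv.Perm.mul_apply, ih, ← hz]
        simp
    have hall : ∀ x, b.repr a x = 0 := by
      intro x
      have h1 := congrFun h0 (Quotient.mk'' x)
      have h2 : (MulAction.orbitRel (Subgroup.zpowers σ) X) (Quotient.out
          (Quotient.mk'' x : MulAction.orbitRel.Quotient (Subgroup.zpowers σ) X)) x :=
        Quotient.exact' (Quotient.out_eq' _)
      obtain ⟨⟨g, k, hk⟩, hg⟩ := MulAction.orbitRel_apply.mp h2
      have h3 : (σ ^ k) x = Quotient.out
          (Quotient.mk'' x : MulAction.orbitRel.Quotient (Subgroup.zpowers σ) X) := by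
        rw [← hg]
        exact congrArg (fun t : Equiv.Perm X => t x) hk
      rw [← hz' k, h3]
      exact h1
    apply Subtype.ext
    exact b.repr.injective (Finsupp.ext fun x => by simp [hall x])
  have := LinearMap.finrank_le_finrank_of_injective hinj
  rwa [Module.finrank_fintype_fun_eq_card, ← Nat.card_eq_fintype_card] at this

/-- Burnside's lemma for a permutation of prime order. -/
lemma card_orbits_of_prime_order {X : Type*} [Finite X] (σ : Equiv.Perm X) {r : ℕ}
    (hr : r.Prime) (hσ : orderOf σ = r) :
    Nat.card (MulAction.orbitRel.Quotient (Subgroup.zpowers σ) X) * r =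
      Nat.card X + (r - 1) * Nat.card {x // σ x = x} ∧
    Nat.card X ≡ Nat.card {x // σ x = x} [MOD r] := by
  classical
  have := Fintype.ofFinite X
  have := Fintype.ofFinite (Subgroup.zpowers σ)
  have := Fintype.ofFinite (MulAction.orbitRel.Quotient (Subgroup.zpowers σ) X)
  have hfact : Fact r.Prime := ⟨hr⟩
  have hcardz : Nat.card (Subgroup.zpowers σ) = r := by rw [Nat.card_zpowers, hσ]
  -- Every nonidentity element generates the same group of prime order and thus has the fixed points
  -- of `σ`. In Burnside's sum the `r - 1` such elements contribute equally.
  have hfix : ∀ g : Subgroup.zpowers σ, g ≠ 1 → ∀ x, g • x = x ↔ σ x = x := by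
    rintro ⟨g, hg⟩ hg1 x
    have hgen : Subgroup.zpowers (⟨g, hg⟩ : Subgroup.zpowers σ) = ⊤ :=
      zpowers_eq_top_of_prime_card hcardz hg1
    constructor
    · intro h
      have hmem : (⟨σ, Subgroup.mem_zpowers σ⟩ : Subgroup.zpowers σ) ∈
          Subgroup.zpowers (⟨g, hg⟩ : Subgroup.zpowers σ) := hgen ▸ Subgroup.mem_top _
      have hstab : Subgroup.zpowers (⟨g, hg⟩ : Subgroup.zpowers σ) ≤
          MulAction.stabilizer (Subgroup.zpowers σ) x := by
        rw [Subgroup.zpowers_le]; exact h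
      exact hstab hmem
    · intro h
      have hstab : Subgroup.zpowers σ ≤ MulAction.stabilizer (Equiv.Perm X) x := by
        rw [Subgroup.zpowers_le]; exact h
      exact hstab hg
  refine ⟨?_, ?_⟩
  · have hb := MulAction.sum_card_fixedBy_eq_card_orbits_mul_card_group (Subgroup.zpowers σ) X
    rw [← Nat.card_eq_fintype_card (α := Subgroup.zpowers σ), hcardz,
      ← Nat.card_eq_fintype_card] at hb
    change _ = Nat.card (MulAction.orbitRel.Quotient (Subgroup.zpowers σ) X) * r at hb
    rw [← hb, ← Finset.add_sum_erase _ _ (Finset.mem_univ 1)]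
    congr 1
    · rw [← Nat.card_eq_fintype_card]
      exact Nat.card_congr (Equiv.subtypeUnivEquiv (p := fun x => x ∈ MulAction.fixedBy X
        (1 : Subgroup.zpowers σ)) fun x => one_smul _ x)
    · rw [Finset.sum_congr rfl (g := fun _ => Nat.card {x // σ x = x})]
      · rw [Finset.sum_const, Finset.card_erase_of_mem (Finset.mem_univ _), Finset.card_univ,
          ← Nat.card_eq_fintype_card, hcardz, smul_eq_mul]
      · intro g hg
        rw [← Nat.card_eq_fintype_card]
        refine Nat.card_congr (Equiv.subtypeEquivRight fun x => ?_)
        exact hfix g (Finset.ne_of_mem_erase hg) x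
  · have hp : IsPGroup r (Subgroup.zpowers σ) := IsPGroup.of_card (n := 1) (by rw [hcardz, pow_one])
    refine (hp.card_modEq_card_fixedPoints X).trans ?_
    have hiff : ∀ x, x ∈ MulAction.fixedPoints (Subgroup.zpowers σ) X ↔ σ x = x := ?_
    · rw [Nat.card_congr (Equiv.subtypeEquivRight hiff)]
    intro x
    constructor
    · intro h
      exact h ⟨σ, Subgroup.mem_zpowers σ⟩
    · rintro h g
      by_cases hg : g = 1
      · simp [hg]
      · exact (hfix g hg x).mpr h

end Monomial

/-! ### Numerical estimates -/

section Arithmetic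

/-- By Fermat's theorem `r` divides Q^(r-1) - 1, and primitivity then excludes r - 1 < e. -/
lemma IsPpd.lt {Q e r : ℕ} (h : IsPpd Q e r) (he : 1 ≤ e) (hQ : 0 < Q) : e < r := by
  obtain ⟨hp, hdvd, hprim⟩ := h
  have hfact : Fact r.Prime := ⟨hp⟩
  have hiff : ∀ i, r ∣ Q ^ i - 1 ↔ (Q : ZMod r) ^ i = 1 := by
    intro i
    rw [← CharP.cast_eq_zero_iff (ZMod r) r, Nat.cast_sub (Nat.one_le_pow _ _ hQ), sub_eq_zero]
    push_cast
    rfl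
  have hne : (Q : ZMod r) ≠ 0 := by
    intro h0
    have := (hiff e).mp hdvd
    rw [h0, zero_pow (by omega)] at this
    exact zero_ne_one this
  by_contra hlt
  push Not at hlt
  have h1 := hprim (r - 1) (by have := hp.two_le; omega) (by have := hp.two_le; omega)
  rw [hiff] at h1
  exact h1 (ZMod.pow_card_sub_one_eq_one hne)

/-- The numerical contradiction behind the absence of stingray elements with large fixed point
space in normalisers of Heisenberg groups. -/
lemma stingray_arithmetic {s m k d e r N : ℕ} (hs : s.Prime) (hd : 8 < d) (he : 2 ≤ e)
    (hed : 2 * e ≤ d) (hr : r.Prime) (her : e < r) (hdm : d ^ 2 = s ^ m) (hk : k < m)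
    (hrs : r ≠ s) (hmod : s ^ m ≡ s ^ k [MOD r])
    (hN : N * r = s ^ m + (r - 1) * s ^ k) (hle : (d - e) ^ 2 + 1 ≤ N) : False := by
  obtain ⟨j, rfl⟩ := Nat.exists_eq_add_of_lt hk
  set t := s ^ (j + 1) with ht
  set c := s ^ k with hc
  have hct : s ^ (k + j + 1) = c * t := by rw [hc, ht, ← pow_add, add_assoc]
  rw [hct] at hdm hmod hN
  have htpos : 1 < t := Nat.one_lt_pow (by omega) hs.one_lt
  -- `r` divides s^m - s^k = c(t - 1) and is prime to `c`.
  have hdvd : r ∣ t - 1 := by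
    have h1 : r ∣ c * t - c := by
      rw [← Nat.modEq_iff_dvd' (Nat.le_mul_of_pos_right _ (by omega))]
      exact hmod.symm
    rw [show c * t - c = c * (t - 1) by rw [Nat.mul_sub, mul_one]] at h1
    refine (Nat.Coprime.dvd_mul_left ?_).mp h1
    rw [hc]
    exact Nat.Coprime.pow_right k ((Nat.coprime_primes hr hs).mpr hrs)
  -- 6 is not a prime power; this rules out t = r + 1 when r = 5.
  have ht6 : t ≠ 6 := by
    intro h6
    have h2 : 2 ∣ s := Nat.prime_two.dvd_of_dvd_pow (n := j + 1) (by rw [← ht, h6]; norm_num)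
    have h3 : 3 ∣ s := Nat.prime_three.dvd_of_dvd_pow (n := j + 1) (by rw [← ht, h6]; norm_num)
    have e2 := (Nat.prime_dvd_prime_iff_eq Nat.prime_two hs).mp h2
    have e3 := (Nat.prime_dvd_prime_iff_eq Nat.prime_three hs).mp h3
    omega
  obtain ⟨m, hm⟩ := hdvd
  have hm1 : 1 ≤ m := by
    rcases Nat.eq_zero_or_pos m with rfl | h
    · omega
    · exact h
  obtain ⟨f, rfl⟩ := Nat.exists_eq_add_of_le (show e ≤ d by omega)
  rw [Nat.add_sub_cancel_left] at hle
  have hle' : (f ^ 2 + 1) * r ≤ (e + f) ^ 2 + (r - 1) * c := by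
    rw [hdm, ← hN]; exact Nat.mul_le_mul_right r hle
  have hcle : c * (r * m + 1) = (e + f) ^ 2 := by rw [hdm]; congr 1; omega
  rcases Nat.lt_or_ge r 7 with h7 | h7
  · have h3r : 3 ≤ r := by omega
    interval_cases r
    · have he2 : e = 2 := by omega
      subst he2
      have h1 : c * 4 ≤ (2 + f) ^ 2 := by rw [← hcle]; exact Nat.mul_le_mul_left c (by omega)
      nlinarith
    · exact absurd hr (by norm_num)
    · have hm2 : 2 ≤ m := by omega
      have h1 : c * 11 ≤ (e + f) ^ 2 := by rw [← hcle]; exact Nat.mul_le_mul_left c (by omega)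
      have h2 : (e + f) ^ 2 ≤ (4 + f) ^ 2 := Nat.pow_le_pow_left (by omega) 2
      have h3 : 5 ≤ f := by omega
      nlinarith
    · exact absurd hr (by norm_num)
  · have h1 : c * (r + 1) ≤ (e + f) ^ 2 := by
      rw [← hcle]; exact Nat.mul_le_mul_left c (by nlinarith)
    have h2 : (e + f) ^ 2 ≤ (2 * f) ^ 2 := Nat.pow_le_pow_left (by omega) 2
    obtain ⟨r, rfl⟩ : ∃ r', r = r' + 1 := ⟨r - 1, by omega⟩
    rw [Nat.add_sub_cancel] at hle'
    have h3 : (f ^ 2 + 1) * (r + 1) * (r + 2) ≤ (e + f) ^ 2 * (r + 2) + r * (e + f) ^ 2 := by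
      calc (f ^ 2 + 1) * (r + 1) * (r + 2) ≤ ((e + f) ^ 2 + r * c) * (r + 2) :=
            Nat.mul_le_mul_right _ hle'
        _ = (e + f) ^ 2 * (r + 2) + r * (c * (r + 1 + 1)) := by ring
        _ ≤ _ := by gcongr
    have h4 : (f ^ 2 + 1) * (r + 2) * (r + 1) ≤ (2 * (2 * f) ^ 2) * (r + 1) := by
      calc (f ^ 2 + 1) * (r + 2) * (r + 1) = (f ^ 2 + 1) * (r + 1) * (r + 2) := by ring
        _ ≤ _ := h3
        _ = (2 * (e + f) ^ 2) * (r + 1) := by ring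
        _ ≤ _ := by gcongr
    have h5 := Nat.le_of_mul_le_mul_right h4 (by omega)
    have h6 : (f ^ 2 + 1) * 8 ≤ (f ^ 2 + 1) * (r + 2) := Nat.mul_le_mul_left _ (by omega)
    have h8 : (2 * f) ^ 2 = 4 * f ^ 2 := by ring
    omega

end Arithmetic

/-! ### Stingray elements do not normalise Heisenberg groups -/

section NoStingray

variable {F V : Type*} [Field F] [AddCommGroup V] [Module F V] [FiniteDimensional F V] [Finite F]
  {s n : ℕ} {R : Subgroup (V ≃ₗ[F] V)}

/-- The centraliser of a stingray element in `End(V)` contains the endomorphisms of its fixed point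
space and a further projection. -/
lemma IsStingrayOn.le_finrank_centralizer {g : V ≃ₗ[F] V} {U : Submodule F V}
    (hg : IsStingrayOn g U) (hU : U ≠ ⊥) (L : Module.End F V →ₗ[F] Module.End F V)
    (hL : ∀ T, L T = toEnd g * T * toEnd g⁻¹) :
    (Module.finrank F V - Module.finrank F U) ^ 2 + 1 ≤
      Module.finrank F (LinearMap.ker (L - LinearMap.id)) := by
  obtain ⟨hcompl, hinv, -, -⟩ := hg
  set W := fixedSpace g
  have hW : ∀ w ∈ W, g w = w := fun w hw => by
    simpa [W, fixedSpace, sub_eq_zero] using hw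
  -- The projection `P` onto the fixed space along `U` satisfies P g = P, so endomorphisms of the
  -- fixed space composed with `P` commute with `g`. The projection onto `U` supplies the extra
  -- dimension.
  let P : V →ₗ[F] W := W.projectionOnto U hcompl.symm
  have hPW : ∀ w : W, P w = w := fun w => Submodule.projectionOnto_apply_left _ w
  have hPU : ∀ u ∈ U, P u = 0 := fun u hu =>
    Submodule.projectionOnto_apply_right hcompl.symm ⟨u, hu⟩
  have hPg : ∀ v, P (g v) = P v := by
    intro v
    obtain ⟨u, hu, w, hw, rfl⟩ : ∃ u ∈ U, ∃ w ∈ W, u + w = v :=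
      Submodule.mem_sup.mp (hcompl.sup_eq_top ▸ Submodule.mem_top)
    rw [map_add, map_add, map_add, hPU u hu, hPU _ (hinv u hu), hW w hw]
  have hmem : ∀ T : Module.End F V, T ∈ LinearMap.ker (L - LinearMap.id) ↔
      ∀ v, g (T v) = T (g v) := by
    intro T
    rw [LinearMap.mem_ker, LinearMap.sub_apply, LinearMap.id_apply, sub_eq_zero, hL]
    constructor
    · intro h v
      have h1 := LinearMap.congr_fun h (g v)
      have h2 : g⁻¹ (g v) = v := g.symm_apply_apply v
      simpa [h2] using h1
    · intro h
      ext v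
      simp [h]
  let Φ : (Module.End F W × F) →ₗ[F] Module.End F V :=
    { toFun := fun p => W.subtype ∘ₗ p.1 ∘ₗ P + p.2 • (LinearMap.id - W.subtype ∘ₗ P)
      map_add' := fun p p' => by ext v; simp [add_smul]; abel
      map_smul' := fun c p => by ext v; simp [smul_smul] }
  have hΦ : ∀ p, Φ p ∈ LinearMap.ker (L - LinearMap.id) := by
    intro p
    rw [hmem]
    intro v
    simp [Φ, hPg, hW _ (Subtype.mem _)]
  have hinj : Function.Injective (Φ.codRestrict _ hΦ) := by
    rw [injective_iff_map_eq_zero]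
    rintro ⟨A, c⟩ h0
    have h1 : ∀ v, Φ (A, c) v = 0 := fun v =>
      LinearMap.congr_fun (congrArg Subtype.val h0) v
    obtain ⟨u, hu, hu0⟩ := Submodule.exists_mem_ne_zero_of_ne_bot hU
    have hc : c = 0 := by
      have := h1 u
      simp [Φ, hPU u hu, hu0] at this
      exact this
    have hA : A = 0 := by
      ext w
      have := h1 w
      simpa [Φ, hPW, hc] using this
    rw [hA, hc]; rfl
  have h := LinearMap.finrank_le_finrank_of_injective hinj
  rw [Module.finrank_prod, Module.finrank_linearMap, Module.finrank_self] at h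
  have hdim := Submodule.finrank_add_eq_of_isCompl hcompl
  have : Module.finrank F V - Module.finrank F U = Module.finrank F W := by omega
  rw [this, sq]
  exact h

/-- The automorphism of `R / Z(R)` induced by an element of the normaliser of `R`. -/
noncomputable def quotientAut (R : Subgroup (V ≃ₗ[F] V))
    (g : Subgroup.normalizer (R : Set (V ≃ₗ[F] V))) : MulAut (R ⧸ Subgroup.center R) :=
  QuotientGroup.congr _ _ (R.normalizerMonoidHom g)
    (Subgroup.characteristic_iff_map_eq.mp inferInstance (R.normalizerMonoidHom g))

lemma quotientAut_mk (g : Subgroup.normalizer (R : Set (V ≃ₗ[F] V))) (x : R) :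
    quotientAut R g (x : R ⧸ Subgroup.center R) = (R.normalizerMonoidHom g x : R) := rfl

lemma normalizerMonoidHom_coe (g : Subgroup.normalizer (R : Set (V ≃ₗ[F] V))) (x : R) :
    ((R.normalizerMonoidHom g x : R) : V ≃ₗ[F] V) = g * x * (g : V ≃ₗ[F] V)⁻¹ := rfl

lemma quotientAut_pow (g : Subgroup.normalizer (R : Set (V ≃ₗ[F] V))) (k : ℕ) :
    quotientAut R g ^ k = quotientAut R (g ^ k) := by
  induction k with
  | zero =>
    ext x
    induction x using QuotientGroup.induction_on with
    | H x => rw [pow_zero, pow_zero, quotientAut_mk, map_one]; rfl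
  | succ k ih =>
    ext x
    induction x using QuotientGroup.induction_on with
    | H x =>
      rw [pow_succ, pow_succ, ih, quotientAut_mk, map_mul]
      rfl

/-- The normaliser of a Heisenberg group contains no stingray element of order a primitive
prime divisor and with fixed point space of dimension at least half the dimension of `V`. -/
theorem IsHeisenberg.not_mem_normalizer_of_isStingray (h : IsHeisenberg s n R) {e r : ℕ}
    (hd : 8 < Module.finrank F V) (he : 2 ≤ e) (hed : 2 * e ≤ Module.finrank F V)
    (hr : IsPpd (Nat.card F) e r) {g : V ≃ₗ[F] V} (hg : IsStingray e g) (ho : orderOf g = r) :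
    g ∉ Subgroup.normalizer (R : Set (V ≃ₗ[F] V)) := by
  intro hgR
  have := h.nontrivial
  have := h.finite_quotient
  obtain ⟨U, hU, hUe⟩ := hg
  -- `s` divides |F| - 1, which a primitive divisor for an exponent `e ≥ 2` does not.
  have hrs : r ≠ s := by
    rintro rfl
    exact hr.2.2 1 le_rfl (by omega) (by rw [pow_one]; exact h.dvd)
  set γ : Subgroup.normalizer (R : Set (V ≃ₗ[F] V)) := ⟨g, hgR⟩
  set σ := quotientAut R γ with hσ
  have hγr : γ ^ r = 1 := Subtype.ext (by rw [← ho]; exact pow_orderOf_eq_one g)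
  have hσr : σ ^ r = 1 := by
    rw [hσ, quotientAut_pow, hγr]
    ext x
    induction x using QuotientGroup.induction_on with
    | H x => rw [quotientAut_mk, map_one]; rfl
  -- conjugates of the basis elements
  have hconj : ∀ x : R ⧸ Subgroup.center R, ∃ c : F, c ≠ 0 ∧
      (∃ k : ℕ, c ^ s ^ k = 1) ∧
      toEnd g * h.basis x * toEnd g⁻¹ = c • h.basis (σ x) := by
    intro x
    have h1 : σ x = (R.normalizerMonoidHom γ x.out : R) := by
      conv_lhs => rw [← Quotient.out_eq x]
      exact quotientAut_mk γ x.out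
    have h2 : ((Quotient.out (σ x) : R) : R ⧸ Subgroup.center R) =
        (R.normalizerMonoidHom γ x.out : R) := by
      rw [← h1]; exact Quotient.out_eq _
    have h3 := QuotientGroup.eq.mp h2
    obtain ⟨c, hc⟩ := h.exists_scalar_of_mem_center h3
    obtain ⟨k, hk⟩ := h.card_center
    have hpow : ∀ m : ℕ, toEnd ((((Quotient.out (σ x) : R)⁻¹ *
        R.normalizerMonoidHom γ x.out) ^ m : R) : V ≃ₗ[F] V) = c ^ m • 1 := by
      intro m
      induction m with
      | zero => rw [pow_zero, pow_zero, one_smul]; rfl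
      | succ m ih =>
        rw [pow_succ, Subgroup.coe_mul, toEnd_mul, ih, hc, smul_mul_smul_comm, one_mul, pow_succ]
    refine ⟨c, ?_, ⟨k, ?_⟩, ?_⟩
    · rintro rfl
      rw [zero_smul] at hc
      exact toEnd_ne_zero _ hc
    · have h4 := hpow (s ^ k)
      have h5 : ((Quotient.out (σ x) : R)⁻¹ * R.normalizerMonoidHom γ x.out) ^ s ^ k = 1 := by
        have : (⟨_, h3⟩ : Subgroup.center R) ^ s ^ k = 1 := by
          rw [← hk]; exact pow_card_eq_one'
        exact congrArg Subtype.val this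
      rw [h5] at h4
      obtain ⟨v, hv⟩ := exists_ne (0 : V)
      have h6 := LinearMap.congr_fun h4 v
      have h7 : v = c ^ s ^ k • v := h6
      have h8 : (1 - c ^ s ^ k) • v = 0 := by rw [sub_smul, one_smul, ← h7, sub_self]
      exact (sub_eq_zero.mp ((smul_eq_zero.mp h8).resolve_right hv)).symm
    · rw [h.basis_apply, h.basis_apply]
      have h4 : toEnd ((Quotient.out (σ x) : R) : V ≃ₗ[F] V) * toEnd ((((Quotient.out (σ x) : R)⁻¹ *
        R.normalizerMonoidHom γ x.out) : R) : V ≃ₗ[F] V) =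
          toEnd ((R.normalizerMonoidHom γ x.out : R) : V ≃ₗ[F] V) := by
        rw [← toEnd_mul, ← Subgroup.coe_mul, mul_inv_cancel_left]
      rw [hc, mul_smul_comm, mul_one, normalizerMonoidHom_coe] at h4
      rw [h4]; rfl
  choose c hc0 hcs hc using hconj
  let L : Module.End F V →ₗ[F] Module.End F V :=
    LinearMap.mulLeft F (toEnd g) ∘ₗ LinearMap.mulRight F (toEnd g⁻¹)
  have hL : ∀ T, L T = toEnd g * T * toEnd g⁻¹ := fun T => by simp [L, mul_assoc]
  -- `g` does not centralise the quotient
  have hr1 := hr.1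
  have hσ1 : σ ≠ 1 := by
    -- If `σ = 1`, conjugation by `g` multiplies each basis element by a scalar whose order divides
    -- both `r` and a power of `s`, hence by 1. Then `g` is a scalar, equal to 1 because it has
    -- nonzero fixed vectors, against its nontrivial action on `U`.
    intro h1
    have hfix : ∀ x, toEnd g * h.basis x = h.basis x * toEnd g := by
      intro x
      have h2 : toEnd g * h.basis x = c x • h.basis x * toEnd g := by
        have h3 := congrArg (· * toEnd g) (hc x)
        simp only [mul_assoc, toEnd_inv_mul, mul_one, h1, MulAut.one_apply] at h3
        exact h3
      have h3 : ∀ m : ℕ, toEnd (g ^ m) * h.basis x = c x ^ m • h.basis x * toEnd (g ^ m) := by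
        intro m
        induction m with
        | zero => rw [pow_zero, pow_zero, one_smul, toEnd_one, one_mul, mul_one]
        | succ m ih =>
          rw [pow_succ, toEnd_mul, mul_assoc, h2, ← mul_assoc, mul_smul_comm, ih, pow_succ',
            smul_mul_assoc, smul_mul_assoc, smul_mul_assoc, smul_mul_assoc, smul_smul, mul_assoc]
      have h4 := h3 r
      rw [← ho, pow_orderOf_eq_one, toEnd_one, one_mul, mul_one, ho] at h4
      have h5 : c x ^ r = 1 := by
        have h6 : (1 - c x ^ r) • h.basis x = 0 := by rw [sub_smul, one_smul, ← h4, sub_self]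
        exact (sub_eq_zero.mp ((smul_eq_zero.mp h6).resolve_right (h.basis.ne_zero x))).symm
      obtain ⟨k, hk⟩ := hcs x
      have h6 : c x = 1 := by
        have hcop : Nat.Coprime r (s ^ k) :=
          Nat.Coprime.pow_right k ((Nat.coprime_primes hr1 h.prime).mpr hrs)
        have := Nat.dvd_gcd (orderOf_dvd_of_pow_eq_one h5) (orderOf_dvd_of_pow_eq_one hk)
        rw [hcop, Nat.dvd_one] at this
        exact orderOf_eq_one_iff.mp this
      rw [h2, h6, one_smul]
    obtain ⟨a, ha⟩ : ∃ a : F, toEnd g = a • 1 := by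
      refine exists_scalar_of_commute (R := Set.range fun x : R ⧸ Subgroup.center R =>
        ((Quotient.out x : R) : V ≃ₗ[F] V)) ?_ _ ?_
      · rw [eq_top_iff, ← h.basis.span_eq]
        apply Submodule.span_mono
        rintro _ ⟨x, rfl⟩
        exact ⟨_, ⟨x, rfl⟩, (h.basis_apply x).symm⟩
      · rintro _ ⟨x, rfl⟩
        rw [← h.basis_apply]
        exact hfix x
    have hdim := Submodule.finrank_add_eq_of_isCompl hU.1
    have hne : fixedSpace g ≠ ⊥ := by
      intro hb
      rw [hb, finrank_bot] at hdim
      omega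
    obtain ⟨w, hw, hw0⟩ := Submodule.exists_mem_ne_zero_of_ne_bot hne
    have hgw : g w = w := by simpa [fixedSpace, sub_eq_zero] using hw
    have hav : ∀ v, g v = a • v := fun v => LinearMap.congr_fun ha v
    have ha1 : a = 1 := by
      have h6 : (a - 1) • w = 0 := by rw [sub_smul, one_smul, ← hav, hgw, sub_self]
      exact sub_eq_zero.mp ((smul_eq_zero.mp h6).resolve_right hw0)
    obtain ⟨u, -, hu⟩ := hU.2.2.1
    exact hu (by rw [hav, ha1, one_smul])
  let τ : Equiv.Perm (R ⧸ Subgroup.center R) := σ.toEquiv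
  have hτr : orderOf τ = r := by
    have : Fact r.Prime := ⟨hr1⟩
    refine orderOf_eq_prime ?_ ?_
    · have hpow : ∀ k : ℕ, ∀ x, (τ ^ k) x = (σ ^ k) x := by
        intro k
        induction k with
        | zero => intro x; rfl
        | succ k ih => intro x; rw [pow_succ, pow_succ]; exact ih _
      ext x
      rw [hpow, hσr]; rfl
    · intro h1
      apply hσ1
      ext x
      exact congrArg (fun t : Equiv.Perm _ => t x) h1
  obtain ⟨hN, hmod⟩ := card_orbits_of_prime_order τ hr1 hτr
  -- The fixed space of conjugation by `g` is the centraliser of `g`: orbits bound it from above,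
  -- the stingray structure from below.
  have hup := finrank_fixed_le_card_orbits h.basis τ L c hc0 (fun x => by rw [hL]; exact hc x)
  have hUbot : U ≠ ⊥ := by
    rintro rfl
    rw [finrank_bot] at hUe
    omega
  have hlow := hU.le_finrank_centralizer hUbot L hL
  -- the fixed points form a subgroup
  let C : Subgroup (R ⧸ Subgroup.center R) :=
    { carrier := {x | σ x = x}
      one_mem' := map_one σ
      mul_mem' := fun {a b} ha hb => by
        simp only [Set.mem_ofPred_eq] at ha hb ⊢
        rw [map_mul, ha, hb]
      inv_mem' := fun {a} ha => by
        simp only [Set.mem_ofPred_eq] at ha ⊢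
        rw [map_inv, ha] }
  have hcardQ : Nat.card (R ⧸ Subgroup.center R) = s ^ (2 * n) := by
    rw [← Subgroup.index_eq_card, h.index]
  have hCcard : Nat.card {x // τ x = x} = Nat.card C := rfl
  obtain ⟨k, hk2, hk⟩ := (Nat.dvd_prime_pow h.prime).mp (hcardQ ▸ Subgroup.card_subgroup_dvd_card C)
  have hklt : k < 2 * n := by
    refine lt_of_le_of_ne hk2 fun hkk => hσ1 ?_
    have hCtop : C = ⊤ := Subgroup.eq_top_of_card_eq C (by rw [hk, hcardQ, hkk])
    ext x
    have hx : x ∈ C := hCtop ▸ Subgroup.mem_top x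
    exact hx
  rw [hCcard, hk, hcardQ] at hN hmod
  refine stingray_arithmetic h.prime hd he hed hr1 (hr.lt (by omega) Nat.card_pos) ?_ hklt hrs hmod
    hN (le_trans ?_ hup)
  · rw [h.finrank, ← pow_mul, mul_comm]
  · rwa [hUe] at hlow

/-- No stingray duo generates a subgroup of a member of the sixth category. -/
theorem duosSix_eq_empty {G : Subgroup (V ≃ₗ[F] V)} {e₁ e₂ r₂ : ℕ} {g₁ g₂ : V ≃ₗ[F] V}
    (hd : 8 < Module.finrank F V) (hsum : e₁ + e₂ = Module.finrank F V) (he₂ : 2 ≤ e₂)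
    (he : e₂ ≤ e₁) (hr₂ : IsPpd (Nat.card F) e₂ r₂) (ho₂ : orderOf g₂ = r₂) :
    duosSix G e₁ e₂ g₁ g₂ = ∅ := by
  rw [Set.eq_empty_iff_forall_notMem]
  rintro ⟨x, y⟩ ⟨⟨-, ⟨k, -, hy⟩, -, -, U, U', -, -, hyU, hU', -⟩, ⟨M, ⟨s, n, R, hs, hdvd, -, hV, -,
    hR, rfl⟩, hM⟩, -⟩
  have hHeis : IsHeisenberg s n R := by
    rcases hR with hR | ⟨rfl, hR⟩
    · exact IsHeisenberg.of_isExtraspecial hs hdvd hV hR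
    · exact IsHeisenberg.of_isFourCircExtraspecial hdvd hV hR
  -- As `e₂ ≤ e₁`, the second element satisfies 2e₂ ≤ d, and conjugation keeps its order; so it
  -- cannot normalise `R`.
  have hyR : y ∈ Subgroup.normalizer (R : Set (V ≃ₗ[F] V)) :=
    (hM (Subgroup.subset_closure (by simp))).2
  refine hHeis.not_mem_normalizer_of_isStingray hd he₂ (by omega) hr₂ ⟨U', hyU, hU'⟩ ?_ hyR
  have hy' : y = k * g₂ * k⁻¹ := hy
  rw [hy', ← ho₂]
  exact orderOf_injective (MulAut.conj k).toMonoidHom (MulAut.conj k).injective g₂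

end NoStingray

/-! ### Bilinear pairings and orthogonal complements -/

section Pairing

variable {K V : Type*} [Field K] [AddCommGroup V] [Module K V] [FiniteDimensional K V]

/-- Every functional on a subspace is given by pairing with a vector, depending linearly on it. -/
lemma exists_dual_section (B : V →ₗ[K] V →ₗ[K] K) (hB : ∀ v, (∀ w, B w v = 0) → v = 0)
    (W : Submodule K V) :
    ∃ j : Module.Dual K W →ₗ[K] V, ∀ (w : W) f, B w (j f) = f w := by
  have hinj : Function.Injective B.flip := by
    rw [injective_iff_map_eq_zero]
    intro v hv
    exact hB v fun w => by simpa using LinearMap.congr_fun hv w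
  have hsurj : Function.Surjective B.flip :=
    (LinearMap.injective_iff_surjective_of_finrank_eq_finrank
      (Subspace.dual_finrank_eq (K := K) (V := V)).symm).mp hinj
  have hsurj' : Function.Surjective (W.dualRestrict ∘ₗ B.flip) :=
    (Subspace.dualRestrict_surjective (W := W)).comp hsurj
  obtain ⟨j, hj⟩ := LinearMap.exists_rightInverse_of_surjective _
    (LinearMap.range_eq_top.mpr hsurj')
  refine ⟨j, fun w f => ?_⟩
  have := LinearMap.congr_fun (LinearMap.congr_fun hj f) w
  simpa using this

/-- The space of vectors orthogonal to `W`. -/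
def perp (B : V →ₗ[K] V →ₗ[K] K) (W : Submodule K V) : Submodule K V :=
  LinearMap.ker (W.dualRestrict ∘ₗ B.flip)

lemma mem_perp {B : V →ₗ[K] V →ₗ[K] K} {W : Submodule K V} {v : V} :
    v ∈ perp B W ↔ ∀ w ∈ W, B w v = 0 := by
  rw [perp, LinearMap.mem_ker]
  constructor
  · intro h w hw
    exact LinearMap.congr_fun h ⟨w, hw⟩
  · intro h
    ext w
    exact h w w.2

/-- By nondegeneracy the map from `V` to the dual of `W` is surjective, and `perp B W` is its
kernel. -/
lemma finrank_add_finrank_perp (B : V →ₗ[K] V →ₗ[K] K) (hB : ∀ v, (∀ w, B w v = 0) → v = 0)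
    (W : Submodule K V) :
    Module.finrank K W + Module.finrank K (perp B W) = Module.finrank K V := by
  obtain ⟨j, hj⟩ := exists_dual_section B hB W
  have hr : LinearMap.range (W.dualRestrict ∘ₗ B.flip) = ⊤ := by
    rw [LinearMap.range_eq_top]
    intro f
    exact ⟨j f, by ext w; exact hj w f⟩
  have := LinearMap.finrank_range_add_finrank_ker (W.dualRestrict ∘ₗ B.flip)
  rw [hr, finrank_top, Subspace.dual_finrank_eq] at this
  exact this

lemma two_mul_finrank_le_of_isotropic (B : V →ₗ[K] V →ₗ[K] K)
    (hB : ∀ v, (∀ w, B w v = 0) → v = 0) (W : Submodule K V)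
    (hW : ∀ v ∈ W, ∀ w ∈ W, B v w = 0) : 2 * Module.finrank K W ≤ Module.finrank K V := by
  have h1 : W ≤ perp B W := fun v hv => mem_perp.mpr fun w hw => hW w hw v hv
  have h2 := Submodule.finrank_mono h1
  have h3 := finrank_add_finrank_perp B hB W
  omega

end Pairing

/-! ### Hyperbolic decomposition of alternating spaces -/

section Alternating

variable {K : Type*} [Field K]

/-- An alternating form is the antisymmetrization of a bilinear form. -/
lemma exists_sub_flip_eq {U : Type*} [AddCommGroup U] [Module K U] [FiniteDimensional K U]
    (B : U →ₗ[K] U →ₗ[K] K) (hB : ∀ v, B v v = 0) :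
    ∃ β : U →ₗ[K] U →ₗ[K] K, ∀ u v, β u v - β v u = B u v := by
  let b := Module.finBasis K U
  have hneg : ∀ u v, B v u = - B u v := by
    intro u v
    have h := hB (u + v)
    simp only [map_add, LinearMap.add_apply, hB, zero_add, add_zero] at h
    exact eq_neg_of_add_eq_zero_left h
  -- The strictly upper triangular half of the Gram matrix; unlike division by 2 this works in
  -- characteristic two.
  let β : U →ₗ[K] U →ₗ[K] K :=
    b.constr K fun i => b.constr K fun j => if i < j then B (b i) (b j) else 0
  refine ⟨β, fun u v => ?_⟩
  have : β - β.flip = B := by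
    refine b.ext fun i => b.ext fun j => ?_
    simp only [β, LinearMap.sub_apply, LinearMap.flip_apply, Module.Basis.constr_basis]
    rcases lt_trichotomy i j with h | h | h
    · simp [h, h.not_gt]
    · simp [h, hB]
    · simp [h, h.not_gt, hneg (b i) (b j)]
  rw [← this]; simp

variable {V V' : Type*} [AddCommGroup V] [Module K V] [FiniteDimensional K V]
  [AddCommGroup V'] [Module K V'] [FiniteDimensional K V']

/-- A nondegenerate alternating space is isometric to a hyperbolic one. -/
lemma exists_hyperbolic_of_alternating (B : V →ₗ[K] V →ₗ[K] K) (hB : ∀ v, B v v = 0)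
    (hnd : ∀ v, (∀ w, B v w = 0) → v = 0) :
    ∃ (W : Submodule K V) (e : (W × Module.Dual K W) ≃ₗ[K] V),
      2 * Module.finrank K W = Module.finrank K V ∧
      ∀ p p', B (e p) (e p') = p'.2 p.1 - p.2 p'.1 := by
  have hneg : ∀ u v, B v u = - B u v := by
    intro u v
    have h := hB (u + v)
    simp only [map_add, LinearMap.add_apply, hB, zero_add, add_zero] at h
    exact eq_neg_of_add_eq_zero_left h
  have hnd' : ∀ v, (∀ w, B w v = 0) → v = 0 := fun v hv => hnd v fun w => by
    rw [hneg, hv, neg_zero]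
  -- A maximal totally isotropic subspace is its own orthogonal complement, since any further
  -- orthogonal vector could be adjoined.
  obtain ⟨W, hW, hmax⟩ := (wellFounded_gt (α := Submodule K V)).has_min
    {W | ∀ v ∈ W, ∀ w ∈ W, B v w = 0} ⟨⊥, by simp⟩
  have hperp : perp B W = W := by
    apply le_antisymm
    · intro x hx
      rw [mem_perp] at hx
      by_contra hxW
      refine hmax (W ⊔ Submodule.span K {x}) ?_ ?_
      · intro v hv w hw
        obtain ⟨v1, hv1, v2, hv2, rfl⟩ := Submodule.mem_sup.mp hv
        obtain ⟨w1, hw1, w2, hw2, rfl⟩ := Submodule.mem_sup.mp hw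
        obtain ⟨a, rfl⟩ := Submodule.mem_span_singleton.mp hv2
        obtain ⟨c, rfl⟩ := Submodule.mem_span_singleton.mp hw2
        simp [hW v1 hv1 w1 hw1, hx v1 hv1, hneg w1 x, hx w1 hw1, hB]
      · refine lt_of_le_of_ne le_sup_left fun h => hxW ?_
        rw [h]
        exact Submodule.mem_sup_right (Submodule.mem_span_singleton_self x)
    · exact fun v hv => mem_perp.mpr fun w hw => hW w hw v hv
  have hdim := finrank_add_finrank_perp B hnd' W
  rw [hperp, ← two_mul] at hdim
  obtain ⟨j₀, hj₀⟩ := exists_dual_section B hnd' W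
  -- The image of `j₀` need not be isotropic. Subtracting the `W`-valued map `m` that represents `β`
  -- cancels B(j₀ f, j₀ f') and does not change the pairing with `W`.
  obtain ⟨β, hβ⟩ := exists_sub_flip_eq (B.compl₁₂ j₀ j₀) (fun f => hB _)
  let m : Module.Dual K W →ₗ[K] W := (Module.evalEquiv K W).symm.toLinearMap ∘ₗ β
  have hm : ∀ f f', f' (m f) = β f f' := fun f f' => by
    simp [m, Module.apply_evalEquiv_symm_apply]
  let e : (W × Module.Dual K W) →ₗ[K] V :=
    LinearMap.coprod W.subtype (j₀ - W.subtype ∘ₗ m)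
  have he : ∀ p p', B (e p) (e p') = p'.2 p.1 - p.2 p'.1 := by
    rintro ⟨w, f⟩ ⟨w', f'⟩
    have h1 := hβ f f'
    rw [LinearMap.compl₁₂_apply] at h1
    simp only [e, LinearMap.coprod_apply, Submodule.subtype_apply, LinearMap.sub_apply,
      LinearMap.comp_apply, map_add, map_sub, LinearMap.add_apply, hW _ w.2 _ w'.2,
      hW _ w.2 _ (m f').2, hW _ (m f).2 _ w'.2, hW _ (m f).2 _ (m f').2, hj₀, hm,
      hneg (w' : V) (j₀ f), hneg (m f' : V) (j₀ f), ← h1]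
    ring
  have hinj : Function.Injective e := by
    rw [injective_iff_map_eq_zero]
    rintro ⟨w, f⟩ h0
    have h1 : ∀ p' : W × Module.Dual K W, p'.2 w - f p'.1 = 0 := fun p' => by
      rw [← he (w, f) p', h0]; simp
    have hf : f = 0 := by
      ext w'
      simpa using h1 (w', 0)
    have hw : w = 0 := by
      rw [← Module.forall_dual_apply_eq_zero_iff K]
      intro f'
      simpa using h1 (0, f')
    rw [hf, hw]; rfl
  have hfin : Module.finrank K (W × Module.Dual K W) = Module.finrank K V := by
    rw [Module.finrank_prod, Subspace.dual_finrank_eq, ← two_mul, hdim]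
  exact ⟨W, LinearEquiv.ofInjectiveOfFinrankEq e hinj hfin, hdim, he⟩

/-- Nondegenerate alternating spaces of the same dimension are isometric. -/
lemma exists_isometry_of_alternating (B : V →ₗ[K] V →ₗ[K] K) (hB : ∀ v, B v v = 0)
    (hnd : ∀ v, (∀ w, B v w = 0) → v = 0) (B' : V' →ₗ[K] V' →ₗ[K] K) (hB' : ∀ v, B' v v = 0)
    (hnd' : ∀ v, (∀ w, B' v w = 0) → v = 0) (hdim : Module.finrank K V = Module.finrank K V') :
    ∃ T : V ≃ₗ[K] V', ∀ v w, B' (T v) (T w) = B v w := by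
  obtain ⟨W, e, hW, he⟩ := exists_hyperbolic_of_alternating B hB hnd
  obtain ⟨W', e', hW', he'⟩ := exists_hyperbolic_of_alternating B' hB' hnd'
  let φ : W ≃ₗ[K] W' := LinearEquiv.ofFinrankEq W W' (by omega)
  refine ⟨e.symm.trans ((LinearEquiv.prodCongr φ φ.symm.dualMap).trans e'), fun v w => ?_⟩
  obtain ⟨p, rfl⟩ := e.surjective v
  obtain ⟨p', rfl⟩ := e.surjective w
  simp [he, he']

end Alternating

/-! ### Hyperbolic decomposition of quadratic spaces -/

section Quadratic

variable {K : Type*} [Field K] {V V' : Type*} [AddCommGroup V] [Module K V]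
  [FiniteDimensional K V] [AddCommGroup V'] [Module K V'] [FiniteDimensional K V']

lemma polarBilin_eq (Q : QuadraticForm K V) (v w : V) :
    Q.polarBilin v w = QuadraticMap.polar Q v w := rfl

lemma QuadraticNondegenerate.right {Q : QuadraticForm K V} (hQ : QuadraticNondegenerate Q) :
    ∀ v, (∀ w, Q.polarBilin w v = 0) → v = 0 := fun v hv => hQ v fun w => by
  rw [QuadraticMap.polar_comm]; exact hv w

/-- A totally singular subspace is part of a hyperbolic subspace. -/
lemma exists_singular_section {Q : QuadraticForm K V} (hQ : QuadraticNondegenerate Q)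
    (W : Submodule K V) (hW : ∀ w ∈ W, Q w = 0) :
    ∃ j : Module.Dual K W →ₗ[K] V, (∀ (w : W) f, Q.polarBilin w (j f) = f w) ∧
      ∀ f, Q (j f) = 0 := by
  obtain ⟨j₀, hj₀⟩ := exists_dual_section Q.polarBilin hQ.right W
  let Q₀ : QuadraticForm K (Module.Dual K W) := Q.comp j₀
  let b := Module.finBasis K (Module.Dual K W)
  -- `β` has Q(j₀ f) on its diagonal. Subtracting the `W`-valued map that represents it makes the
  -- complement totally singular, in every characteristic.
  let β := Q₀.toBilin b
  have hβ : ∀ f, β f f = Q (j₀ f) := fun f =>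
    congrArg (fun q : QuadraticForm K _ => q f) (Q₀.toQuadraticMap_toBilin b)
  let m : Module.Dual K W →ₗ[K] W := (Module.evalEquiv K W).symm.toLinearMap ∘ₗ β
  have hm : ∀ f f', f' (m f) = β f f' := fun f f' => by
    simp [m, Module.apply_evalEquiv_symm_apply]
  have hWW : ∀ w w' : W, Q.polarBilin (w : V) (w' : V) = 0 := fun w w' => by
    rw [polarBilin_eq, QuadraticMap.polar, hW _ (W.add_mem w.2 w'.2), hW _ w.2, hW _ w'.2]; simp
  refine ⟨j₀ - W.subtype ∘ₗ m, fun w f => ?_, fun f => ?_⟩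
  · simp only [LinearMap.sub_apply, map_sub, LinearMap.comp_apply, Submodule.subtype_apply, hj₀,
      hWW, sub_zero]
  · have h1 : Q (j₀ f + -(m f : V)) = Q (j₀ f) + Q (-(m f : V)) +
        Q.polarBilin (j₀ f) (-(m f : V)) := by
      rw [polarBilin_eq, QuadraticMap.polar]; ring
    have h2 : Q.polarBilin (j₀ f) (m f : V) = β f f := by
      rw [polarBilin_eq, QuadraticMap.polar_comm, ← polarBilin_eq, hj₀, hm]
    simp only [LinearMap.sub_apply, LinearMap.comp_apply, Submodule.subtype_apply]
    rw [sub_eq_add_neg, h1, LinearMap.map_neg, h2, QuadraticMap.map_neg, hW _ (m f).2, hβ]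
    ring

/-- Decomposition of a quadratic space into a hyperbolic space and its orthogonal complement. -/
lemma exists_hyperbolic_decomposition {Q : QuadraticForm K V} (hQ : QuadraticNondegenerate Q)
    (W : Submodule K V) (hW : ∀ w ∈ W, Q w = 0) :
    ∃ (P : Submodule K V) (e : ((W × Module.Dual K W) × P) ≃ₗ[K] V),
      (∀ p ∈ P, ∀ w ∈ W, Q.polarBilin w p = 0) ∧ (∀ p ∈ P, p ∈ W → p = 0) ∧
      ∀ w f p, Q (e ((w, f), p)) = f w + Q p := by
  obtain ⟨j, hj, hjQ⟩ := exists_singular_section hQ W hW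
  have hsymm : ∀ v w, Q.polarBilin v w = Q.polarBilin w v := fun v w =>
    QuadraticMap.polar_comm Q v w
  have hadd : ∀ v w, Q (v + w) = Q v + Q w + Q.polarBilin v w := fun v w => by
    rw [polarBilin_eq, QuadraticMap.polar]; ring
  have hWW : ∀ w w' : W, Q.polarBilin (w : V) (w' : V) = 0 := fun w w' => by
    rw [polarBilin_eq, QuadraticMap.polar, hW _ (W.add_mem w.2 w'.2), hW _ w.2, hW _ w'.2]; simp
  have hjj : ∀ f f', Q.polarBilin (j f) (j f') = 0 := fun f f' => by
    rw [polarBilin_eq, QuadraticMap.polar, ← map_add, hjQ, hjQ, hjQ]; simp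
  let P : Submodule K V := perp Q.polarBilin W ⊓ perp Q.polarBilin (LinearMap.range j)
  have hP1 : ∀ p ∈ P, ∀ w ∈ W, Q.polarBilin w p = 0 := fun p hp => mem_perp.mp hp.1
  have hP2 : ∀ p ∈ P, ∀ f, Q.polarBilin (j f) p = 0 := fun p hp f =>
    mem_perp.mp hp.2 _ ⟨f, rfl⟩
  have hPW : ∀ p ∈ P, p ∈ W → p = 0 := by
    intro p hp hpW
    have : (⟨p, hpW⟩ : W) = 0 := by
      rw [← Module.forall_dual_apply_eq_zero_iff K]
      intro f
      rw [← hj, hsymm]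
      exact hP2 p hp f
    exact congrArg Subtype.val this
  let e : ((W × Module.Dual K W) × P) →ₗ[K] V :=
    LinearMap.coprod (LinearMap.coprod W.subtype j) P.subtype
  have he : ∀ w f p, e ((w, f), p) = w + j f + p := fun w f p => by simp [e]
  have hinj : Function.Injective e := by
    rw [injective_iff_map_eq_zero]
    rintro ⟨⟨w, f⟩, p⟩ h0
    rw [he] at h0
    have hf : f = 0 := by
      ext w'
      have h1 := congrArg (Q.polarBilin (w' : V)) h0
      rw [map_add, map_add, hWW, hj, hP1 p p.2 w' w'.2, map_zero] at h1
      simpa using h1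
    have hw : w = 0 := by
      rw [← Module.forall_dual_apply_eq_zero_iff K]
      intro f'
      have h1 := congrArg (Q.polarBilin (j f')) h0
      rw [map_add, map_add, hjj, hsymm (j f') (w : V), hj, hP2 p p.2 f', map_zero] at h1
      simpa using h1
    have hp : p = 0 := by
      rw [hf, hw] at h0
      simpa using h0
    rw [hf, hw, hp]; rfl
  have hsurj : Function.Surjective e := by
    intro v
    -- The components of `v` in `W` and in the image of `j` are read off from its pairings with the
    -- opposite summand.
    let f : Module.Dual K W := (Q.polarBilin.flip v) ∘ₗ W.subtype
    let w : W := (Module.evalEquiv K W).symm ((Q.polarBilin.flip v) ∘ₗ j)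
    have hw : ∀ f', f' w = Q.polarBilin (j f') v := fun f' => by
      simp [w, Module.apply_evalEquiv_symm_apply]
    have hp : v - w - j f ∈ P := by
      refine ⟨mem_perp.mpr fun w' hw' => ?_, mem_perp.mpr ?_⟩
      · rw [map_sub, map_sub, hWW ⟨w', hw'⟩ w, hj ⟨w', hw'⟩ f]
        simp [f]
      · rintro _ ⟨f', rfl⟩
        rw [map_sub, map_sub, hjj, hsymm (j f') (w : V), hj, hw]
        simp
    refine ⟨((w, f), ⟨_, hp⟩), ?_⟩
    rw [he]
    simp only
    abel
  refine ⟨P, LinearEquiv.ofBijective e ⟨hinj, hsurj⟩, hP1, hPW, fun w f p => ?_⟩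
  change Q (e ((w, f), p)) = _
  rw [he, hadd, hadd, hW _ w.2, hjQ, map_add,
    LinearMap.add_apply, hP1 p p.2 w w.2, hP2 p p.2 f, hj]
  ring

/-- Quadratic spaces of plus type and of the same dimension are isometric. -/
lemma exists_isometry_of_isPlusType {Q : QuadraticForm K V} {Q' : QuadraticForm K V'}
    (hQ : IsPlusType Q) (hQ' : IsPlusType Q')
    (hdim : Module.finrank K V = Module.finrank K V') :
    ∃ T : V ≃ₗ[K] V', ∀ v, Q' (T v) = Q v := by
  obtain ⟨-, hnd, W, hWd, hW⟩ := hQ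
  obtain ⟨-, hnd', W', hWd', hW'⟩ := hQ'
  obtain ⟨P, e, -, -, he⟩ := exists_hyperbolic_decomposition hnd W hW
  obtain ⟨P', e', -, -, he'⟩ := exists_hyperbolic_decomposition hnd' W' hW'
  let φ : W ≃ₗ[K] W' := LinearEquiv.ofFinrankEq W W' (by omega)
  have h1 := e.finrank_eq
  have h2 := e'.finrank_eq
  rw [Module.finrank_prod, Module.finrank_prod, Subspace.dual_finrank_eq] at h1 h2
  -- With a singular subspace of half the dimension, the hyperbolic part is the whole space.
  have hP : Subsingleton P := Module.finrank_zero_iff (R := K).mp (by omega)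
  have hP' : Module.finrank K P' = 0 := by omega
  let ψ : P ≃ₗ[K] P' := LinearEquiv.ofFinrankEq P P' (by omega)
  refine ⟨e.symm.trans ((LinearEquiv.prodCongr (LinearEquiv.prodCongr φ φ.symm.dualMap) ψ).trans
    e'), fun v => ?_⟩
  obtain ⟨⟨⟨w, f⟩, p⟩, rfl⟩ := e.surjective v
  have hp : p = 0 := Subsingleton.elim _ _
  simp [he, he', hp]

end Quadratic

/-! ### Quadratic forms over the field of two elements and their orthogonal groups -/

section BinaryQuadratic

variable {E E' : Type*} [AddCommGroup E] [Module (ZMod 2) E] [FiniteDimensional (ZMod 2) E]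
  [AddCommGroup E'] [Module (ZMod 2) E'] [FiniteDimensional (ZMod 2) E']

lemma zmod_two_cases (z : ZMod 2) : z = 0 ∨ z = 1 := by
  revert z; decide

lemma zmod_two_ne_zero {z : ZMod 2} : z ≠ 0 ↔ z = 1 := by
  revert z; decide

lemma quadratic_add (Q : QuadraticForm (ZMod 2) E) (v w : E) :
    Q (v + w) = Q v + Q w + Q.polarBilin v w := by
  rw [polarBilin_eq, QuadraticMap.polar]; ring

lemma polarBilin_symm (Q : QuadraticForm (ZMod 2) E) (v w : E) :
    Q.polarBilin v w = Q.polarBilin w v := QuadraticMap.polar_comm Q v w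

lemma polarBilin_self (Q : QuadraticForm (ZMod 2) E) (v : E) : Q.polarBilin v v = 0 := by
  have h := quadratic_add Q v v
  rw [ZModModule.add_self, QuadraticMap.map_zero] at h
  have h2 : Q v + Q v = 0 := CharTwo.add_self_eq_zero _
  rw [h2, zero_add] at h
  exact h.symm

/-- A quadratic space of minus type over the field of two elements is the orthogonal sum of a
hyperbolic space and an anisotropic plane. -/
lemma IsMinusType.exists_decomposition {Q : QuadraticForm (ZMod 2) E} (hQ : IsMinusType Q) :
    ∃ (W P : Submodule (ZMod 2) E) (e : ((W × Module.Dual (ZMod 2) W) × P) ≃ₗ[ZMod 2] E),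
      2 * Module.finrank (ZMod 2) W + 2 = Module.finrank (ZMod 2) E ∧
      Module.finrank (ZMod 2) P = 2 ∧ (∀ p ∈ P, p ≠ 0 → Q p = 1) ∧
      ∀ w f p, Q (e ((w, f), p)) = f w + Q p := by
  obtain ⟨heven, hnd, hhalf⟩ := hQ
  obtain ⟨W, hW, hmax⟩ := (wellFounded_gt (α := Submodule (ZMod 2) E)).has_min
    {W | ∀ w ∈ W, Q w = 0} ⟨⊥, by simp⟩
  obtain ⟨P, e, hPW, hPW0, he⟩ := exists_hyperbolic_decomposition hnd W hW
  -- A nonzero singular vector of `P` could be adjoined to the maximal singular subspace `W`.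
  have hP : ∀ p ∈ P, p ≠ 0 → Q p = 1 := by
    intro p hp hp0
    by_contra hQp
    have hQp0 : Q p = 0 := (zmod_two_cases _).resolve_right hQp
    refine hmax (W ⊔ Submodule.span (ZMod 2) {p}) ?_ ?_
    · intro v hv
      obtain ⟨w, hw, v2, hv2, rfl⟩ := Submodule.mem_sup.mp hv
      obtain ⟨a, rfl⟩ := Submodule.mem_span_singleton.mp hv2
      rw [quadratic_add, hW w hw, QuadraticMap.map_smul, hQp0, map_smul, hPW p hp w hw]
      simp
    · refine lt_of_le_of_ne le_sup_left fun h => hp0 (hPW0 p hp ?_)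
      rw [h]
      exact Submodule.mem_sup_right (Submodule.mem_span_singleton_self p)
  have hpol : ∀ p ∈ P, ∀ p' ∈ P, p ≠ 0 → p' ≠ 0 → p + p' ≠ 0 → Q.polarBilin p p' = 1 := by
    intro p hp p' hp' h1 h2 h3
    have h := quadratic_add Q p p'
    rw [hP p hp h1, hP p' hp' h2, hP _ (P.add_mem hp hp') h3] at h
    have h2 : (1 : ZMod 2) + 1 = 0 := by decide
    rw [h2, zero_add] at h
    exact h.symm
  have hdimE := e.finrank_eq
  rw [Module.finrank_prod, Module.finrank_prod, Subspace.dual_finrank_eq] at hdimE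
  have hle : Module.finrank (ZMod 2) P ≤ 2 := by
    -- In an anisotropic space over F₂ distinct nonzero vectors pair to 1. For independent v 0, v 1,
    -- v 2 the pairing of v 0 with v 1 + v 2 would be both 1 and 1 + 1.
    by_contra hgt
    push Not at hgt
    obtain ⟨v, hv⟩ := exists_linearIndependent_of_le_finrank (R := ZMod 2) (M := P) (n := 3) hgt
    have hrel : ∀ a b c : ZMod 2, a • v 0 + b • v 1 + c • v 2 = 0 → a = 0 ∧ b = 0 ∧ c = 0 := by
      intro a b c habc
      have := Fintype.linearIndependent_iff.mp hv ![a, b, c] (by simpa [Fin.sum_univ_three])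
      exact ⟨this 0, this 1, this 2⟩
    have hne : ∀ a b c : ZMod 2, ¬ (a = 0 ∧ b = 0 ∧ c = 0) →
        a • (v 0 : E) + b • (v 1 : E) + c • (v 2 : E) ≠ 0 := by
      intro a b c h h0
      exact h (hrel a b c (Subtype.ext (by simpa using h0)))
    have e1 := hpol _ (v 0).2 _ (v 1).2 (by simpa using hne 1 0 0 (by decide))
      (by simpa using hne 0 1 0 (by decide)) (by simpa using hne 1 1 0 (by decide))
    have e2 := hpol _ (v 0).2 _ (v 2).2 (by simpa using hne 1 0 0 (by decide))
      (by simpa using hne 0 0 1 (by decide)) (by simpa using hne 1 0 1 (by decide))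
    have e3 := hpol _ (v 0).2 _ (P.add_mem (v 1).2 (v 2).2) (by simpa using hne 1 0 0 (by decide))
      (by simpa using hne 0 1 1 (by decide))
      (by simpa [add_assoc] using hne 1 1 1 (by decide))
    rw [map_add, e1, e2] at e3
    exact absurd e3 (by decide)
  -- Dimension 0 would make `W` singular of half the dimension; dimension 1 is excluded by parity.
  have hpos : Module.finrank (ZMod 2) P ≠ 0 := by
    intro h0
    exact hhalf ⟨W, by omega, hW⟩
  obtain ⟨m, hm⟩ := heven
  exact ⟨W, P, e, by omega, by omega, hP, he⟩

/-- Quadratic spaces of minus type and of the same dimension over the field of two elements are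
isometric. -/
lemma exists_isometry_of_isMinusType {Q : QuadraticForm (ZMod 2) E}
    {Q' : QuadraticForm (ZMod 2) E'} (hQ : IsMinusType Q) (hQ' : IsMinusType Q')
    (hdim : Module.finrank (ZMod 2) E = Module.finrank (ZMod 2) E') :
    ∃ T : E ≃ₗ[ZMod 2] E', ∀ v, Q' (T v) = Q v := by
  obtain ⟨W, P, e, hW, hPd, hP, he⟩ := hQ.exists_decomposition
  obtain ⟨W', P', e', hW', hPd', hP', he'⟩ := hQ'.exists_decomposition
  let φ : W ≃ₗ[ZMod 2] W' := LinearEquiv.ofFinrankEq W W' (by omega)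
  let ψ : P ≃ₗ[ZMod 2] P' := LinearEquiv.ofFinrankEq P P' (by omega)
  refine ⟨e.symm.trans ((LinearEquiv.prodCongr (LinearEquiv.prodCongr φ φ.symm.dualMap) ψ).trans
    e'), fun v => ?_⟩
  obtain ⟨⟨⟨w, f⟩, p⟩, rfl⟩ := e.surjective v
  -- Both planes are anisotropic over F₂, so any linear bijection between them is an isometry.
  have hp : Q' (ψ p) = Q p := by
    by_cases h : p = 0
    · simp [h]
    · rw [hP p p.2 (by simpa using h), hP' _ (ψ p).2 (by simpa using h)]
  simp [he, he', hp]

/-- The transvection with centre `a`. -/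
def transvection (Q : QuadraticForm (ZMod 2) E) (a : E) : E ≃ₗ[ZMod 2] E :=
  LinearEquiv.ofInvolutive (LinearMap.id + (Q.polarBilin a).smulRight a) (fun x => by
    have h : Q.polarBilin a a = 0 := polarBilin_self Q a
    simp only [LinearMap.add_apply, LinearMap.id_apply, LinearMap.smulRight_apply, map_add,
      map_smul, h, zero_smul, add_zero]
    rw [add_assoc, ZModModule.add_self, add_zero])

lemma transvection_apply (Q : QuadraticForm (ZMod 2) E) (a x : E) :
    transvection Q a x = x + Q.polarBilin a x • a := rfl

lemma transvection_mul_self (Q : QuadraticForm (ZMod 2) E) (a : E) :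
    transvection Q a * transvection Q a = 1 := by
  ext x
  exact (transvection Q a).left_inv x

lemma transvection_mem {Q : QuadraticForm (ZMod 2) E} {a : E} (ha : Q a = 1) :
    transvection Q a ∈ quadraticIsometries Q := by
  intro x
  rw [transvection_apply, quadratic_add, QuadraticMap.map_smul, ha, map_smul,
    polarBilin_symm Q x a]
  have : ∀ z : ZMod 2, (z * z) • (1 : ZMod 2) + z • z = 0 := by decide
  rw [add_assoc, this, add_zero]

lemma quadraticIsometries_polar {Q : QuadraticForm (ZMod 2) E} {g : E ≃ₗ[ZMod 2] E}
    (hg : g ∈ quadraticIsometries Q) (v w : E) :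
    Q.polarBilin (g v) (g w) = Q.polarBilin v w := by
  rw [polarBilin_eq, polarBilin_eq, QuadraticMap.polar, QuadraticMap.polar, ← map_add,
    hg, hg, hg]

lemma mem_fixedSpace {K V : Type*} [Field K] [AddCommGroup V] [Module K V] {g : V ≃ₗ[K] V}
    {v : V} : v ∈ fixedSpace g ↔ g v = v := by
  simp [fixedSpace, sub_eq_zero]

/-- A nonsingular vector orthogonal to two given vectors. -/
lemma exists_nonsingular_perp {Q : QuadraticForm (ZMod 2) E} (hQ : QuadraticNondegenerate Q)
    (hdim : 5 ≤ Module.finrank (ZMod 2) E) (x y : E) :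
    ∃ w, Q w = 1 ∧ Q.polarBilin w x = 0 ∧ Q.polarBilin w y = 0 := by
  by_contra hcon
  push Not at hcon
  -- Otherwise `Q` vanishes on `N`, which has codimension at most 2; being totally isotropic it
  -- gives 2(dim - 2) ≤ dim, against dim ≥ 5.
  let N := perp Q.polarBilin (Submodule.span (ZMod 2) {x, y})
  have hN : ∀ w ∈ N, Q w = 0 := by
    intro w hw
    rw [mem_perp] at hw
    refine (zmod_two_cases _).resolve_right fun h1 => hcon w h1 ?_ ?_
    · rw [polarBilin_symm]; exact hw x (Submodule.subset_span (by simp))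
    · rw [polarBilin_symm]; exact hw y (Submodule.subset_span (by simp))
  have hiso : ∀ v ∈ N, ∀ w ∈ N, Q.polarBilin v w = 0 := by
    intro v hv w hw
    have h := quadratic_add Q v w
    rw [hN v hv, hN w hw, hN _ (N.add_mem hv hw)] at h
    simpa using h.symm
  have h1 := two_mul_finrank_le_of_isotropic _ hQ.right N hiso
  have h2 := finrank_add_finrank_perp Q.polarBilin hQ.right (Submodule.span (ZMod 2) {x, y})
  have h3 : Module.finrank (ZMod 2) (Submodule.span (ZMod 2) {x, y}) ≤ 2 := by
    classical
    have h4 := finrank_span_finset_le_card (R := ZMod 2) ({x, y} : Finset E)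
    have h5 : ({x, y} : Finset E).card ≤ 2 := Finset.card_le_two
    simp only [Finset.coe_insert, Finset.coe_singleton] at h4
    exact h4.trans h5
  have h4 : Module.finrank (ZMod 2) N = Module.finrank (ZMod 2)
    (perp Q.polarBilin (Submodule.span (ZMod 2) {x, y})) := rfl
  omega

/-- The orthogonal groups of dimension at least `5` over the field of two elements are generated by
transvections. -/
theorem mem_closure_transvections {Q : QuadraticForm (ZMod 2) E} (hQ : QuadraticNondegenerate Q)
    (hdim : 5 ≤ Module.finrank (ZMod 2) E) {g : E ≃ₗ[ZMod 2] E}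
    (hg : g ∈ quadraticIsometries Q) :
    g ∈ Subgroup.closure {t | ∃ a, Q a = 1 ∧ t = transvection Q a} := by
  set T := Subgroup.closure {t | ∃ a, Q a = 1 ∧ t = transvection Q a}
  have hT : ∀ a, Q a = 1 → transvection Q a ∈ T := fun a ha =>
    Subgroup.subset_closure ⟨a, ha, rfl⟩
  -- Induction on the codimension of the fixed space of `g`.
  induction hk : Module.finrank (ZMod 2) E - Module.finrank (ZMod 2) (fixedSpace g)
    using Nat.strong_induction_on generalizing g with
  | _ k ih =>
  subst hk
  -- it suffices to enlarge the fixed point space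
  have hstep : ∀ s ∈ T, s ∈ quadraticIsometries Q → fixedSpace g < fixedSpace (s * g) → g ∈ T := by
    intro s hs hsQ hlt
    have h1 := Submodule.finrank_lt_finrank_of_lt hlt
    have h2 := Submodule.finrank_le (fixedSpace (s * g))
    have h3 := ih _ (by omega) (mul_mem hsQ hg) rfl
    have h4 := mul_mem (inv_mem hs) h3
    rwa [inv_mul_cancel_left] at h4
  by_cases h1 : ∃ v, Q.polarBilin v (g v) = 1
  · obtain ⟨v, hv⟩ := h1
    -- The transvection at `g v + v` sends `g v` back to `v`, and its centre is orthogonal to the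
    -- fixed space of `g`.
    have hu : Q (g v + v) = 1 := by
      rw [quadratic_add, hg, polarBilin_symm, hv, CharTwo.add_self_eq_zero, zero_add]
    refine hstep _ (hT _ hu) (transvection_mem hu) (lt_of_le_of_ne ?_ ?_)
    · intro x hx
      rw [mem_fixedSpace] at hx ⊢
      change transvection Q (g v + v) (g x) = x
      have h2 : Q.polarBilin (g v + v) x = 0 := by
        rw [map_add, LinearMap.add_apply, ← quadraticIsometries_polar hg v x, hx]
        exact CharTwo.add_self_eq_zero _
      rw [hx, transvection_apply, h2, zero_smul, add_zero]
    · intro heq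
      have h2 : v ∈ fixedSpace (transvection Q (g v + v) * g) := by
        rw [mem_fixedSpace]
        change transvection Q (g v + v) (g v) = v
        rw [transvection_apply, map_add, LinearMap.add_apply, polarBilin_self, hv, zero_add,
          one_smul, ← add_assoc, ZModModule.add_self, zero_add]
      rw [← heq, mem_fixedSpace] at h2
      rw [h2, polarBilin_self] at hv
      exact zero_ne_one hv
  · push Not at h1
    -- Now every `g v + v` is singular, and a product of four transvections takes the place of a
    -- single one.
    have h1' : ∀ v, Q.polarBilin v (g v) = 0 := fun v => (zmod_two_cases _).resolve_right (h1 v)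
    by_cases hone : ∀ v, g v = v
    · have : g = 1 := LinearEquiv.ext hone
      rw [this]; exact one_mem _
    push Not at hone
    obtain ⟨v, hv⟩ := hone
    have hsing : ∀ y, Q (g y + y) = 0 := fun y => by
      rw [quadratic_add, hg, polarBilin_symm, h1', add_zero, CharTwo.add_self_eq_zero]
    have hperp : ∀ y, ∀ x ∈ fixedSpace g, Q.polarBilin (g y + y) x = 0 := by
      intro y x hx
      rw [mem_fixedSpace] at hx
      rw [map_add, LinearMap.add_apply, ← quadraticIsometries_polar hg y x, hx]
      exact CharTwo.add_self_eq_zero _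
    have hu0 : g v + v ≠ 0 := fun h => hv (by
      rw [← ZModModule.sub_eq_add, sub_eq_zero] at h; exact h)
    obtain ⟨y, hy⟩ : ∃ y, Q.polarBilin (g v + v) y = 1 := by
      by_contra hcon
      push Not at hcon
      exact hu0 (hQ _ fun w => (zmod_two_cases _).resolve_right (hcon w))
    set u₁ := g v + v with hu₁
    set u₂ := g y + y with hu₂
    have hu12 : Q.polarBilin u₁ u₂ = 0 := by
      have h2 := quadratic_add Q u₁ u₂
      rw [hsing, hsing, show u₁ + u₂ = g (v + y) + (v + y) by rw [hu₁, hu₂, map_add]; abel,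
        hsing] at h2
      simpa using h2.symm
    have hgu₁ : Q.polarBilin u₁ (g v) = 0 := by
      rw [hu₁, map_add, LinearMap.add_apply, polarBilin_self, h1', add_zero]
    have hgu₂ : Q.polarBilin u₂ (g v) = 1 := by
      rw [hu₂, map_add, LinearMap.add_apply, quadraticIsometries_polar hg, polarBilin_symm Q y v,
        polarBilin_symm Q y (g v), add_comm, ← LinearMap.add_apply, ← map_add]
      exact hy
    obtain ⟨w, hw, hw1, hw2⟩ := exists_nonsingular_perp hQ hdim u₁ u₂
    have hw1' : Q.polarBilin u₁ w = 0 := by rw [polarBilin_symm, hw1]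
    have hw2' : Q.polarBilin u₂ w = 0 := by rw [polarBilin_symm, hw2]
    have hu21 : Q.polarBilin u₂ u₁ = 0 := by rw [polarBilin_symm, hu12]
    have hQ1 : Q (w + u₁) = 1 := by rw [quadratic_add, hw, hsing, hw1]; simp
    have hQ2 : Q (w + u₂) = 1 := by rw [quadratic_add, hw, hsing, hw2]; simp
    have hQ3 : Q (w + u₁ + u₂) = 1 := by
      rw [quadratic_add, hQ1, hsing, map_add Q.polarBilin, LinearMap.add_apply, hw2, hu12]; simp
    -- Over F₂ the terms in `w` cancel and the product is the Siegel transformation x ↦ x + (u₁,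
    -- x)u₂ + (u₂, x)u₁. It fixes the fixed space of `g`, and the choice of `y` makes it send `g v`
    -- to `v`.
    let S := transvection Q w * (transvection Q (w + u₁) * (transvection Q (w + u₂) *
      transvection Q (w + u₁ + u₂)))
    have hS : ∀ x, S x = x + Q.polarBilin u₁ x • u₂ + Q.polarBilin u₂ x • u₁ := by
      intro x
      change transvection Q w (transvection Q (w + u₁) (transvection Q (w + u₂)
        (transvection Q (w + u₁ + u₂) x))) = _
      simp only [transvection_apply, map_add, map_smul, LinearMap.add_apply, polarBilin_self,
        hw1, hw2, hw1', hw2', hu12, hu21, zero_smul, add_zero]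
      have h2 : (2 : ZMod 2) = 0 := by decide
      set α := Q.polarBilin w x
      set β := Q.polarBilin u₁ x
      set γ := Q.polarBilin u₂ x
      have h3 : x + α • w + (α + β) • (w + u₁) + (α + γ) • (w + u₂) + (α + β + γ) • (w + u₁ + u₂) =
          x + β • u₂ + γ • u₁ + (2 : ZMod 2) • ((2 * α + β + γ) • w + (α + β) • u₁ +
            (α + γ) • u₂) := by module
      rw [h2, zero_smul, add_zero] at h3
      exact h3
    have hST : S ∈ T := mul_mem (hT _ hw) (mul_mem (hT _ hQ1) (mul_mem (hT _ hQ2) (hT _ hQ3)))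
    have hSQ : S ∈ quadraticIsometries Q := mul_mem (transvection_mem hw)
      (mul_mem (transvection_mem hQ1) (mul_mem (transvection_mem hQ2) (transvection_mem hQ3)))
    refine hstep S hST hSQ (lt_of_le_of_ne ?_ ?_)
    · intro x hx
      have hx' := mem_fixedSpace.mp hx
      rw [mem_fixedSpace]
      change S (g x) = x
      rw [hx', hS, hperp v x hx, hperp y x hx]
      simp
    · intro heq
      have h2 : v ∈ fixedSpace (S * g) := by
        rw [mem_fixedSpace]
        change S (g v) = v
        rw [hS, hgu₁, hgu₂, zero_smul, add_zero, one_smul, hu₁, ← add_assoc,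
          ZModModule.add_self, zero_add]
      rw [← heq, mem_fixedSpace] at h2
      exact hv h2

/-- The orthogonal group is transitive on nonsingular vectors. -/
lemma exists_isometry_map_nonsingular {Q : QuadraticForm (ZMod 2) E}
    (hQ : QuadraticNondegenerate Q) (hdim : 5 ≤ Module.finrank (ZMod 2) E) {a b : E}
    (ha : Q a = 1) (hb : Q b = 1) : ∃ h ∈ quadraticIsometries Q, h a = b := by
  -- If `a` and `b` pair to 1, then `a + b` is nonsingular and its transvection sends `a` to `b`. In
  -- the remaining case a nonsingular `c` pairing to 1 with both serves as a stepping stone.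
  have key : ∀ a b, Q a = 1 → Q b = 1 → Q.polarBilin a b = 1 →
      ∃ h ∈ quadraticIsometries Q, h a = b := by
    intro a b ha hb hab
    have hu : Q (a + b) = 1 := by
      rw [quadratic_add, ha, hb, hab]; decide
    refine ⟨_, transvection_mem hu, ?_⟩
    rw [transvection_apply, map_add, LinearMap.add_apply, polarBilin_self, polarBilin_symm Q b a,
      hab, zero_add, one_smul, ← add_assoc, ZModModule.add_self, zero_add]
  by_cases hab : Q.polarBilin a b = 1
  · exact key a b ha hb hab
  have hab0 : Q.polarBilin a b = 0 := (zmod_two_cases _).resolve_right hab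
  by_cases heq : a = b
  · exact ⟨1, one_mem _, heq⟩
  obtain ⟨c, hc, hac, hcb⟩ : ∃ c, Q c = 1 ∧ Q.polarBilin a c = 1 ∧ Q.polarBilin c b = 1 := by
    have hne : ∀ x, x ≠ 0 → ∃ y, Q.polarBilin x y = 1 := by
      intro x hx
      by_contra hcon
      push Not at hcon
      exact hx (hQ x fun w => (zmod_two_cases _).resolve_right (hcon w))
    obtain ⟨x, hxa, hxb⟩ : ∃ x, Q.polarBilin a x = 1 ∧ Q.polarBilin b x = 1 := by
      obtain ⟨x, hx⟩ := hne a (by rintro rfl; simp at ha)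
      obtain ⟨y, hy⟩ := hne b (by rintro rfl; simp at hb)
      obtain ⟨z, hz⟩ := hne (a + b) (fun h => heq (by
        rw [← ZModModule.sub_eq_add, sub_eq_zero] at h; exact h))
      rw [map_add, LinearMap.add_apply] at hz
      rcases zmod_two_cases (Q.polarBilin b x) with h1 | h1
      · rcases zmod_two_cases (Q.polarBilin a y) with h2 | h2
        · exact ⟨x + y, by rw [map_add, hx, h2, add_zero], by rw [map_add, hy, h1, zero_add]⟩
        · exact ⟨y, h2, hy⟩
      · exact ⟨x, hx, h1⟩
    rcases zmod_two_cases (Q x) with hx | hx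
    · -- adjust `x` by a vector orthogonal to `a` and `b`
      by_contra hcon
      push Not at hcon
      let N := perp Q.polarBilin (Submodule.span (ZMod 2) {a, b})
      -- If no adjustment is nonsingular, `Q` is linear on `N`, so `N` is totally isotropic, which
      -- is impossible in codimension at most 2.
      have hN : ∀ w ∈ N, Q w = Q.polarBilin x w := by
        intro w hw
        rw [mem_perp] at hw
        have h1 := hw a (Submodule.subset_span (by simp))
        have h2 := hw b (Submodule.subset_span (by simp))
        by_contra hne
        refine hcon (x + w) ?_ ?_ ?_
        · rw [quadratic_add, hx, zero_add]
          revert hne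
          generalize Q w = s
          generalize Q.polarBilin x w = t
          revert s t
          decide
        · rw [map_add, hxa, h1, add_zero]
        · rw [polarBilin_symm, map_add, hxb, h2, add_zero]
      have hiso : ∀ v ∈ N, ∀ w ∈ N, Q.polarBilin v w = 0 := by
        intro v hv w hw
        have h := quadratic_add Q v w
        rw [hN v hv, hN w hw, hN _ (N.add_mem hv hw), map_add] at h
        simpa using h.symm
      have h1 := two_mul_finrank_le_of_isotropic _ hQ.right N hiso
      have h2 := finrank_add_finrank_perp Q.polarBilin hQ.right (Submodule.span (ZMod 2) {a, b})
      have h3 : Module.finrank (ZMod 2) (Submodule.span (ZMod 2) {a, b}) ≤ 2 := by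
        classical
        have h4 := finrank_span_finset_le_card (R := ZMod 2) ({a, b} : Finset E)
        have h5 : ({a, b} : Finset E).card ≤ 2 := Finset.card_le_two
        simp only [Finset.coe_insert, Finset.coe_singleton] at h4
        exact h4.trans h5
      have h4 : Module.finrank (ZMod 2) N = Module.finrank (ZMod 2)
        (perp Q.polarBilin (Submodule.span (ZMod 2) {a, b})) := rfl
      omega
    · exact ⟨x, hx, hxa, by rw [polarBilin_symm]; exact hxb⟩
  obtain ⟨h₁, hh₁, e₁⟩ := key a c ha hc hac
  obtain ⟨h₂, hh₂, e₂⟩ := key c b hc hb hcb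
  exact ⟨h₂ * h₁, mul_mem hh₂ hh₁, by rw [← e₂, ← e₁]; rfl⟩

/-- The transvection with nonsingular centre `a` as an element of the orthogonal group. -/
def orthTransvection (Q : QuadraticForm (ZMod 2) E) {a : E} (ha : Q a = 1) :
    quadraticIsometries Q := ⟨transvection Q a, transvection_mem ha⟩

lemma orthTransvection_mul_self {Q : QuadraticForm (ZMod 2) E} {a : E} (ha : Q a = 1) :
    orthTransvection Q ha * orthTransvection Q ha = 1 :=
  Subtype.ext (transvection_mul_self Q a)

/-- The product of two transvections lies in the derived subgroup. -/
lemma orthTransvection_mul_mem_commutator {Q : QuadraticForm (ZMod 2) E}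
    (hQ : QuadraticNondegenerate Q) (hdim : 5 ≤ Module.finrank (ZMod 2) E) {a b : E}
    (ha : Q a = 1) (hb : Q b = 1) :
    orthTransvection Q ha * orthTransvection Q hb ∈ commutator (quadraticIsometries Q) := by
  obtain ⟨h, hh, hab⟩ := exists_isometry_map_nonsingular hQ hdim ha hb
  set t := orthTransvection Q ha
  set η : quadraticIsometries Q := ⟨h, hh⟩
  -- Conjugation by `η` moves the transvection at `a` to the one at `b`, so the product is the
  -- commutator of `t` and `η`.
  have hconj : orthTransvection Q hb = η * t * η⁻¹ := by
    rw [eq_mul_inv_iff_mul_eq]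
    apply Subtype.ext
    ext x
    change transvection Q b (h x) = h (transvection Q a x)
    rw [transvection_apply, transvection_apply, map_add, map_smul, hab, ← hab,
      quadraticIsometries_polar hh]
  have hinv : t⁻¹ = t := inv_eq_of_mul_eq_one_left (orthTransvection_mul_self ha)
  have hmem := mem_commutator (quadraticIsometries Q) t η
  rw [commutatorElement_def, hinv] at hmem
  have h2 : t * η * t * η⁻¹ = t * (η * t * η⁻¹) := by group
  rw [h2, ← hconj] at hmem
  exact hmem

/-- Up to a transvection, every isometry lies in the derived subgroup. -/
lemma mem_commutator_or_orthTransvection_mul {Q : QuadraticForm (ZMod 2) E}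
    (hQ : QuadraticNondegenerate Q) (hdim : 5 ≤ Module.finrank (ZMod 2) E) {a : E}
    (ha : Q a = 1) (g : quadraticIsometries Q) :
    g ∈ commutator (quadraticIsometries Q) ∨
      orthTransvection Q ha * g ∈ commutator (quadraticIsometries Q) := by
  obtain ⟨g, hg⟩ := g
  have hcl := mem_closure_transvections hQ hdim hg
  -- Left multiplication by a transvection exchanges the two alternatives.
  have hstep : ∀ b, ∀ hb : Q b = 1, ∀ k : quadraticIsometries Q,
      (k ∈ commutator (quadraticIsometries Q) ∨
        orthTransvection Q ha * k ∈ commutator (quadraticIsometries Q)) →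
      (orthTransvection Q hb * k ∈ commutator (quadraticIsometries Q) ∨
        orthTransvection Q ha * (orthTransvection Q hb * k) ∈
          commutator (quadraticIsometries Q)) := by
    intro b hb k hk
    rcases hk with hk | hk
    · right
      rw [← mul_assoc]
      exact mul_mem (orthTransvection_mul_mem_commutator hQ hdim ha hb) hk
    · left
      have h1 := mul_mem (orthTransvection_mul_mem_commutator hQ hdim hb ha) hk
      rwa [mul_assoc, ← mul_assoc (orthTransvection Q ha), orthTransvection_mul_self,
        one_mul] at h1
  induction hcl using Subgroup.closure_induction_left with
  | one => left; exact one_mem _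
  | mul_left x hx y hy ih =>
    obtain ⟨b, hb, rfl⟩ := hx
    have hy' : y ∈ quadraticIsometries Q := by
      have := mul_mem (inv_mem (transvection_mem hb)) hg
      rwa [inv_mul_cancel_left] at this
    exact hstep b hb ⟨y, hy'⟩ (ih hy')
  | inv_mul_cancel x hx y hy ih =>
    obtain ⟨b, hb, rfl⟩ := hx
    have hy' : y ∈ quadraticIsometries Q := by
      have := mul_mem (transvection_mem hb) hg
      rwa [mul_inv_cancel_left] at this
    have h2 : (transvection Q b)⁻¹ = transvection Q b :=
      inv_eq_of_mul_eq_one_left (transvection_mul_self Q b)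
    have := hstep b hb ⟨y, hy'⟩ (ih hy')
    simp only [h2]
    exact this

end BinaryQuadratic

/-! ### Common eigenvectors of commuting operators -/

section CommonEigenvector

/-- Commuting endomorphisms whose squares are squares of scalars have a common eigenvector. -/
lemma exists_common_eigenvector {F A I : Type*} [Field F] [AddCommGroup A] [Module F A]
    [FiniteDimensional F A] [Nontrivial A] (f : I → Module.End F A)
    (hcomm : ∀ i j, f i * f j = f j * f i) (hsq : ∀ i, ∃ m : F, f i * f i = (m * m) • 1) :
    ∃ v : A, v ≠ 0 ∧ ∀ i, ∃ μ : F, f i v = μ • v := by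
  -- On a minimal nonzero invariant subspace (f i - m)(f i + m) = 0. The kernel of f i - m there is
  -- invariant under all `f j`, so it is zero or everything, and `f i` acts as -m or m.
  obtain ⟨W, ⟨hW, hinv⟩, hmin⟩ := (wellFounded_lt (α := Submodule F A)).has_min
    {W | W ≠ ⊥ ∧ ∀ i, ∀ w ∈ W, f i w ∈ W} ⟨⊤, top_ne_bot, fun _ _ _ => Submodule.mem_top⟩
  obtain ⟨v, hvW, hv⟩ := Submodule.exists_mem_ne_zero_of_ne_bot hW
  refine ⟨v, hv, fun i => ?_⟩
  obtain ⟨m, hm⟩ := hsq i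
  let N : Submodule F A := W ⊓ LinearMap.ker (f i - m • 1)
  by_cases hN : N = ⊥
  · refine ⟨-m, ?_⟩
    have h1 : f i v + m • v ∈ N := by
      refine ⟨W.add_mem (hinv i v hvW) (W.smul_mem m hvW), ?_⟩
      have h2 : f i (f i v) = (m * m) • v := LinearMap.congr_fun hm v
      rw [SetLike.mem_coe, LinearMap.mem_ker, LinearMap.sub_apply, map_add, map_smul, h2]
      simp only [LinearMap.smul_apply, Module.End.one_apply, smul_add, smul_smul]
      abel
    rw [hN, Submodule.mem_bot] at h1
    rw [neg_smul]
    exact eq_neg_of_add_eq_zero_left h1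
  · refine ⟨m, ?_⟩
    have hNW : N = W := by
      by_contra hne
      refine hmin N ⟨hN, fun j w hw => ⟨hinv j w hw.1, ?_⟩⟩ (lt_of_le_of_ne inf_le_left hne)
      have h1 : f i w = m • w := by simpa [sub_eq_zero] using hw.2
      have h2 : f i (f j w) = f j (f i w) := LinearMap.congr_fun (hcomm i j) w
      rw [SetLike.mem_coe, LinearMap.mem_ker, LinearMap.sub_apply, h2, h1, map_smul]
      simp
    have hvN : v ∈ N := hNW ▸ hvW
    simpa [sub_eq_zero] using hvN.2

end CommonEigenvector

/-! ### Signs indexed by the field of two elements -/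

section Sign

variable {F : Type*} [Field F]

/-- The sign `(-1) ^ z`. -/
def sgn (F : Type*) [Field F] (z : ZMod 2) : F := (-1) ^ z.val

lemma sgn_zero : sgn F 0 = 1 := by simp [sgn]

lemma sgn_one : sgn F 1 = -1 := by simp [sgn, ZMod.val_one]

lemma sgn_add (a b : ZMod 2) : sgn F (a + b) = sgn F a * sgn F b := by
  have h2 : (1 : ZMod 2) + 1 = 0 := by decide
  rcases zmod_two_cases a with rfl | rfl <;> rcases zmod_two_cases b with rfl | rfl <;>
    simp [sgn_zero, sgn_one, h2]

lemma sgn_mul_self (a : ZMod 2) : sgn F a * sgn F a = 1 := by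
  rw [← sgn_add, CharTwo.add_self_eq_zero, sgn_zero]

lemma sgn_ne_zero (a : ZMod 2) : sgn F a ≠ 0 := left_ne_zero_of_mul_eq_one (sgn_mul_self a)

lemma sgn_injective (h2 : (2 : F) ≠ 0) : Function.Injective (sgn F) := by
  have h : (1 : F) ≠ -1 := fun h => h2 (by linear_combination h)
  intro a b hab
  rcases zmod_two_cases a with rfl | rfl <;> rcases zmod_two_cases b with rfl | rfl
  · rfl
  · rw [sgn_zero, sgn_one] at hab; exact absurd hab h
  · rw [sgn_zero, sgn_one] at hab; exact absurd hab.symm h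
  · rfl

lemma sgn_eq_one (h2 : (2 : F) ≠ 0) {a : ZMod 2} : sgn F a = 1 ↔ a = 0 := by
  rw [← sgn_zero, (sgn_injective h2).eq_iff]

lemma exists_sgn_eq {c : F} (hc : c * c = 1) : ∃ a, sgn F a = c := by
  rcases mul_self_eq_one_iff.mp hc with rfl | rfl
  · exact ⟨0, sgn_zero⟩
  · exact ⟨1, sgn_one⟩

end Sign

/-! ### Frames and their intertwiners -/

section Frames

variable {F V : Type*} [Field F] [AddCommGroup V] [Module F V]
  {E E' : Type*} [AddCommGroup E] [Module (ZMod 2) E] [AddCommGroup E'] [Module (ZMod 2) E']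

/-- A system `w` of representatives of the nontrivial cosets of the scalars in a group `R` of
symplectic type, indexed by a symplectic space over the field of two elements. -/
structure IsFrame (R : Subgroup (V ≃ₗ[F] V)) (B : E →ₗ[ZMod 2] E →ₗ[ZMod 2] ZMod 2)
    (w : E → V ≃ₗ[F] V) : Prop where
  mem : ∀ a, w a ∈ R
  exists_eq : ∀ x ∈ R, ∃ (a : E) (c : F), toEnd x = c • toEnd (w a)
  mul : ∀ a b, ∃ c : F, toEnd (w a) * toEnd (w b) = c • toEnd (w (a + b))
  comm : ∀ a b, toEnd (w a) * toEnd (w b) = sgn F (B a b) • (toEnd (w b) * toEnd (w a))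
  span : Submodule.span F (toEnd '' (Set.range w)) = ⊤
  nondeg : ∀ a, (∀ b, B a b = 0) → a = 0

/-- A frame of an extraspecial group, with the quadratic form given by squaring. -/
structure IsQuadraticFrame (R : Subgroup (V ≃ₗ[F] V)) (Q : QuadraticForm (ZMod 2) E)
    (w : E → V ≃ₗ[F] V) : Prop extends IsFrame R Q.polarBilin w where
  sq : ∀ a, toEnd (w a) * toEnd (w a) = sgn F (Q a) • 1
  scalar_mem : ∀ x : V ≃ₗ[F] V, ∀ c : F, toEnd x = c • 1 → (x ∈ R ↔ c * c = 1)

lemma IsFrame.comp {R : Subgroup (V ≃ₗ[F] V)} {B : E →ₗ[ZMod 2] E →ₗ[ZMod 2] ZMod 2}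
    {w : E → V ≃ₗ[F] V} (h : IsFrame R B w) (T : E' ≃ₗ[ZMod 2] E)
    (B' : E' →ₗ[ZMod 2] E' →ₗ[ZMod 2] ZMod 2) (hT : ∀ a b, B (T a) (T b) = B' a b) :
    IsFrame R B' (w ∘ T) where
  mem a := h.mem _
  exists_eq x hx := by
    obtain ⟨a, c, hc⟩ := h.exists_eq x hx
    exact ⟨T.symm a, c, by simpa using hc⟩
  mul a b := by
    obtain ⟨c, hc⟩ := h.mul (T a) (T b)
    exact ⟨c, by simpa using hc⟩
  comm a b := by rw [← hT]; exact h.comm _ _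
  span := by rw [Set.range_comp, T.surjective.range_eq, Set.image_univ]; exact h.span
  nondeg a ha := by
    have : T a = 0 := h.nondeg _ fun b => by
      obtain ⟨b, rfl⟩ := T.surjective b
      rw [hT]; exact ha b
    simpa using this

/-- Proportional frame elements have the same commutation signs, so `a - b` lies in the radical of
`B`. -/
lemma IsFrame.eq_of_smul [Nontrivial V] (h2 : (2 : F) ≠ 0) {R : Subgroup (V ≃ₗ[F] V)}
    {B : E →ₗ[ZMod 2] E →ₗ[ZMod 2] ZMod 2} {w : E → V ≃ₗ[F] V} (h : IsFrame R B w) {a b : E}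
    {c : F} (hab : toEnd (w a) = c • toEnd (w b)) : a = b := by
  have hz : a - b = 0 := by
    refine h.nondeg _ fun x => ?_
    rw [map_sub, LinearMap.sub_apply, sub_eq_zero]
    apply sgn_injective h2
    have h1 := h.comm a x
    have h3 := h.comm b x
    rw [hab, smul_mul_assoc, h3, mul_smul_comm] at h1
    have hc : c ≠ 0 := by
      rintro rfl
      rw [zero_smul] at hab
      exact toEnd_ne_zero _ hab
    rw [smul_smul, smul_smul, ← sub_eq_zero, ← sub_smul] at h1
    have h4 : toEnd (w x) * toEnd (w b) ≠ 0 := by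
      rw [← toEnd_mul]; exact toEnd_ne_zero _
    have h5 := (smul_eq_zero.mp h1).resolve_right h4
    have h6 : c * (sgn F (B b x) - sgn F (B a x)) = 0 := by linear_combination h5
    exact (sub_eq_zero.mp ((mul_eq_zero.mp h6).resolve_left hc)).symm
  exact sub_eq_zero.mp hz

/-- Two frames over isometric symplectic spaces are intertwined by a linear automorphism. -/
theorem exists_intertwiner [FiniteDimensional F V] [Nontrivial V] {R R' : Subgroup (V ≃ₗ[F] V)}
    {B : E →ₗ[ZMod 2] E →ₗ[ZMod 2] ZMod 2} {B' : E' →ₗ[ZMod 2] E' →ₗ[ZMod 2] ZMod 2}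
    {w : E → V ≃ₗ[F] V} {w' : E' → V ≃ₗ[F] V} (h : IsFrame R B w) (h' : IsFrame R' B' w')
    (φ : E → E') (hsymm : ∀ a b, B a b = B b a) (hφ : ∀ a b, B' (φ a) (φ b) = B a b)
    (hsq : ∀ a, ∃ c c' m : F, c * c' = m * m ∧ toEnd (w a) * toEnd (w a) = c • 1 ∧
      toEnd (w' (φ a)) * toEnd (w' (φ a)) = c' • 1) :
    ∃ T : V ≃ₗ[F] V, ∀ a, ∃ c : F, toEnd T * toEnd (w a) = c • (toEnd (w' (φ a)) * toEnd T) := by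
  -- These operators commute because `φ` preserves the commutator form, so two equal signs cancel;
  -- their squares are squares of scalars by `hsq`. A common eigenvector intertwines the frames up
  -- to scalars.
  let f : E → Module.End F (Module.End F V) := fun a =>
    LinearMap.mulLeft F (toEnd (w' (φ a))) ∘ₗ LinearMap.mulRight F (toEnd (w a))
  have hf : ∀ a T, f a T = toEnd (w' (φ a)) * T * toEnd (w a) := fun a T => by
    simp [f, mul_assoc]
  obtain ⟨T, hT0, hT⟩ := exists_common_eigenvector f
    (fun a b => by
      ext1 T
      have e1 := h.comm b a
      have e2 := h'.comm (φ a) (φ b)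
      rw [hφ] at e2
      rw [hsymm] at e1
      rw [Module.End.mul_apply, Module.End.mul_apply, hf, hf, hf, hf]
      calc toEnd (w' (φ a)) * (toEnd (w' (φ b)) * T * toEnd (w b)) * toEnd (w a)
          = (toEnd (w' (φ a)) * toEnd (w' (φ b))) * T * (toEnd (w b) * toEnd (w a)) := by
            simp only [mul_assoc]
        _ = (sgn F (B a b) * sgn F (B a b)) • ((toEnd (w' (φ b)) * toEnd (w' (φ a))) * T *
              (toEnd (w a) * toEnd (w b))) := by
            rw [e1, e2, smul_mul_assoc, smul_mul_assoc, mul_smul_comm, smul_smul]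
        _ = _ := by rw [sgn_mul_self, one_smul]; simp only [mul_assoc])
    (fun a => by
      obtain ⟨c, c', m, hm, e1, e2⟩ := hsq a
      refine ⟨m, ?_⟩
      ext1 T
      rw [Module.End.mul_apply, hf, hf]
      calc toEnd (w' (φ a)) * (toEnd (w' (φ a)) * T * toEnd (w a)) * toEnd (w a)
          = (toEnd (w' (φ a)) * toEnd (w' (φ a))) * T * (toEnd (w a) * toEnd (w a)) := by
            simp only [mul_assoc]
        _ = (m * m) • T := by
            rw [e1, e2, ← hm]; simp [smul_smul])
  have hT' : ∀ a, ∃ c : F, T * toEnd (w a) = c • (toEnd (w' (φ a)) * T) := by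
    intro a
    obtain ⟨μ, hμ⟩ := hT a
    obtain ⟨c, c', m, hm, e1, e2⟩ := hsq a
    rw [hf] at hμ
    have hμ0 : μ ≠ 0 := by
      rintro rfl
      rw [zero_smul] at hμ
      apply hT0
      calc T = toEnd (w' (φ a))⁻¹ * (toEnd (w' (φ a)) * T * toEnd (w a)) * toEnd (w a)⁻¹ := by
            rw [mul_assoc, mul_assoc _ _ (toEnd (w a)⁻¹), toEnd_mul_inv, mul_one, ← mul_assoc,
              toEnd_inv_mul, one_mul]
        _ = 0 := by rw [hμ]; simp
    refine ⟨c * μ⁻¹, ?_⟩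
    have h3 := congrArg (· * toEnd (w a)) hμ
    simp only [mul_assoc, e1, mul_smul_comm, mul_one, smul_mul_assoc] at h3
    rw [mul_comm, mul_smul, h3, smul_smul, inv_mul_cancel₀ hμ0, one_smul]
  -- The kernel of `T` is invariant under all `w a`, which span End(V). A nonzero `v` in it would
  -- give T(S v) = 0 for all `S`, hence T = 0.
  have hinj : Function.Injective T := by
    rw [injective_iff_map_eq_zero]
    intro v hv
    by_contra hv0
    apply hT0
    have hall : ∀ S : Module.End F V, T (S v) = 0 := by
      intro S
      have hS : S ∈ Submodule.span F (toEnd '' (Set.range w)) := h.span ▸ Submodule.mem_top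
      induction hS using Submodule.span_induction with
      | mem x hx =>
        obtain ⟨_, ⟨a, rfl⟩, rfl⟩ := hx
        obtain ⟨c, hc⟩ := hT' a
        have := LinearMap.congr_fun hc v
        rw [Module.End.mul_apply, LinearMap.smul_apply, Module.End.mul_apply, hv, map_zero,
          smul_zero] at this
        exact this
      | zero => simp
      | add a b _ _ ha hb => rw [LinearMap.add_apply, map_add, ha, hb, add_zero]
      | smul c a _ ha => rw [LinearMap.smul_apply, map_smul, ha, smul_zero]
    obtain ⟨ℓ, hℓ⟩ := Module.Projective.exists_dual_eq_one F hv0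
    ext u
    have := hall (LinearMap.smulRight ℓ u)
    simpa [hℓ] using this
  refine ⟨LinearEquiv.ofInjectiveEndo T hinj, fun a => ?_⟩
  have hTT : toEnd (LinearEquiv.ofInjectiveEndo T hinj) = T := by ext v; rfl
  rw [hTT]
  exact hT' a

end Frames

/-! ### Existence of frames -/

section FrameExistence

/-- Representatives of the quotient of a group by its centre, if that is elementary abelian. -/
lemma exists_quotient_representatives {R : Type*} [Group R] {m : ℕ}
    (hcomm : commutator R ≤ Subgroup.center R) (hsq : ∀ x : R, x ^ 2 ∈ Subgroup.center R)
    (hindex : (Subgroup.center R).index = 2 ^ m) (E : Type*) [AddCommGroup E] [Module (ZMod 2) E]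
    [FiniteDimensional (ZMod 2) E] (hE : Module.finrank (ZMod 2) E = m) :
    ∃ w : E → R, (∀ x : R, ∃ a, (w a)⁻¹ * x ∈ Subgroup.center R) ∧
      (∀ a b, (w (a + b))⁻¹ * (w a * w b) ∈ Subgroup.center R) ∧
      ∀ a b, (w a)⁻¹ * w b ∈ Subgroup.center R → a = b := by
  let Z := Subgroup.center R
  let : CommGroup (R ⧸ Z) :=
    { (inferInstance : Group (R ⧸ Z)) with
      mul_comm := fun x y => by
        induction x using QuotientGroup.induction_on with
        | H x =>
        induction y using QuotientGroup.induction_on with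
        | H y =>
        refine QuotientGroup.eq.mpr ?_
        have := hcomm (mem_commutator R y⁻¹ x⁻¹)
        rw [commutatorElement_def] at this
        simpa [mul_assoc] using this }
  have h2 : ∀ x : Additive (R ⧸ Z), 2 • x = 0 := by
    intro x
    obtain ⟨y, hy⟩ := QuotientGroup.mk_surjective x.toMul
    have : x.toMul ^ 2 = 1 := by
      rw [← hy, ← QuotientGroup.mk_pow]
      exact (QuotientGroup.eq_one_iff _).mpr (hsq y)
    exact congrArg Additive.ofMul this
  let : Module (ZMod 2) (Additive (R ⧸ Z)) := AddCommGroup.zmodModule h2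
  have hfin : Finite (R ⧸ Z) := Nat.finite_of_card_ne_zero (by
    rw [← Subgroup.index_eq_card, hindex]; exact pow_ne_zero _ two_ne_zero)
  have hfin' : Finite (Additive (R ⧸ Z)) := hfin
  have : Module.Finite (ZMod 2) (Additive (R ⧸ Z)) := Module.Finite.of_finite
  have hfr : Module.finrank (ZMod 2) (Additive (R ⧸ Z)) = m := by
    have h1 := Module.natCard_eq_pow_finrank (K := ZMod 2) (V := Additive (R ⧸ Z))
    have h3 : Nat.card (Additive (R ⧸ Z)) = 2 ^ m := by
      rw [← hindex, Subgroup.index_eq_card]; rfl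
    rw [h3, Nat.card_zmod] at h1
    exact (Nat.pow_right_injective le_rfl h1).symm
  let e : E ≃ₗ[ZMod 2] Additive (R ⧸ Z) := LinearEquiv.ofFinrankEq _ _ (by rw [hE, hfr])
  let w : E → R := fun a => Quotient.out (e a).toMul
  have hw : ∀ a, ((w a : R) : R ⧸ Z) = (e a).toMul := fun a => Quotient.out_eq _
  refine ⟨w, fun x => ?_, fun a b => ?_, fun a b hab => ?_⟩
  · obtain ⟨a, ha⟩ := e.surjective (Additive.ofMul (x : R ⧸ Z))
    refine ⟨a, QuotientGroup.eq.mp ?_⟩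
    rw [hw, ha]; rfl
  · refine QuotientGroup.eq.mp ?_
    rw [QuotientGroup.mk_mul, hw, hw, hw, map_add]; rfl
  · apply e.injective
    have := QuotientGroup.eq.mpr hab
    rw [hw, hw] at this
    exact congrArg Additive.ofMul this

variable {F V : Type*} [Field F] [AddCommGroup V] [Module F V] [FiniteDimensional F V] [Finite F]
  {n : ℕ} {R : Subgroup (V ≃ₗ[F] V)}

lemma two_ne_zero_of_dvd_card (h : 2 ∣ Nat.card F - 1) : (2 : F) ≠ 0 := by
  intro h2
  have := Fintype.ofFinite F
  have hc : CharP F 2 := CharTwo.of_one_ne_zero_of_two_eq_zero one_ne_zero h2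
  have h1 : 2 ∣ Nat.card F := by
    rw [Nat.card_eq_fintype_card]
    obtain ⟨k, -, hk⟩ := FiniteField.card F 2
    rw [hk]
    exact dvd_pow_self 2 k.ne_zero
  have h3 : 0 < Nat.card F := Nat.card_pos
  omega

/-- A Heisenberg `2`-group in which squares are central has a frame. -/
lemma IsHeisenberg.exists_isFrame (h : IsHeisenberg 2 n R)
    (hsq : ∀ x : R, x ^ 2 ∈ Subgroup.center R) (E : Type*) [AddCommGroup E] [Module (ZMod 2) E]
    [FiniteDimensional (ZMod 2) E] (hE : Module.finrank (ZMod 2) E = 2 * n) :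
    ∃ (B : E →ₗ[ZMod 2] E →ₗ[ZMod 2] ZMod 2) (w : E → V ≃ₗ[F] V), IsFrame R B w ∧
      (∀ a, B a a = 0) ∧ ∀ x ∈ R, ∃ (a : E), ∃ z : R, z ∈ Subgroup.center R ∧ x = w a * z := by
  have h2 := two_ne_zero_of_dvd_card h.dvd
  have := h.nontrivial
  obtain ⟨w, hw1, hw2, hw3⟩ := exists_quotient_representatives h.commutator_le hsq h.index E hE
  have hex : ∀ x : R, ∃ a, ∃ z : R, z ∈ Subgroup.center R ∧ x = w a * z := fun x => by
    obtain ⟨a, ha⟩ := hw1 x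
    exact ⟨a, _, ha, by group⟩
  let ρ : E → Module.End F V := fun a => toEnd ((w a : R) : V ≃ₗ[F] V)
  have hsc : ∀ x : R, ∀ a, (w a)⁻¹ * x ∈ Subgroup.center R → ∃ c : F,
      toEnd (x : V ≃ₗ[F] V) = c • ρ a := by
    intro x a hx
    obtain ⟨c, hc⟩ := h.exists_scalar_of_mem_center hx
    refine ⟨c, ?_⟩
    have h1 : toEnd (x : V ≃ₗ[F] V) = ρ a * toEnd (((w a)⁻¹ * x : R) : V ≃ₗ[F] V) := by
      rw [← toEnd_mul, ← Subgroup.coe_mul, mul_inv_cancel_left]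
    rw [h1, hc, mul_smul_comm, mul_one]
  -- Commutators are scalars of square 1, since the commutator subgroup has order 2; hence they are
  -- signs.
  have hcomm : ∀ a b, ∃ z : ZMod 2, ρ a * ρ b = sgn F z • (ρ b * ρ a) := by
    intro a b
    have hmem := mem_commutator R (w a) (w b)
    obtain ⟨c, -, hc⟩ := h.exists_scalar_of_mem_commutator _ hmem
    have hc' : toEnd ((⁅w a, w b⁆ : R) : V ≃ₗ[F] V) = c • 1 := by ext v; exact hc v
    have h1 : ρ a * ρ b = c • (ρ b * ρ a) := by
      have h3 : w a * w b = ⁅w a, w b⁆ * (w b * w a) := by rw [commutatorElement_def]; group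
      calc ρ a * ρ b = toEnd ((w a * w b : R) : V ≃ₗ[F] V) := rfl
        _ = toEnd ((⁅w a, w b⁆ : R) : V ≃ₗ[F] V) * (ρ b * ρ a) := by
            rw [h3]; rfl
        _ = c • (ρ b * ρ a) := by rw [hc', smul_mul_assoc, one_mul]
    have hsq1 : ⁅w a, w b⁆ ^ 2 = 1 := by
      have : (⟨_, hmem⟩ : commutator R) ^ 2 = 1 := by
        rw [← h.card_commutator]; exact pow_card_eq_one'
      exact congrArg Subtype.val this
    have hcc : c * c = 1 := by
      have h4 : toEnd ((⁅w a, w b⁆ ^ 2 : R) : V ≃ₗ[F] V) = (c * c) • 1 := by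
        rw [pow_two, Subgroup.coe_mul, toEnd_mul, hc', smul_mul_smul_comm, one_mul]
      rw [hsq1] at h4
      obtain ⟨v, hv⟩ := exists_ne (0 : V)
      have h5 : v = (c * c) • v := LinearMap.congr_fun h4 v
      have h6 : (c * c - 1) • v = 0 := by rw [sub_smul, ← h5, one_smul, sub_self]
      exact sub_eq_zero.mp ((smul_eq_zero.mp h6).resolve_right hv)
    obtain ⟨z, hz⟩ := exists_sgn_eq hcc
    exact ⟨z, by rw [hz]; exact h1⟩
  choose β hβ using hcomm
  have hne : ∀ a b, ρ a * ρ b ≠ 0 := fun a b => by rw [← toEnd_mul]; exact toEnd_ne_zero _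
  have hβuniq : ∀ a b z, ρ a * ρ b = sgn F z • (ρ b * ρ a) → β a b = z := by
    intro a b z hz
    apply sgn_injective h2
    rw [hβ a b, ← sub_eq_zero, ← sub_smul] at hz
    exact sub_eq_zero.mp ((smul_eq_zero.mp hz).resolve_right (hne b a))
  have hmul : ∀ a b, ∃ c : F, ρ a * ρ b = c • ρ (a + b) := fun a b => hsc _ _ (hw2 a b)
  have hmul' : ∀ a b, ∃ c : F, ρ (a + b) = c • (ρ a * ρ b) := fun a b => by
    obtain ⟨c, hc⟩ := hmul a b
    have hc0 : c ≠ 0 := by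
      rintro rfl
      rw [zero_smul] at hc
      exact hne a b hc
    exact ⟨c⁻¹, by rw [hc, smul_smul, inv_mul_cancel₀ hc0, one_smul]⟩
  have hadd : ∀ a a' b, β (a + a') b = β a b + β a' b := by
    intro a a' b
    apply hβuniq
    obtain ⟨c, hc⟩ := hmul' a a'
    rw [hc, smul_mul_assoc, mul_assoc, hβ a' b, mul_smul_comm, ← mul_assoc, hβ a b, smul_mul_assoc,
      mul_smul_comm, sgn_add, smul_smul, smul_smul, smul_smul, mul_assoc (ρ b)]
    congr 1
    ring
  have hsymm : ∀ a b, β a b = β b a := by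
    intro a b
    apply hβuniq
    rw [hβ b a, smul_smul, sgn_mul_self, one_smul]
  let B : E →ₗ[ZMod 2] E →ₗ[ZMod 2] ZMod 2 :=
    LinearMap.mk₂ (ZMod 2) β hadd
      (fun c a b => by
        rcases zmod_two_cases c with rfl | rfl
        · have := hadd 0 0 b
          rw [add_zero] at this
          simpa using this
        · simp)
      (fun a b b' => by rw [hsymm a, hadd, hsymm b, hsymm b'])
      (fun c a b => by
        rw [hsymm a, hsymm a]
        rcases zmod_two_cases c with rfl | rfl
        · have := hadd 0 0 a
          rw [add_zero] at this
          simpa using this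
        · simp)
  have hspan : Submodule.span F (toEnd '' (Set.range fun a => ((w a : R) : V ≃ₗ[F] V))) = ⊤ := by
    rw [eq_top_iff, ← h.span_eq_top, Submodule.span_le]
    rintro _ ⟨x, hx, rfl⟩
    obtain ⟨a, ha⟩ := hw1 ⟨x, hx⟩
    obtain ⟨c, hc⟩ := hsc _ _ ha
    change toEnd x = _ at hc
    rw [hc]
    exact Submodule.smul_mem _ _ (Submodule.subset_span ⟨_, ⟨a, rfl⟩, rfl⟩)
  refine ⟨B, fun a => w a, ⟨fun a => (w a).2, fun x hx => ?_, hmul, hβ, hspan, fun a ha => ?_⟩,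
    fun a => ?_, fun x hx => ?_⟩
  · obtain ⟨a, ha⟩ := hw1 ⟨x, hx⟩
    obtain ⟨c, hc⟩ := hsc _ _ ha
    exact ⟨a, c, hc⟩
  · have hcen : ∀ b, w a * w b = w b * w a := by
      intro b
      have h1 := hβ a b
      have h3 : β a b = 0 := ha b
      rw [h3, sgn_zero, one_smul] at h1
      exact Subtype.ext (toEnd_injective h1)
    have hwa : w a ∈ Subgroup.center R := by
      rw [Subgroup.mem_center_iff]
      intro x
      obtain ⟨b, z, hz, rfl⟩ := hex x
      rw [Subgroup.mem_center_iff] at hz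
      rw [mul_assoc, ← hz, ← mul_assoc, ← hcen, mul_assoc]
    have hw0 : w 0 ∈ Subgroup.center R := by
      have h1 := hw2 0 0
      rwa [add_zero, inv_mul_cancel_left] at h1
    exact hw3 a 0 (mul_mem (inv_mem hwa) hw0)
  · exact hβuniq a a 0 (by rw [sgn_zero, one_smul])
  · obtain ⟨a, z, hz, hx'⟩ := hex ⟨x, hx⟩
    exact ⟨a, z, hz, congrArg Subtype.val hx'⟩

end FrameExistence

section Scalar

variable {F V : Type*} [Field F] [AddCommGroup V] [Module F V]

lemma smul_one_injective [Nontrivial V] {a b : F}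
    (h : a • (1 : Module.End F V) = b • (1 : Module.End F V)) : a = b := by
  rw [← sub_eq_zero, ← sub_smul] at h
  exact sub_eq_zero.mp ((smul_eq_zero.mp h).resolve_right one_ne_zero)

/-- Multiplication by a nonzero scalar as a linear automorphism. -/
noncomputable def scalarEquiv (V : Type*) [AddCommGroup V] [Module F V] (c : F) (hc : c ≠ 0) :
    V ≃ₗ[F] V := LinearEquiv.smulOfNeZero F V c hc

lemma toEnd_scalarEquiv (c : F) (hc : c ≠ 0) : toEnd (scalarEquiv V c hc) = c • 1 := by
  ext v; rfl

lemma toEnd_mul_inv_of_smul {x y : V ≃ₗ[F] V} {c : F} (h : toEnd x = c • toEnd y) :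
    toEnd (x * y⁻¹) = c • 1 := by
  rw [toEnd_mul, h, smul_mul_assoc, toEnd_mul_inv]

lemma ne_zero_of_toEnd_eq [Nontrivial V] {x : V ≃ₗ[F] V} {c : F} {S : Module.End F V}
    (h : toEnd x = c • S) : c ≠ 0 := by
  rintro rfl
  rw [zero_smul] at h
  exact toEnd_ne_zero x h

end Scalar

/-! ### Frames of extraspecial groups and their quadratic forms -/

section QuadraticFrames

variable {F V : Type*} [Field F] [AddCommGroup V] [Module F V]
  {E : Type*} [AddCommGroup E] [Module (ZMod 2) E]
  {R : Subgroup (V ≃ₗ[F] V)} {Q : QuadraticForm (ZMod 2) E} {w : E → V ≃ₗ[F] V}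

lemma IsQuadraticFrame.mem_iff (h : IsQuadraticFrame R Q w) {x : V ≃ₗ[F] V} {a : E} {c : F}
    (hx : toEnd x = c • toEnd (w a)) : x ∈ R ↔ c * c = 1 := by
  rw [← h.scalar_mem _ c (toEnd_mul_inv_of_smul hx), Subgroup.mul_mem_cancel_right]
  exact inv_mem (h.mem a)

lemma IsQuadraticFrame.nondegenerate (h : IsQuadraticFrame R Q w) : QuadraticNondegenerate Q :=
  fun v hv => h.nondeg v hv

/-- Extraspecial `2`-groups in dimension `2 ^ n` have quadratic frames. -/
lemma IsExtraspecial.exists_isQuadraticFrame [FiniteDimensional F V] [Finite F] {n : ℕ}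
    (hdvd : 2 ∣ Nat.card F - 1) (hV : Module.finrank F V = 2 ^ n) (hR : IsExtraspecial 2 n R) :
    ∃ (Q : QuadraticForm (ZMod 2) (Space2 n)) (w : Space2 n → V ≃ₗ[F] V),
      IsQuadraticFrame R Q w := by
  have h := IsHeisenberg.of_isExtraspecial Nat.prime_two hdvd hV hR
  have h2 := two_ne_zero_of_dvd_card hdvd
  have := h.nontrivial
  obtain ⟨-, hcen, -, hsq, -⟩ := hR
  obtain ⟨B, w, hw, hB, hex⟩ := h.exists_isFrame hsq (Space2 n) (by simp)
  have hcenter : ∀ z : R, z ∈ Subgroup.center R → ∃ c : F, c * c = 1 ∧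
      toEnd (z : V ≃ₗ[F] V) = c • 1 := by
    intro z hz
    obtain ⟨c, hc⟩ := h.exists_scalar_of_mem_center hz
    refine ⟨c, ?_, hc⟩
    have h1 : z ^ 2 = 1 := by
      have : (⟨z, hz⟩ : Subgroup.center R) ^ 2 = 1 := by rw [← hcen]; exact pow_card_eq_one'
      exact congrArg Subtype.val this
    have h3 : toEnd ((z ^ 2 : R) : V ≃ₗ[F] V) = (c * c) • 1 := by
      rw [pow_two, Subgroup.coe_mul, toEnd_mul, hc, smul_mul_smul_comm, one_mul]
    rw [h1] at h3
    apply smul_one_injective (V := V)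
    rw [← h3, one_smul]; rfl
  -- Scalars in `R` are central, and the centre has order 2, so they are exactly 1 and -1.
  have hscal : ∀ x : V ≃ₗ[F] V, ∀ c : F, toEnd x = c • 1 → (x ∈ R ↔ c * c = 1) := by
    intro x c hx
    constructor
    · intro hxR
      have hxc : (⟨x, hxR⟩ : R) ∈ Subgroup.center R := by
        rw [Subgroup.mem_center_iff]
        intro y
        apply Subtype.ext
        apply toEnd_injective
        change toEnd (y : V ≃ₗ[F] V) * toEnd x = toEnd x * toEnd (y : V ≃ₗ[F] V)
        rw [hx]; simp
      obtain ⟨c', hc', hx'⟩ := hcenter _ hxc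
      have : c = c' := smul_one_injective (V := V) (hx.symm.trans hx')
      rwa [this]
    · intro hc
      rcases mul_self_eq_one_iff.mp hc with rfl | rfl
      · have : x = 1 := toEnd_injective (by rw [hx, one_smul]; rfl)
        rw [this]; exact one_mem R
      · obtain ⟨z, hz⟩ : ∃ z : Subgroup.center R, z ≠ 1 := by
          have : Nontrivial (Subgroup.center R) := by
            have : Finite (Subgroup.center R) := Nat.finite_of_card_ne_zero (by omega)
            rw [← Finite.one_lt_card_iff_nontrivial]
            omega
          exact exists_ne 1
        obtain ⟨c', hc', hz'⟩ := hcenter z z.2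
        rcases mul_self_eq_one_iff.mp hc' with rfl | rfl
        · exfalso
          apply hz
          apply Subtype.ext
          apply Subtype.ext
          apply toEnd_injective
          rw [hz', one_smul]; rfl
        · have : x = ((z : R) : V ≃ₗ[F] V) := toEnd_injective (hx.trans hz'.symm)
          rw [this]; exact (z : R).2
  have hsq' : ∀ a, ∃ t : ZMod 2, toEnd (w a) * toEnd (w a) = sgn F t • 1 := by
    intro a
    obtain ⟨c, hc, hc'⟩ := hcenter _ (hsq ⟨w a, hw.mem a⟩)
    obtain ⟨t, ht⟩ := exists_sgn_eq hc
    refine ⟨t, ?_⟩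
    rw [ht, ← hc', pow_two]; rfl
  choose q hq using hsq'
  -- Squaring w a * w b = ± w (a + b) and commuting the middle factors gives the polarisation
  -- identity with polar form `B`.
  have hqadd : ∀ a b, q (a + b) = q a + q b + B a b := by
    intro a b
    obtain ⟨c, hc⟩ := hw.mul a b
    rw [← toEnd_mul] at hc
    have hcc : c * c = 1 := by
      have h1 := toEnd_mul_inv_of_smul hc
      rw [← hscal _ _ h1]
      exact mul_mem (mul_mem (hw.mem a) (hw.mem b)) (inv_mem (hw.mem _))
    apply sgn_injective h2
    apply smul_one_injective (V := V)
    have hsym : sgn F (B a b) = sgn F (B b a) := by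
      congr 1
      have h1 := hB (a + b)
      simp only [map_add, LinearMap.add_apply, hB, zero_add, add_zero] at h1
      have h3 : ∀ s t : ZMod 2, s + t = 0 → t = s := by decide
      exact h3 _ _ h1
    calc sgn F (q (a + b)) • (1 : Module.End F V)
        = (c * c) • (toEnd (w (a + b)) * toEnd (w (a + b))) := by rw [hcc, one_smul, hq]
      _ = (c • toEnd (w (a + b))) * (c • toEnd (w (a + b))) := by rw [smul_mul_smul_comm]
      _ = toEnd (w a) * (toEnd (w b) * toEnd (w a)) * toEnd (w b) := by
          rw [← hc, toEnd_mul]; simp only [mul_assoc]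
      _ = sgn F (B b a) • ((toEnd (w a) * toEnd (w a)) * (toEnd (w b) * toEnd (w b))) := by
          rw [hw.comm b a, mul_smul_comm, smul_mul_assoc]; simp only [mul_assoc]
      _ = _ := by
          rw [hq, hq, smul_mul_smul_comm, one_mul, smul_smul, sgn_add, sgn_add, hsym]
          congr 1; ring
  have hq0 : q 0 = 0 := by
    have h1 := hqadd 0 0
    simp only [add_zero, map_zero] at h1
    have h3 : ∀ s : ZMod 2, s = s + s → s = 0 := by decide
    exact h3 _ h1
  let Q : QuadraticForm (ZMod 2) (Space2 n) :=
    { toFun := q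
      toFun_smul := fun c a => by
        rcases zmod_two_cases c with rfl | rfl
        · simp [hq0]
        · simp
      exists_companion' := ⟨B, hqadd⟩ }
  have hQB : Q.polarBilin = B := by
    refine LinearMap.ext fun a => LinearMap.ext fun b => ?_
    rw [polarBilin_eq, QuadraticMap.polar]
    change q (a + b) - q a - q b = _
    rw [hqadd]; ring
  exact ⟨Q, w, ⟨hQB ▸ hw, hq, hscal⟩⟩

variable [FiniteDimensional (ZMod 2) E]

/-- The elements of the group with a quadratic frame, parametrised by vectors and signs. -/
lemma IsQuadraticFrame.exists_param [Nontrivial V] (h2 : (2 : F) ≠ 0)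
    (h : IsQuadraticFrame R Q w) :
    ∃ f : E × ZMod 2 → V ≃ₗ[F] V, Function.Injective f ∧
      (∀ p, toEnd (f p) = sgn F p.2 • toEnd (w p.1)) ∧ ∀ x, x ∈ R ↔ ∃ p, f p = x := by
  let f : E × ZMod 2 → V ≃ₗ[F] V := fun p => scalarEquiv V (sgn F p.2) (sgn_ne_zero _) * w p.1
  have hf : ∀ p, toEnd (f p) = sgn F p.2 • toEnd (w p.1) := fun p => by
    rw [toEnd_mul, toEnd_scalarEquiv, smul_mul_assoc, one_mul]
  refine ⟨f, ?_, hf, fun x => ⟨fun hx => ?_, ?_⟩⟩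
  · rintro ⟨a, s⟩ ⟨b, t⟩ hab
    have h1 := congrArg toEnd hab
    rw [hf, hf] at h1
    have h3 : toEnd (w a) = (sgn F s * sgn F t) • toEnd (w b) := by
      rw [mul_smul, ← h1, smul_smul, sgn_mul_self, one_smul]
    obtain rfl := h.eq_of_smul h2 h3
    have h4 : sgn F s = sgn F t := by
      rw [← sub_eq_zero, ← sub_smul] at h1
      exact sub_eq_zero.mp ((smul_eq_zero.mp h1).resolve_right (toEnd_ne_zero _))
    rw [sgn_injective h2 h4]
  · obtain ⟨a, c, hc⟩ := h.exists_eq x hx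
    obtain ⟨t, rfl⟩ := exists_sgn_eq ((h.mem_iff hc).mp hx)
    exact ⟨(a, t), toEnd_injective (by rw [hf, hc])⟩
  · rintro ⟨p, rfl⟩
    rw [h.mem_iff (hf p), sgn_mul_self]

/-- A totally singular subspace corresponds to an elementary abelian subgroup. -/
lemma IsQuadraticFrame.exists_subgroup_of_hasHalfSingular [Nontrivial V] (h2 : (2 : F) ≠ 0)
    (h : IsQuadraticFrame R Q w) {n : ℕ} (hE : Module.finrank (ZMod 2) E = 2 * n)
    (hQ : HasHalfSingular Q) : ∃ A : Subgroup R, Nat.card A = 2 ^ (n + 1) ∧ ∀ x ∈ A, x ^ 2 = 1 := by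
  obtain ⟨W, hW, hW0⟩ := hQ
  obtain ⟨f, hfi, hf, hfR⟩ := h.exists_param h2
  have hW00 : ∀ x : R, ∀ a ∈ W, ∀ t, f (a, t) = x → x * x = 1 := by
    intro x a ha t hx
    apply Subtype.ext
    apply toEnd_injective
    change toEnd (x : V ≃ₗ[F] V) * toEnd (x : V ≃ₗ[F] V) = toEnd 1
    rw [← hx, hf, smul_mul_smul_comm, sgn_mul_self, one_smul, h.sq, hW0 a ha, sgn_zero, one_smul]
    rfl
  let A : Subgroup R :=
    { carrier := {x | ∃ a ∈ W, ∃ t, f (a, t) = x}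
      one_mem' := by
        obtain ⟨⟨a, t⟩, hp⟩ := (hfR 1).mp (one_mem R)
        refine ⟨a, ?_, t, hp⟩
        -- A frame element that is a scalar commutes with the whole frame, so its index lies in the
        -- radical.
        have ha : a = 0 := by
          refine h.nondeg a fun b => ?_
          rw [← sgn_eq_one h2]
          have e1 := h.comm a b
          have e2 : toEnd (w a) = sgn F t • 1 := by
            have := congrArg toEnd hp
            rw [hf] at this
            calc toEnd (w a) = (sgn F t * sgn F t) • toEnd (w a) := by rw [sgn_mul_self, one_smul]
              _ = sgn F t • 1 := by rw [mul_smul, this]; rfl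
          rw [e2, smul_mul_assoc, one_mul, mul_smul_comm, mul_one, smul_smul, ← sub_eq_zero,
            ← sub_smul] at e1
          have e3 := (smul_eq_zero.mp e1).resolve_right (toEnd_ne_zero _)
          have e4 : sgn F t * (1 - sgn F (Q.polarBilin a b)) = 0 := by linear_combination e3
          exact (sub_eq_zero.mp ((mul_eq_zero.mp e4).resolve_left (sgn_ne_zero _))).symm
        rw [ha]; exact W.zero_mem
      mul_mem' := by
        rintro x y ⟨a, ha, s, hx⟩ ⟨b, hb, t, hy⟩
        obtain ⟨⟨c, u⟩, hp⟩ := (hfR (x * y : R)).mp (x * y).2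
        refine ⟨c, ?_, u, hp⟩
        obtain ⟨k, hk⟩ := h.mul a b
        have e1 := congrArg toEnd hp
        rw [Subgroup.coe_mul, toEnd_mul, ← hx, ← hy, hf, hf, hf, smul_mul_smul_comm, hk,
          smul_smul] at e1
        have e2 : toEnd (w c) = (sgn F u * (sgn F s * sgn F t * k)) • toEnd (w (a + b)) := by
          rw [mul_smul, ← e1, smul_smul, sgn_mul_self, one_smul]
        rw [h.eq_of_smul h2 e2]
        exact W.add_mem ha hb
      inv_mem' := by
        rintro x ⟨a, ha, s, hx⟩
        have : x⁻¹ = x := inv_eq_of_mul_eq_one_left (hW00 x a ha s hx)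
        rw [this]
        exact ⟨a, ha, s, hx⟩ }
  refine ⟨A, ?_, ?_⟩
  · have e : (W × ZMod 2) ≃ A := Equiv.ofBijective
      (fun p => ⟨⟨f (p.1, p.2), (hfR _).mpr ⟨_, rfl⟩⟩, p.1, p.1.2, p.2, rfl⟩) ⟨by
        rintro ⟨a, s⟩ ⟨b, t⟩ hab
        have h1 := hfi (congrArg (fun x : A => ((x : R) : V ≃ₗ[F] V)) hab)
        simp only [Prod.mk.injEq] at h1
        exact Prod.ext (Subtype.ext h1.1) h1.2, by
        rintro ⟨x, a, ha, t, hx⟩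
        exact ⟨(⟨a, ha⟩, t), Subtype.ext (Subtype.ext hx)⟩⟩
    rw [← Nat.card_congr e, Nat.card_prod, Module.natCard_eq_pow_finrank (K := ZMod 2) (V := W),
      Nat.card_zmod, show Module.finrank (ZMod 2) W = n by omega, pow_succ]
  · rintro x ⟨a, ha, t, hx⟩
    rw [pow_two]
    exact hW00 x a ha t hx

/-- A large elementary abelian subgroup yields a totally singular subspace of half the
dimension. -/
lemma IsQuadraticFrame.hasHalfSingular_of_subgroup [Nontrivial V] (h2 : (2 : F) ≠ 0)
    (h : IsQuadraticFrame R Q w) {n : ℕ} (hE : Module.finrank (ZMod 2) E = 2 * n)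
    (A : Subgroup R) (hA : Nat.card A = 2 ^ (n + 1)) (hA2 : ∀ x ∈ A, x ^ 2 = 1) :
    ∃ W : Submodule (ZMod 2) E, 2 * Module.finrank (ZMod 2) W = Module.finrank (ZMod 2) E ∧
      (∀ a ∈ W, Q a = 0) ∧ ∀ a, a ∈ W ↔ ∃ x ∈ A, ∃ c : F, toEnd ((x : R) : V ≃ₗ[F] V) =
        c • toEnd (w a) := by
  -- The indices occurring in `A`. As x² = 1 on `A`, they are singular, so 2 dim W ≤ dim E; each
  -- index comes from at most two elements, which gives the opposite bound.
  let W : AddSubgroup E :=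
    { carrier := {a | ∃ x ∈ A, ∃ c : F, toEnd ((x : R) : V ≃ₗ[F] V) = c • toEnd (w a)}
      zero_mem' := by
        refine ⟨1, one_mem A, ?_⟩
        obtain ⟨c, hc⟩ := h.mul 0 0
        rw [add_zero] at hc
        have e1 := congrArg (· * toEnd (w 0)⁻¹) hc
        simp only [mul_assoc, toEnd_mul_inv, mul_one, smul_mul_assoc] at e1
        rw [← toEnd_mul] at hc
        have hc0 := ne_zero_of_toEnd_eq hc
        exact ⟨c⁻¹, by rw [e1, smul_smul, inv_mul_cancel₀ hc0, one_smul]; rfl⟩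
      add_mem' := by
        rintro a b ⟨x, hx, c, hc⟩ ⟨y, hy, d, hd⟩
        obtain ⟨k, hk⟩ := h.mul a b
        refine ⟨x * y, mul_mem hx hy, c * d * k, ?_⟩
        rw [Subgroup.coe_mul, toEnd_mul, hc, hd, smul_mul_smul_comm, hk, smul_smul]
      neg_mem' := by
        rintro a ha
        rwa [ZModModule.neg_eq_self] }
  let W' : Submodule (ZMod 2) E := AddSubgroup.toZModSubmodule 2 W
  have hmem : ∀ a, a ∈ W' ↔ ∃ x ∈ A, ∃ c : F, toEnd ((x : R) : V ≃ₗ[F] V) = c • toEnd (w a) :=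
    fun a => Iff.rfl
  have hsing : ∀ a ∈ W', Q a = 0 := by
    intro a ha
    obtain ⟨x, hx, c, hc⟩ := (hmem a).mp ha
    have hcc := (h.mem_iff hc).mp x.2
    rw [← sgn_eq_one h2]
    apply smul_one_injective (V := V)
    have h1 := hA2 x hx
    rw [pow_two] at h1
    have h3 : toEnd ((x * x : R) : V ≃ₗ[F] V) = sgn F (Q a) • 1 := by
      rw [Subgroup.coe_mul, toEnd_mul, hc, smul_mul_smul_comm, hcc, one_smul, h.sq]
    rw [← h3, h1, one_smul]; rfl
  refine ⟨W', ?_, hsing, hmem⟩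
  have hiso : ∀ v ∈ W', ∀ w ∈ W', Q.polarBilin v w = 0 := by
    intro v hv w hw
    have h := quadratic_add Q v w
    rw [hsing v hv, hsing w hw, hsing _ (W'.add_mem hv hw)] at h
    simpa using h.symm
  have hle := two_mul_finrank_le_of_isotropic _ h.nondegenerate.right W' hiso
  obtain ⟨f, hfi, hf, hfR⟩ := h.exists_param h2
  have hcard : Nat.card A ≤ Nat.card (W' × ZMod 2) := by
    have hfin : Finite E := Module.finite_of_finite (ZMod 2)
    have hex : ∀ x : A, ∃ p : W' × ZMod 2, f (p.1, p.2) = ((x : R) : V ≃ₗ[F] V) := by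
      rintro ⟨x, hx⟩
      obtain ⟨⟨a, t⟩, hp⟩ := (hfR x).mp x.2
      refine ⟨(⟨a, x, hx, sgn F t, ?_⟩, t), hp⟩
      rw [← hp, hf]
    choose g hg using hex
    refine Nat.card_le_card_of_injective g fun x y hxy => ?_
    apply Subtype.ext
    apply Subtype.ext
    rw [← hg x, ← hg y, hxy]
  rw [hA, Nat.card_prod, Module.natCard_eq_pow_finrank (K := ZMod 2) (V := W'), Nat.card_zmod,
    ← pow_succ] at hcard
  have := (Nat.pow_le_pow_iff_right (by norm_num : 1 < 2)).mp hcard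
  omega

end QuadraticFrames

/-! ### The action of the normaliser on a frame -/

section InducedMaps

variable {F V : Type*} [Field F] [AddCommGroup V] [Module F V]
  {E : Type*} [AddCommGroup E] [Module (ZMod 2) E]
  {R : Subgroup (V ≃ₗ[F] V)} {B : E →ₗ[ZMod 2] E →ₗ[ZMod 2] ZMod 2} {w : E → V ≃ₗ[F] V}

/-- Conjugation by `T` maps the line of `w a` to the line of `w (φ a)`. -/
def Induces (w : E → V ≃ₗ[F] V) (T : V ≃ₗ[F] V) (φ : E → E) : Prop :=
  ∀ a, ∃ c : F, toEnd T * toEnd (w a) = c • (toEnd (w (φ a)) * toEnd T)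

lemma Induces.mul {T T' : V ≃ₗ[F] V} {φ φ' : E → E} (h : Induces w T φ) (h' : Induces w T' φ') :
    Induces w (T * T') (φ ∘ φ') := by
  intro a
  obtain ⟨c', hc'⟩ := h' a
  obtain ⟨c, hc⟩ := h (φ' a)
  refine ⟨c' * c, ?_⟩
  rw [toEnd_mul, mul_assoc, hc', mul_smul_comm, ← mul_assoc, hc, smul_mul_assoc, smul_smul,
    mul_assoc]
  rfl

lemma Induces.inv [Nontrivial V] {T : V ≃ₗ[F] V} {φ ψ : E → E} (h : Induces w T φ)
    (hψ : ∀ a, φ (ψ a) = a) : Induces w T⁻¹ ψ := by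
  intro a
  obtain ⟨c, hc⟩ := h (ψ a)
  rw [hψ] at hc
  have hc' : toEnd (T * w (ψ a)) = c • toEnd (w a * T) := hc
  have hc0 := ne_zero_of_toEnd_eq hc'
  refine ⟨c⁻¹, ?_⟩
  have h1 := congrArg (fun S => toEnd T⁻¹ * S * toEnd T⁻¹) hc
  simp only [mul_assoc, mul_smul_comm, smul_mul_assoc, toEnd_mul_inv, mul_one] at h1
  rw [← mul_assoc, toEnd_inv_mul, one_mul] at h1
  rw [h1, smul_smul, inv_mul_cancel₀ hc0, one_smul]

lemma Induces.unique [Nontrivial V] (h2 : (2 : F) ≠ 0) (hw : IsFrame R B w) {T : V ≃ₗ[F] V}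
    {φ ψ : E → E} (h : Induces w T φ) (h' : Induces w T ψ) (a : E) : φ a = ψ a := by
  obtain ⟨c, hc⟩ := h a
  obtain ⟨d, hd⟩ := h' a
  have hc0 : c ≠ 0 := ne_zero_of_toEnd_eq (x := T * w a) hc
  have h1 : toEnd (w (φ a)) * toEnd T = (c⁻¹ * d) • (toEnd (w (ψ a)) * toEnd T) := by
    rw [mul_smul, ← hd, hc, smul_smul, inv_mul_cancel₀ hc0, one_smul]
  have h3 := congrArg (· * toEnd T⁻¹) h1
  simp only [mul_assoc, smul_mul_assoc, toEnd_mul_inv, mul_one] at h3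
  exact hw.eq_of_smul h2 h3

/-- The maps induced by elements of the normaliser are linear. -/
lemma IsFrame.exists_hom [Nontrivial V] (h2 : (2 : F) ≠ 0) (hw : IsFrame R B w) :
    ∃ Φ : Subgroup.normalizer (R : Set (V ≃ₗ[F] V)) →* (E ≃ₗ[ZMod 2] E),
      ∀ T : Subgroup.normalizer (R : Set (V ≃ₗ[F] V)),
        Induces w (T : V ≃ₗ[F] V) (Φ T) := by
  have hex : ∀ T : Subgroup.normalizer (R : Set (V ≃ₗ[F] V)), ∀ a, ∃ b, ∃ c : F,
      toEnd (T : V ≃ₗ[F] V) * toEnd (w a) = c • (toEnd (w b) * toEnd (T : V ≃ₗ[F] V)) := by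
    rintro ⟨T, hT⟩ a
    have h1 := (Subgroup.mem_normalizer_iff.mp hT (w a)).mp (hw.mem a)
    obtain ⟨b, c, hc⟩ := hw.exists_eq _ h1
    refine ⟨b, c, ?_⟩
    rw [← smul_mul_assoc, ← hc, ← toEnd_mul, ← toEnd_mul]
    simp
  choose φ hφ using hex
  have hφ' : ∀ T : Subgroup.normalizer (R : Set (V ≃ₗ[F] V)),
      Induces w (T : V ≃ₗ[F] V) (φ T) := fun T a => hφ T a
  have hadd : ∀ (T : Subgroup.normalizer (R : Set (V ≃ₗ[F] V))) (a b : E),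
      φ T (a + b) = φ T a + φ T b := by
    intro T a b
    obtain ⟨k, hk⟩ := hw.mul a b
    obtain ⟨k', hk'⟩ := hw.mul (φ T a) (φ T b)
    obtain ⟨c, hc⟩ := hφ T a
    obtain ⟨d, hd⟩ := hφ T b
    obtain ⟨e, he⟩ := hφ T (a + b)
    have hk0 : k ≠ 0 := ne_zero_of_toEnd_eq (x := w a * w b) hk
    have he0 : e ≠ 0 := ne_zero_of_toEnd_eq (x := (T : V ≃ₗ[F] V) * w (a + b)) he
    have h1 : (k * e) • (toEnd (w (φ T (a + b))) * toEnd (T : V ≃ₗ[F] V)) =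
        (c * d * k') • (toEnd (w (φ T a + φ T b)) * toEnd (T : V ≃ₗ[F] V)) := by
      calc (k * e) • (toEnd (w (φ T (a + b))) * toEnd (T : V ≃ₗ[F] V))
          = toEnd (T : V ≃ₗ[F] V) * (toEnd (w a) * toEnd (w b)) := by
            rw [hk, mul_smul_comm, he, smul_smul]
        _ = (c * d) • ((toEnd (w (φ T a)) * toEnd (w (φ T b))) * toEnd (T : V ≃ₗ[F] V)) := by
            rw [← mul_assoc, hc, smul_mul_assoc, mul_assoc, hd, mul_smul_comm, smul_smul,
              mul_assoc]
        _ = _ := by rw [hk', smul_mul_assoc, smul_smul]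
    have h3 := congrArg (· * toEnd (T : V ≃ₗ[F] V)⁻¹) h1
    simp only [mul_assoc, smul_mul_assoc, toEnd_mul_inv, mul_one] at h3
    refine hw.eq_of_smul h2 (c := (k * e)⁻¹ * (c * d * k')) ?_
    rw [mul_smul, show c * d * k' = c * (d * k') by ring, ← h3, smul_smul,
      inv_mul_cancel₀ (mul_ne_zero hk0 he0), one_smul]
  have hmul : ∀ (T T' : Subgroup.normalizer (R : Set (V ≃ₗ[F] V))) (a : E),
      φ (T * T') a = φ T (φ T' a) := fun T T' a =>
    Induces.unique h2 hw (hφ' (T * T')) ((hφ' T).mul (hφ' T')) a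
  have hone : ∀ a, φ 1 a = a := fun a =>
    Induces.unique h2 hw (hφ' 1) (ψ := id) (fun a => ⟨1, by
      rw [one_smul]
      change toEnd 1 * _ = _ * toEnd 1
      rw [toEnd_one, one_mul, mul_one]; rfl⟩) a
  let L : Subgroup.normalizer (R : Set (V ≃ₗ[F] V)) → (E →ₗ[ZMod 2] E) := fun T =>
    AddMonoidHom.toZModLinearMap 2 (AddMonoidHom.mk' (φ T) (hadd T))
  have hL : ∀ T a, L T a = φ T a := fun T a => rfl
  refine ⟨{ toFun := fun T => LinearEquiv.ofLinearMap (L T) (L T⁻¹) ?_ ?_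
            map_one' := ?_
            map_mul' := ?_ }, fun T => hφ' T⟩
  · ext a
    rw [LinearMap.comp_apply, hL, hL, ← hmul, mul_inv_cancel, hone]; rfl
  · ext a
    rw [LinearMap.comp_apply, hL, hL, ← hmul, inv_mul_cancel, hone]; rfl
  · ext a
    exact hone a
  · intro T T'
    ext a
    exact hmul T T' a

/-- Induced maps preserve the commutator form. -/
lemma Induces.form_eq [Nontrivial V] (h2 : (2 : F) ≠ 0) (hw : IsFrame R B w) {T : V ≃ₗ[F] V}
    {φ : E → E} (h : Induces w T φ) (a b : E) : B (φ a) (φ b) = B a b := by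
  obtain ⟨c, hc⟩ := h a
  obtain ⟨d, hd⟩ := h b
  have hc0 : c ≠ 0 := ne_zero_of_toEnd_eq (x := T * w a) hc
  have hd0 : d ≠ 0 := ne_zero_of_toEnd_eq (x := T * w b) hd
  apply sgn_injective h2
  have h1 : ∀ (a b : E) (c d : F), toEnd T * toEnd (w a) = c • (toEnd (w (φ a)) * toEnd T) →
      toEnd T * toEnd (w b) = d • (toEnd (w (φ b)) * toEnd T) →
      toEnd T * (toEnd (w a) * toEnd (w b)) =
        (c * d) • (toEnd (w (φ a)) * toEnd (w (φ b)) * toEnd T) := by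
    intro a b c d hc hd
    rw [← mul_assoc, hc, smul_mul_assoc, mul_assoc, hd, mul_smul_comm, smul_smul, mul_assoc]
  have e1 := h1 a b c d hc hd
  have e2 := h1 b a d c hd hc
  rw [hw.comm a b, mul_smul_comm, e2, hw.comm (φ a) (φ b), smul_mul_assoc, smul_smul, smul_smul,
    ← sub_eq_zero, ← sub_smul] at e1
  have h3 : toEnd (w (φ b)) * toEnd (w (φ a)) * toEnd T ≠ 0 := by
    rw [← toEnd_mul, ← toEnd_mul]; exact toEnd_ne_zero _
  have h4 := (smul_eq_zero.mp e1).resolve_right h3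
  have h5 : (c * d) * (sgn F (B a b) - sgn F (B (φ a) (φ b))) = 0 := by linear_combination h4
  exact (sub_eq_zero.mp ((mul_eq_zero.mp h5).resolve_left (mul_ne_zero hc0 hd0))).symm

/-- An automorphism inducing the identity is a multiple of an element of the frame. -/
lemma IsFrame.exists_eq_smul_of_induces_id [Nontrivial V] [FiniteDimensional (ZMod 2) E]
    (h2 : (2 : F) ≠ 0) (hw : IsFrame R B w) (hsymm : ∀ a b, B a b = B b a) {T : V ≃ₗ[F] V}
    (h : Induces w T id) : ∃ (a : E) (c : F), toEnd T = c • toEnd (w a) := by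
  choose c hc using h
  have hc0 : ∀ a, c a ≠ 0 := fun a => ne_zero_of_toEnd_eq (x := T * w a) (hc a)
  have hne : ∀ a, toEnd (w a) * toEnd T ≠ 0 := fun a => by
    rw [← toEnd_mul]; exact toEnd_ne_zero _
  -- The scalars `c a` form a character of `E` with values ±1, the sign of a linear functional,
  -- which by nondegeneracy is pairing with some `d`.
  have hcadd : ∀ a b, c (a + b) = c a * c b := by
    intro a b
    obtain ⟨k, hk⟩ := hw.mul a b
    have hk0 : k ≠ 0 := ne_zero_of_toEnd_eq (x := w a * w b) hk
    have h1 : toEnd T * (toEnd (w a) * toEnd (w b)) =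
        (c a * c b) • (toEnd (w a) * toEnd (w b) * toEnd T) := by
      rw [← mul_assoc, hc a, smul_mul_assoc, id, mul_assoc, hc b, mul_smul_comm, smul_smul,
        id, mul_assoc]
    rw [hk, mul_smul_comm, hc, id, smul_mul_assoc, smul_smul, smul_smul, ← sub_eq_zero,
      ← sub_smul] at h1
    have h3 := (smul_eq_zero.mp h1).resolve_right (hne _)
    have h4 : k * (c (a + b) - c a * c b) = 0 := by linear_combination h3
    exact sub_eq_zero.mp ((mul_eq_zero.mp h4).resolve_left hk0)
  have hc00 : c 0 = 1 := by
    have h1 := hcadd 0 0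
    rw [add_zero] at h1
    exact (mul_eq_left₀ (hc0 0)).mp h1.symm
  have hcsq : ∀ a, c a * c a = 1 := fun a => by
    rw [← hcadd, ZModModule.add_self, hc00]
  have hex : ∀ a, ∃ z, sgn F z = c a := fun a => exists_sgn_eq (hcsq a)
  choose ℓ hℓ using hex
  let L : E →ₗ[ZMod 2] ZMod 2 := AddMonoidHom.toZModLinearMap 2 (AddMonoidHom.mk' ℓ fun a b => by
    apply sgn_injective h2
    rw [sgn_add, hℓ, hℓ, hℓ, hcadd])
  have hL : ∀ a, sgn F (L a) = c a := hℓ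
  obtain ⟨j, hj⟩ := exists_dual_section B (fun v hv => hw.nondeg v fun u => by
    rw [hsymm]; exact hv u) ⊤
  set d := j (L ∘ₗ (⊤ : Submodule (ZMod 2) E).subtype) with hd
  have hdL : ∀ a, B d a = L a := fun a => by
    rw [hsymm]
    exact hj ⟨a, Submodule.mem_top⟩ _
  -- The signs of `w d` and `T` cancel, so their product commutes with the frame. The inverse of `w
  -- d` lies in `R` and is thus again a multiple of a frame element.
  obtain ⟨k, hk⟩ := exists_scalar_of_commute hw.span (toEnd (w d) * toEnd T) (by
    rintro _ ⟨b, rfl⟩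
    rw [mul_assoc, hc b, mul_smul_comm, id, ← mul_assoc, hw.comm d b, smul_mul_assoc, smul_smul,
      hdL, hL, hcsq, one_smul, mul_assoc])
  obtain ⟨a, e, he⟩ := hw.exists_eq _ (inv_mem (hw.mem d))
  refine ⟨a, k * e, ?_⟩
  rw [mul_smul, ← he]
  calc toEnd T = toEnd (w d)⁻¹ * (toEnd (w d) * toEnd T) := by
        rw [← mul_assoc, toEnd_inv_mul, one_mul]
    _ = k • toEnd (w d)⁻¹ := by rw [hk, mul_smul_comm, mul_one]

/-- Elements of the group itself induce the identity. -/
lemma IsFrame.induces_id (hw : IsFrame R B w) {T : V ≃ₗ[F] V} (hT : ∃ (a : E) (c : F),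
    toEnd T = c • toEnd (w a)) : Induces w T id := by
  obtain ⟨a, c, hc⟩ := hT
  intro b
  refine ⟨sgn F (B a b), ?_⟩
  rw [hc, smul_mul_assoc, hw.comm, id, mul_smul_comm, smul_comm]

end InducedMaps

/-! ### Similarities and invariant forms -/

section SimilarityForms

variable {F V : Type*} [Field F] [AddCommGroup V] [Module F V] [FiniteDimensional F V]

/-- Forms invariant under a spanning set of automorphisms are unique up to scalars. -/
lemma exists_smul_of_invariant {S : Set (V ≃ₗ[F] V)}
    (hS : Submodule.span F (toEnd '' S) = ⊤) (B B' : V →ₗ[F] V →ₗ[F] F)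
    (hnd : ∀ v, (∀ w, B v w = 0) → v = 0) (hB : ∀ x ∈ S, ∀ v w, B (x v) (x w) = B v w)
    (hB' : ∀ x ∈ S, ∀ v w, B' (x v) (x w) = B' v w) :
    ∃ c : F, ∀ v w, B' v w = c * B v w := by
  have hinj : Function.Injective B := by
    rw [injective_iff_map_eq_zero]
    intro v hv
    exact hnd v fun w => by rw [hv]; rfl
  let e : V ≃ₗ[F] Module.Dual F V := LinearEquiv.ofInjectiveOfFinrankEq B hinj
    (Subspace.dual_finrank_eq (K := F) (V := V)).symm
  have he : ∀ v, e v = B v := fun v => rfl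
  -- `D` compares the forms by B(D v, w) = B'(v, w); invariance of both makes it commute with the
  -- spanning set.
  let D : Module.End F V := e.symm.toLinearMap ∘ₗ B'
  have hD : ∀ v w, B (D v) w = B' v w := fun v w => by
    rw [← he]; simp [D]
  obtain ⟨c, hc⟩ := exists_scalar_of_commute hS D (by
    intro x hx
    ext v
    rw [Module.End.mul_apply, Module.End.mul_apply, ← sub_eq_zero]
    apply hnd
    intro w
    obtain ⟨w, rfl⟩ := x.surjective w
    rw [map_sub, LinearMap.sub_apply, hD]
    change B' (x v) (x w) - B (x (D v)) (x w) = 0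
    rw [hB' x hx, hB x hx, hD, sub_self])
  refine ⟨c, fun v w => ?_⟩
  rw [← hD, hc]
  simp

variable {B : V →ₗ[F] V →ₗ[F] F}

/-- `T` is a similarity of the form `B` with multiplier `c`. -/
def IsSimilarity (B : V →ₗ[F] V →ₗ[F] F) (T : V ≃ₗ[F] V) (c : F) : Prop :=
  ∀ v w, B (T v) (T w) = c * B v w

lemma mem_formIsometries {T : V ≃ₗ[F] V} :
    T ∈ formIsometries (fun v w => B v w) ↔ ∀ v w, B (T v) (T w) = B v w := Iff.rfl

lemma mem_formIsometries_iff_isSimilarity {T : V ≃ₗ[F] V} :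
    T ∈ formIsometries (fun v w => B v w) ↔ IsSimilarity B T 1 := by
  simp [mem_formIsometries, IsSimilarity]

lemma IsSimilarity.mul {T T' : V ≃ₗ[F] V} {c c' : F} (h : IsSimilarity B T c)
    (h' : IsSimilarity B T' c') : IsSimilarity B (T * T') (c * c') := fun v w => by
  change B (T (T' v)) (T (T' w)) = _
  rw [h, h', mul_assoc]

lemma IsSimilarity.inv {T : V ≃ₗ[F] V} {c : F} (h : IsSimilarity B T c) (hc : c ≠ 0) :
    IsSimilarity B T⁻¹ c⁻¹ := fun v w => by
  have h1 := h (T⁻¹ v) (T⁻¹ w)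
  have e : ∀ x, T (T⁻¹ x) = x := fun x => T.apply_symm_apply x
  rw [e, e] at h1
  rw [h1, inv_mul_cancel_left₀ hc]

lemma isSimilarity_of_toEnd_eq {T : V ≃ₗ[F] V} {c : F} (h : toEnd T = c • 1) :
    IsSimilarity B T (c * c) := fun v w => by
  have e : ∀ x, T x = c • x := fun x => LinearMap.congr_fun h x
  rw [e, e, map_smul, map_smul, LinearMap.smul_apply, smul_eq_mul, smul_eq_mul, mul_assoc]

lemma exists_form_ne_zero [Nontrivial V] (hnd : ∀ v, (∀ w, B v w = 0) → v = 0) :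
    ∃ v w, B v w ≠ 0 := by
  obtain ⟨v, hv⟩ := exists_ne (0 : V)
  by_contra hcon
  push Not at hcon
  exact hv (hnd v fun w => hcon v w)

lemma IsSimilarity.unique [Nontrivial V] (hnd : ∀ v, (∀ w, B v w = 0) → v = 0) {T : V ≃ₗ[F] V}
    {c c' : F} (h : IsSimilarity B T c) (h' : IsSimilarity B T c') : c = c' := by
  obtain ⟨v, w, hvw⟩ := exists_form_ne_zero hnd
  have := (h v w).symm.trans (h' v w)
  exact mul_right_cancel₀ hvw this

lemma IsSimilarity.ne_zero [Nontrivial V] (hnd : ∀ v, (∀ w, B v w = 0) → v = 0) {T : V ≃ₗ[F] V}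
    {c : F} (h : IsSimilarity B T c) : c ≠ 0 := by
  rintro rfl
  obtain ⟨v, w, hvw⟩ := exists_form_ne_zero hnd
  obtain ⟨v, rfl⟩ := T.surjective v
  obtain ⟨w, rfl⟩ := T.surjective w
  rw [h, zero_mul] at hvw
  exact hvw rfl

/-- Similarities normalise the isometry group. -/
lemma IsSimilarity.mem_normalizer [Nontrivial V] (hnd : ∀ v, (∀ w, B v w = 0) → v = 0)
    {T : V ≃ₗ[F] V} {c : F} (h : IsSimilarity B T c) :
    T ∈ Subgroup.normalizer (formIsometries (fun v w => B v w) : Set (V ≃ₗ[F] V)) := by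
  have hc := h.ne_zero hnd
  rw [Subgroup.mem_normalizer_iff]
  intro g
  rw [mem_formIsometries_iff_isSimilarity, mem_formIsometries_iff_isSimilarity]
  constructor
  · intro hg
    have := (h.mul hg).mul (h.inv hc)
    rwa [mul_one, mul_inv_cancel₀ hc] at this
  · intro hg
    have := ((h.inv hc).mul hg).mul h
    rw [mul_one, inv_mul_cancel₀ hc] at this
    have e : T⁻¹ * (T * g * T⁻¹) * T = g := by group
    rwa [e] at this

/-- An automorphism that conjugates one spanning group of isometries to another one is a
similarity. -/
lemma exists_isSimilarity {R R' : Subgroup (V ≃ₗ[F] V)}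
    (hR : Submodule.span F (toEnd '' (R : Set (V ≃ₗ[F] V))) = ⊤)
    (hnd : ∀ v, (∀ w, B v w = 0) → v = 0) (hRG : R ≤ formIsometries (fun v w => B v w))
    (hRG' : R' ≤ formIsometries (fun v w => B v w)) {T : V ≃ₗ[F] V}
    (hT : ∀ x ∈ R, T * x * T⁻¹ ∈ R') : ∃ c : F, IsSimilarity B T c := by
  -- The form B(T v, T w) is invariant under `R` as well, so it is a multiple of `B`.
  refine exists_smul_of_invariant hR B (B.compl₁₂ (toEnd T) (toEnd T)) hnd
    (fun x hx => hRG hx) (fun x hx v w => ?_)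
  have h1 := hRG' (hT x hx) (T v) (T w)
  have e : ∀ u, (T * x * T⁻¹) (T u) = T (x u) := fun u => by
    change T (x (T⁻¹ (T u))) = _
    rw [show T⁻¹ (T u) = u from T.symm_apply_apply u]
  simp only [e] at h1
  exact h1

/-- For an isometry `x` with `x ^ 2 = -1` the automorphism `1 + x` is a similarity with
multiplier `2`. -/
lemma exists_one_add (h2 : (2 : F) ≠ 0) {x : V ≃ₗ[F] V} (hx : toEnd x * toEnd x = (-1 : F) • 1) :
    ∃ T : V ≃ₗ[F] V, toEnd T = 1 + toEnd x ∧
      (x ∈ formIsometries (fun v w => B v w) → IsSimilarity B T 2) := by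
  have hx' : toEnd x * toEnd x = -1 := by rw [hx]; simp
  -- (1 + x)(1 - x) = 1 - x² = 2, which exhibits the inverse.
  have e1 : (1 + toEnd x) * ((2 : F)⁻¹ • (1 - toEnd x)) = 1 := by
    rw [mul_smul_comm, add_mul, one_mul, mul_sub, mul_one, hx']
    have : (1 : Module.End F V) - toEnd x + (toEnd x - -1) = (2 : F) • 1 := by
      rw [two_smul]; abel
    rw [this, smul_smul, inv_mul_cancel₀ h2, one_smul]
  have e2 : ((2 : F)⁻¹ • (1 - toEnd x)) * (1 + toEnd x) = 1 := by
    rw [smul_mul_assoc, sub_mul, one_mul, mul_add, mul_one, hx']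
    have : (1 : Module.End F V) + toEnd x - (toEnd x + -1) = (2 : F) • 1 := by
      rw [two_smul]; abel
    rw [this, smul_smul, inv_mul_cancel₀ h2, one_smul]
  refine ⟨LinearEquiv.ofLinearMap (1 + toEnd x) ((2 : F)⁻¹ • (1 - toEnd x)) e1 e2, ?_, ?_⟩
  · ext v; rfl
  · intro hxG v w
    change B (v + x v) (w + x w) = _
    have h1 : B (x (x v)) (x w) = B (x v) w := hxG (x v) w
    have h3 : x (x v) = -v := by
      have := LinearMap.congr_fun hx' v
      exact this
    rw [h3, map_neg, LinearMap.neg_apply] at h1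
    have h4 : B (x v) (x w) = B v w := hxG v w
    rw [map_add, map_add, LinearMap.add_apply, LinearMap.add_apply, ← h1, h4]
    ring

end SimilarityForms

/-! ### Conjugation of normalisers -/

section Conjugation

variable {F V : Type*} [Field F] [AddCommGroup V] [Module F V]

lemma mem_conjSubgroup {x y : V ≃ₗ[F] V} {M : Subgroup (V ≃ₗ[F] V)} :
    y ∈ conjSubgroup x M ↔ x⁻¹ * y * x ∈ M := by
  constructor
  · rintro ⟨z, hz, rfl⟩
    have : x⁻¹ * (x * z * x⁻¹) * x = z := by group
    change x⁻¹ * (x * z * x⁻¹) * x ∈ M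
    rwa [this]
  · intro h
    refine ⟨_, h, ?_⟩
    change x * (x⁻¹ * y * x) * x⁻¹ = y
    group

lemma conjSubgroup_inf_normalizer {G R R' : Subgroup (V ≃ₗ[F] V)} {x : V ≃ₗ[F] V}
    (hG : x ∈ Subgroup.normalizer (G : Set (V ≃ₗ[F] V)))
    (hR : ∀ y, y ∈ R ↔ x * y * x⁻¹ ∈ R') :
    G ⊓ Subgroup.normalizer (R' : Set (V ≃ₗ[F] V)) =
      conjSubgroup x (G ⊓ Subgroup.normalizer (R : Set (V ≃ₗ[F] V))) := by
  ext y
  rw [mem_conjSubgroup, Subgroup.mem_inf, Subgroup.mem_inf]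
  refine and_congr ?_ ?_
  · rw [Subgroup.mem_normalizer_iff.mp hG (x⁻¹ * y * x)]
    have : x * (x⁻¹ * y * x) * x⁻¹ = y := by group
    rw [this]
  · rw [Subgroup.mem_normalizer_iff, Subgroup.mem_normalizer_iff]
    constructor
    · intro h z
      have e : x * (x⁻¹ * y * x * z * (x⁻¹ * y * x)⁻¹) * x⁻¹ = y * (x * z * x⁻¹) * y⁻¹ := by group
      have h1 := h (x * z * x⁻¹)
      rw [← e] at h1
      exact (hR z).trans (h1.trans (hR _).symm)
    · intro h z
      have e : x * (x⁻¹ * z * x) * x⁻¹ = z := by group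
      have e' : x * (x⁻¹ * y * x * (x⁻¹ * z * x) * (x⁻¹ * y * x)⁻¹) * x⁻¹ = y * z * y⁻¹ := by group
      have h1 := ((hR _).symm.trans (h (x⁻¹ * z * x))).trans (hR _)
      rw [e, e'] at h1
      exact h1

end Conjugation

/-! ### Intertwiners of quadratic frames -/

section Intertwiners

variable {F V : Type*} [Field F] [AddCommGroup V] [Module F V] [Nontrivial V]
  {E E' : Type*} [AddCommGroup E] [Module (ZMod 2) E] [AddCommGroup E'] [Module (ZMod 2) E']
  [FiniteDimensional (ZMod 2) E] [FiniteDimensional (ZMod 2) E']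
  {R R' : Subgroup (V ≃ₗ[F] V)} {Q : QuadraticForm (ZMod 2) E} {Q' : QuadraticForm (ZMod 2) E'}
  {w : E → V ≃ₗ[F] V} {w' : E' → V ≃ₗ[F] V}

/-- Carrying `T` across the square of `w a` uses the intertwining relation twice. -/
lemma IsQuadraticFrame.sgn_eq_of_intertwines (h : IsQuadraticFrame R Q w)
    (h' : IsQuadraticFrame R' Q' w') {T : V ≃ₗ[F] V} {a : E} {b : E'} {k : F}
    (hk : toEnd T * toEnd (w a) = k • (toEnd (w' b) * toEnd T)) :
    sgn F (Q a) = k * k * sgn F (Q' b) := by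
  have e : toEnd T * (toEnd (w a) * toEnd (w a)) =
      (k * k) • (toEnd (w' b) * toEnd (w' b) * toEnd T) := by
    rw [← mul_assoc, hk, smul_mul_assoc, mul_assoc, hk, mul_smul_comm, smul_smul, mul_assoc]
  rw [h.sq, h'.sq, mul_smul_comm, smul_mul_assoc, mul_one, one_mul, smul_smul, ← sub_eq_zero,
    ← sub_smul] at e
  exact sub_eq_zero.mp ((smul_eq_zero.mp e).resolve_right (toEnd_ne_zero T))

/-- Since `φ` preserves the quadratic forms, the intertwining scalars have square 1, and these are
the scalars contained in both groups. -/
lemma IsQuadraticFrame.mem_iff_conj_mem (h : IsQuadraticFrame R Q w)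
    (h' : IsQuadraticFrame R' Q' w') {T : V ≃ₗ[F] V} {φ : E → E'} (hφ : Function.Surjective φ)
    (hQ : ∀ a, Q' (φ a) = Q a)
    (hT : ∀ a, ∃ c : F, toEnd T * toEnd (w a) = c • (toEnd (w' (φ a)) * toEnd T))
    (x : V ≃ₗ[F] V) : x ∈ R ↔ T * x * T⁻¹ ∈ R' := by
  have hsq : ∀ a, ∃ c : F, c * c = 1 ∧
      toEnd T * toEnd (w a) = c • (toEnd (w' (φ a)) * toEnd T) := by
    intro a
    obtain ⟨c, hc⟩ := hT a
    have h1 := h.sgn_eq_of_intertwines h' hc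
    rw [hQ] at h1
    exact ⟨c, (mul_eq_right₀ (sgn_ne_zero _)).mp h1.symm, hc⟩
  constructor
  · intro hx
    obtain ⟨a, k, hk⟩ := h.exists_eq x hx
    obtain ⟨c, hcc, hc⟩ := hsq a
    have hkk := (h.mem_iff hk).mp hx
    have e : toEnd (T * x * T⁻¹) = (k * c) • toEnd (w' (φ a)) := by
      rw [toEnd_mul, toEnd_mul, hk, mul_smul_comm, hc, smul_smul, smul_mul_assoc, mul_assoc,
        toEnd_mul_inv, mul_one]
    rw [h'.mem_iff e]
    linear_combination c * c * hkk + hcc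
  · intro hx
    obtain ⟨b, k, hk⟩ := h'.exists_eq _ hx
    obtain ⟨a, rfl⟩ := hφ b
    obtain ⟨c, hcc, hc⟩ := hsq a
    have hkk := (h'.mem_iff hk).mp hx
    have e : toEnd x = (k * c) • toEnd (w a) := by
      have e1 : toEnd (T * x) = k • (toEnd (w' (φ a)) * toEnd T) := by
        rw [← smul_mul_assoc, ← hk, ← toEnd_mul]; congr 1; group
      have e2 : toEnd (T * x) = (k * c) • (toEnd T * toEnd (w a)) := by
        rw [hc, smul_smul, mul_assoc, hcc, mul_one, e1]
      have e3 := congrArg (toEnd T⁻¹ * ·) e2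
      simp only [toEnd_mul, mul_smul_comm] at e3
      rwa [← mul_assoc, ← mul_assoc, toEnd_inv_mul, one_mul, one_mul] at e3
    rw [h.mem_iff e]
    linear_combination c * c * hkk + hcc

/-- Conjugates of frame elements stay in `R`, so the scalars that arise are ±1 and squares are
preserved. -/
lemma IsQuadraticFrame.quadratic_eq_of_mem_normalizer (h2 : (2 : F) ≠ 0)
    (h : IsQuadraticFrame R Q w) {T : V ≃ₗ[F] V}
    (hT : T ∈ Subgroup.normalizer (R : Set (V ≃ₗ[F] V))) {φ : E → E} (hφ : Induces w T φ) (a : E) :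
    Q (φ a) = Q a := by
  obtain ⟨k, hk⟩ := hφ a
  have e : toEnd (T * w a * T⁻¹) = k • toEnd (w (φ a)) := by
    rw [toEnd_mul, toEnd_mul, hk, smul_mul_assoc, mul_assoc, toEnd_mul_inv, mul_one]
  have hkk := (h.mem_iff e).mp ((Subgroup.mem_normalizer_iff.mp hT (w a)).mp (h.mem a))
  have h1 := h.sgn_eq_of_intertwines h hk
  rw [hkk, one_mul] at h1
  exact (sgn_injective h2 h1).symm

lemma IsQuadraticFrame.mem_normalizer (h : IsQuadraticFrame R Q w) {T : V ≃ₗ[F] V}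
    {g : E ≃ₗ[ZMod 2] E} (hg : g ∈ quadraticIsometries Q) (hT : Induces w T g) :
    T ∈ Subgroup.normalizer (R : Set (V ≃ₗ[F] V)) :=
  Subgroup.mem_normalizer_iff.mpr (h.mem_iff_conj_mem h g.surjective hg hT)

lemma IsQuadraticFrame.exists_intertwiner [FiniteDimensional F V] (h : IsQuadraticFrame R Q w)
    (h' : IsQuadraticFrame R' Q' w') (φ : E ≃ₗ[ZMod 2] E') (hφ : ∀ a, Q' (φ a) = Q a) :
    ∃ T : V ≃ₗ[F] V, ∀ a, ∃ c : F, toEnd T * toEnd (w a) = c • (toEnd (w' (φ a)) * toEnd T) := by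
  refine Stingray.exists_intertwiner h.toIsFrame h'.toIsFrame φ (polarBilin_symm Q) ?_ ?_
  · intro a b
    rw [polarBilin_eq, polarBilin_eq, QuadraticMap.polar, QuadraticMap.polar, ← map_add,
      hφ, hφ, hφ]
  · intro a
    refine ⟨sgn F (Q a), sgn F (Q' (φ a)), sgn F (Q a), by rw [hφ], h.sq a, h'.sq _⟩

lemma IsFrame.span_group {B : E →ₗ[ZMod 2] E →ₗ[ZMod 2] ZMod 2} (h : IsFrame R B w) :
    Submodule.span F (toEnd '' (R : Set (V ≃ₗ[F] V))) = ⊤ := by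
  rw [eq_top_iff, ← h.span]
  apply Submodule.span_mono
  apply Set.image_mono
  rintro _ ⟨a, rfl⟩
  exact h.mem a

lemma Induces.smul {T T' : V ≃ₗ[F] V} {φ : E → E} (h : Induces w T φ) {c : F}
    (hT' : toEnd T' = c • toEnd T) : Induces w T' φ := by
  intro a
  obtain ⟨k, hk⟩ := h a
  exact ⟨k, by rw [hT', smul_mul_assoc, mul_smul_comm, hk, smul_comm]⟩

/-- The element `1 + w a` induces the transvection with centre `a`. -/
lemma IsQuadraticFrame.induces_transvection (h : IsQuadraticFrame R Q w) {T : V ≃ₗ[F] V} {a : E}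
    (ha : Q a = 1) (hT : toEnd T = 1 + toEnd (w a)) : Induces w T (transvection Q a) := by
  intro b
  rw [transvection_apply]
  have hc := h.comm a b
  -- If `w a` and `w b` commute, so do 1 + w a and `w b`. If they anticommute, (w a)² = -1 gives (1
  -- + w a) w b = w a w b (1 + w a).
  rcases zmod_two_cases (Q.polarBilin a b) with h0 | h0
  · refine ⟨1, ?_⟩
    rw [h0, sgn_zero, one_smul] at hc
    rw [h0, zero_smul, add_zero, one_smul, hT, add_mul, mul_add, hc, one_mul, mul_one]
  · rw [h0, sgn_one, neg_smul, one_smul] at hc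
    obtain ⟨k, hk⟩ := h.mul a b
    have hk0 : k ≠ 0 := ne_zero_of_toEnd_eq (x := w a * w b) hk
    refine ⟨k, ?_⟩
    have hs := h.sq a
    rw [ha, sgn_one, neg_smul, one_smul] at hs
    rw [h0, one_smul, add_comm b a, ← smul_mul_assoc, ← hk, hT, mul_add, mul_one, add_mul, one_mul]
    have : toEnd (w a) * toEnd (w b) * toEnd (w a) = toEnd (w b) := by
      rw [mul_assoc, ← neg_eq_iff_eq_neg.mpr hc, mul_neg, ← mul_assoc, hs]; simp
    rw [this, add_comm]

end Intertwiners

/-! ### Normalisers in isometry groups -/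

section Normalizers

variable {F V : Type*} [Field F] [AddCommGroup V] [Module F V] [Nontrivial V]
  [FiniteDimensional F V]
  {E E' : Type*} [AddCommGroup E] [Module (ZMod 2) E] [AddCommGroup E'] [Module (ZMod 2) E']
  [FiniteDimensional (ZMod 2) E] [FiniteDimensional (ZMod 2) E']
  {R R' : Subgroup (V ≃ₗ[F] V)} {Q : QuadraticForm (ZMod 2) E} {Q' : QuadraticForm (ZMod 2) E'}
  {w : E → V ≃ₗ[F] V} {w' : E' → V ≃ₗ[F] V} {B : V →ₗ[F] V →ₗ[F] F}

/-- Dividing by a square root of the multiplier makes the similarity an isometry. -/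
lemma IsSimilarity.exists_isometry_smul {T : V ≃ₗ[F] V} {c : F}
    (h : IsSimilarity B T c) (hnd : ∀ v, (∀ w, B v w = 0) → v = 0) (hc : IsSquare c) :
    ∃ (T' : V ≃ₗ[F] V) (m : F), T' ∈ formIsometries (fun v w => B v w) ∧
      toEnd T' = m • toEnd T := by
  have hc0 := h.ne_zero hnd
  obtain ⟨m, rfl⟩ := hc
  have hm : m ≠ 0 := fun hm => hc0 (by rw [hm, zero_mul])
  refine ⟨scalarEquiv V m⁻¹ (inv_ne_zero hm) * T, m⁻¹, ?_, ?_⟩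
  · rw [mem_formIsometries_iff_isSimilarity]
    have := (isSimilarity_of_toEnd_eq (B := B) (toEnd_scalarEquiv (V := V) m⁻¹
      (inv_ne_zero hm))).mul h
    have e : m⁻¹ * m⁻¹ * (m * m) = 1 := by field_simp
    rwa [e] at this
  · rw [toEnd_mul, toEnd_scalarEquiv, smul_mul_assoc, one_mul]

/-- An intertwiner of the frame with itself normalises `R`, and the `R`-invariant form is unique up
to scalars. -/
lemma IsQuadraticFrame.exists_similarity (h : IsQuadraticFrame R Q w)
    (hnd : ∀ v, (∀ w, B v w = 0) → v = 0) (hRG : R ≤ formIsometries (fun v w => B v w))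
    {g : E ≃ₗ[ZMod 2] E} (hg : g ∈ quadraticIsometries Q) :
    ∃ (T : V ≃ₗ[F] V) (c : F), Induces w T g ∧ IsSimilarity B T c := by
  obtain ⟨T, hT⟩ := h.exists_intertwiner h g hg
  obtain ⟨c, hc⟩ := exists_isSimilarity h.toIsFrame.span_group hnd hRG hRG (T := T) (fun x hx =>
    (h.mem_iff_conj_mem h g.surjective hg hT x).mp hx)
  exact ⟨T, c, hT, hc⟩

/-- The element 1 + w a induces this transvection with multiplier 2. An isometry inducing it would
differ from 1 + w a by some c · w b, of multiplier c², so 2 would be a square. -/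
lemma IsQuadraticFrame.not_exists_transvection (h2 : (2 : F) ≠ 0) (h : IsQuadraticFrame R Q w)
    (hnd : ∀ v, (∀ w, B v w = 0) → v = 0) (hRG : R ≤ formIsometries (fun v w => B v w))
    (h2sq : ¬ IsSquare (2 : F)) {a : E} (ha : Q a = 1) {T : V ≃ₗ[F] V}
    (hT : T ∈ formIsometries (fun v w => B v w)) : ¬ Induces w T (transvection Q a) := by
  intro hTi
  obtain ⟨S, hS, hSs⟩ := exists_one_add (B := B) h2 (x := w a) (by rw [h.sq, ha, sgn_one])
  have hSi := h.induces_transvection ha hS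
  have hS2 := hSs (hRG (h.mem a))
  have hinv : ∀ b, transvection Q a (transvection Q a b) = b := fun b =>
    LinearEquiv.congr_fun (transvection_mul_self Q a) b
  have hid : Induces w (T⁻¹ * S) id := by
    have := (hTi.inv hinv).mul hSi
    rwa [show (transvection Q a : E → E) ∘ transvection Q a = id from funext hinv] at this
  obtain ⟨b, c, hc⟩ := h.exists_eq_smul_of_induces_id h2 (polarBilin_symm Q) hid
  have hwb := mem_formIsometries_iff_isSimilarity.mp (hRG (h.mem b))
  have hTT := (mem_formIsometries_iff_isSimilarity.mp (inv_mem hT)).mul hS2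
  have hc' : toEnd (T⁻¹ * S) = toEnd (scalarEquiv V c (ne_zero_of_toEnd_eq hc) * w b) := by
    rw [hc, toEnd_mul, toEnd_scalarEquiv, smul_mul_assoc, one_mul]
  rw [toEnd_injective hc'] at hTT
  have := hTT.unique hnd ((isSimilarity_of_toEnd_eq (toEnd_scalarEquiv c _)).mul hwb)
  exact h2sq ⟨c, by linear_combination this⟩

/-- The normaliser of the group of a quadratic frame in the isometry group of a bilinear form,
as an extension by the orthogonal group or by its derived subgroup. -/
theorem IsQuadraticFrame.exists_hom_normalizer (h2 : (2 : F) ≠ 0) (h : IsQuadraticFrame R Q w)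
    (hdim : 5 ≤ Module.finrank (ZMod 2) E)
    (hnd : ∀ v, (∀ w, B v w = 0) → v = 0) (hRG : R ≤ formIsometries (fun v w => B v w)) :
    ∃ Ψ : (formIsometries (fun v w => B v w) ⊓ Subgroup.normalizer (R : Set (V ≃ₗ[F] V)) :
        Subgroup (V ≃ₗ[F] V)) →* quadraticIsometries Q,
      Ψ.ker = R.subgroupOf _ ∧ (IsSquare (2 : F) → Ψ.range = ⊤) ∧
      (¬ IsSquare (2 : F) → Ψ.range = commutator (quadraticIsometries Q)) := by
  obtain ⟨Φ, hΦ⟩ := h.toIsFrame.exists_hom h2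
  set M := formIsometries (fun v w => B v w) ⊓ Subgroup.normalizer (R : Set (V ≃ₗ[F] V)) with hM
  let ι : M →* Subgroup.normalizer (R : Set (V ≃ₗ[F] V)) := Subgroup.inclusion inf_le_right
  have hι : ∀ T : M, ((ι T : V ≃ₗ[F] V)) = T := fun T => rfl
  let Ψ : M →* quadraticIsometries Q := (Φ.comp ι).codRestrict _ fun T =>
    h.quadratic_eq_of_mem_normalizer h2 (ι T).2 (hΦ (ι T))
  have hΨ : ∀ T : M, Induces w (T : V ≃ₗ[F] V) (Ψ T : E ≃ₗ[ZMod 2] E) := fun T => hΦ (ι T)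
  have hrange : ∀ g : quadraticIsometries Q, g ∈ Ψ.range ↔
      ∃ T ∈ formIsometries (fun v w => B v w), Induces w T (g : E ≃ₗ[ZMod 2] E) := by
    intro g
    constructor
    · rintro ⟨T, rfl⟩
      exact ⟨T, T.2.1, hΨ T⟩
    · rintro ⟨T, hT, hTi⟩
      refine ⟨⟨T, hT, h.mem_normalizer g.2 hTi⟩, ?_⟩
      apply Subtype.ext
      ext a
      exact Induces.unique h2 h.toIsFrame (hΨ _) hTi a
  -- Every isometry of `Q` is induced by a similarity, and a commutator of similarities has
  -- multiplier 1.
  have hcomm : commutator (quadraticIsometries Q) ≤ Ψ.range := by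
    rw [commutator_def, Subgroup.commutator_le]
    intro g₁ _ g₂ _
    rw [hrange]
    obtain ⟨T₁, c₁, hT₁, hc₁⟩ := h.exists_similarity hnd hRG g₁.2
    obtain ⟨T₂, c₂, hT₂, hc₂⟩ := h.exists_similarity hnd hRG g₂.2
    have i₁ := hT₁.inv (ψ := ((g₁⁻¹ : quadraticIsometries Q) : E ≃ₗ[ZMod 2] E))
      (fun a => (g₁ : E ≃ₗ[ZMod 2] E).apply_symm_apply a)
    have i₂ := hT₂.inv (ψ := ((g₂⁻¹ : quadraticIsometries Q) : E ≃ₗ[ZMod 2] E))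
      (fun a => (g₂ : E ≃ₗ[ZMod 2] E).apply_symm_apply a)
    have n₁ := hc₁.ne_zero hnd
    have n₂ := hc₂.ne_zero hnd
    refine ⟨T₁ * T₂ * T₁⁻¹ * T₂⁻¹, ?_, ((hT₁.mul hT₂).mul i₁).mul i₂⟩
    rw [mem_formIsometries_iff_isSimilarity]
    have := ((hc₁.mul hc₂).mul (hc₁.inv n₁)).mul (hc₂.inv n₂)
    have e : c₁ * c₂ * c₁⁻¹ * c₂⁻¹ = 1 := by field_simp
    rwa [e] at this
  obtain ⟨a, ha, -⟩ := exists_nonsingular_perp h.nondegenerate hdim 0 0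
  refine ⟨Ψ, ?_, fun hsq => ?_, fun hsq => ?_⟩
  · ext T
    rw [MonoidHom.mem_ker, Subgroup.mem_subgroupOf]
    constructor
    · intro hT
      -- `T` is then c · w b; being an isometry it has c² = 1, which is the condition for membership
      -- in `R`.
      have hid : Induces w (T : V ≃ₗ[F] V) id := by
        have := hΨ T
        rwa [hT] at this
      obtain ⟨b, c, hc⟩ := h.exists_eq_smul_of_induces_id h2 (polarBilin_symm Q) hid
      rw [h.mem_iff hc]
      have hwb := mem_formIsometries_iff_isSimilarity.mp (hRG (h.mem b))
      have hTT := mem_formIsometries_iff_isSimilarity.mp T.2.1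
      have hc' : toEnd (T : V ≃ₗ[F] V) =
          toEnd (scalarEquiv V c (ne_zero_of_toEnd_eq hc) * w b) := by
        rw [toEnd_mul, toEnd_scalarEquiv, hc, smul_mul_assoc, one_mul]
      rw [toEnd_injective hc'] at hTT
      have := hTT.unique hnd ((isSimilarity_of_toEnd_eq (toEnd_scalarEquiv c _)).mul hwb)
      linear_combination -this
    · intro hT
      have hid := h.toIsFrame.induces_id (h.exists_eq _ hT)
      apply Subtype.ext
      ext b
      exact Induces.unique h2 h.toIsFrame (hΨ T) hid b
  · rw [eq_top_iff]
    rintro g -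
    -- When 2 is a square, 1 + w a can be rescaled to an isometry.
    have hta : orthTransvection Q ha ∈ Ψ.range := by
      rw [hrange]
      obtain ⟨S, hS, hSs⟩ := exists_one_add (B := B) h2 (x := w a) (by rw [h.sq, ha, sgn_one])
      obtain ⟨S', m, hS', hm⟩ := (hSs (hRG (h.mem a))).exists_isometry_smul hnd hsq
      exact ⟨S', hS', (h.induces_transvection ha hS).smul hm⟩
    rcases mem_commutator_or_orthTransvection_mul h.nondegenerate hdim ha g with hg | hg
    · exact hcomm hg
    · exact (Subgroup.mul_mem_cancel_left _ hta).mp (hcomm hg)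
  · refine le_antisymm ?_ hcomm
    intro g hg
    rcases mem_commutator_or_orthTransvection_mul h.nondegenerate hdim ha g with hg' | hg'
    · exact hg'
    · exfalso
      have hta : orthTransvection Q ha ∈ Ψ.range :=
        (Subgroup.mul_mem_cancel_right _ hg).mp (hcomm hg')
      obtain ⟨T, hT, hTi⟩ := (hrange _).mp hta
      exact h.not_exists_transvection h2 hnd hRG hsq ha hT hTi

/-- The quadratic character is multiplicative and takes the value -1 at 2. -/
lemma isSquare_or_isSquare_two_mul [Finite F] (h2sq : ¬ IsSquare (2 : F)) (c : F) :
    IsSquare c ∨ IsSquare (2 * c) := by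
  classical
  have := Fintype.ofFinite F
  by_cases hc : IsSquare c
  · exact Or.inl hc
  · right
    have hc0 : c ≠ 0 := fun h => hc (h ▸ IsSquare.zero)
    have h20 : (2 : F) ≠ 0 := fun h => h2sq (h ▸ IsSquare.zero)
    have e1 := quadraticChar_neg_one_iff_not_isSquare.mpr hc
    have e2 := quadraticChar_neg_one_iff_not_isSquare.mpr h2sq
    rw [← quadraticChar_one_iff_isSquare (mul_ne_zero h20 hc0), map_mul, e1, e2]
    norm_num

/-- The groups of isometric quadratic frames are conjugate. -/
theorem IsQuadraticFrame.exists_conj [Finite F] (h2 : (2 : F) ≠ 0) (h : IsQuadraticFrame R Q w)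
    (h' : IsQuadraticFrame R' Q' w') (hdim : 5 ≤ Module.finrank (ZMod 2) E)
    (hnd : ∀ v, (∀ w, B v w = 0) → v = 0) (hRG : R ≤ formIsometries (fun v w => B v w))
    (hRG' : R' ≤ formIsometries (fun v w => B v w)) (φ : E ≃ₗ[ZMod 2] E')
    (hφ : ∀ a, Q' (φ a) = Q a) :
    (∃ T ∈ Subgroup.normalizer (formIsometries (fun v w => B v w) : Set (V ≃ₗ[F] V)),
      ∀ x, x ∈ R ↔ T * x * T⁻¹ ∈ R') ∧
    (¬ IsSquare (2 : F) → ∃ T ∈ formIsometries (fun v w => B v w),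
      ∀ x, x ∈ R ↔ T * x * T⁻¹ ∈ R') := by
  obtain ⟨T, hT⟩ := h.exists_intertwiner h' φ hφ
  have hTR := h.mem_iff_conj_mem h' φ.surjective hφ hT
  obtain ⟨c, hc⟩ := exists_isSimilarity h.toIsFrame.span_group hnd hRG hRG' (T := T)
    (fun x hx => (hTR x).mp hx)
  -- Conjugation ignores scalar factors, so similarities may be rescaled freely.
  have hscale : ∀ S S' : V ≃ₗ[F] V, ∀ m : F, toEnd S' = m • toEnd S → ∀ x,
      S' * x * S'⁻¹ = S * x * S⁻¹ := by
    intro S S' m hm x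
    have e : S' = scalarEquiv V m (ne_zero_of_toEnd_eq hm) * S := toEnd_injective (by
      rw [toEnd_mul, toEnd_scalarEquiv, hm, smul_mul_assoc, one_mul])
    have hcen : ∀ y, scalarEquiv V m (ne_zero_of_toEnd_eq hm) * y =
        y * scalarEquiv V m (ne_zero_of_toEnd_eq hm) := fun y => toEnd_injective (by
      rw [toEnd_mul, toEnd_mul, toEnd_scalarEquiv]; simp)
    have e' : ∀ z : V ≃ₗ[F] V, z * S * x * (z * S)⁻¹ = z * (S * x * S⁻¹) * z⁻¹ := fun z => by group
    rw [e, e', hcen, mul_inv_cancel_right]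
  refine ⟨⟨T, hc.mem_normalizer hnd, hTR⟩, fun h2sq => ?_⟩
  -- If the multiplier `c` is not a square, composing with 1 + w a, which normalises `R` and has
  -- multiplier 2, makes it one.
  rcases isSquare_or_isSquare_two_mul h2sq c with hsq | hsq
  · obtain ⟨T', m, hT', hm⟩ := hc.exists_isometry_smul hnd hsq
    exact ⟨T', hT', fun x => by rw [hscale T T' m hm]; exact hTR x⟩
  · obtain ⟨a, ha, -⟩ := exists_nonsingular_perp h.nondegenerate hdim 0 0
    obtain ⟨S, hS, hSs⟩ := exists_one_add (B := B) h2 (x := w a) (by rw [h.sq, ha, sgn_one])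
    have hSn := h.mem_normalizer (transvection_mem ha) (h.induces_transvection ha hS)
    have hTS := hc.mul (hSs (hRG (h.mem a)))
    obtain ⟨T', m, hT', hm⟩ := hTS.exists_isometry_smul hnd (by rwa [mul_comm])
    refine ⟨T', hT', fun x => ?_⟩
    rw [hscale _ T' m hm, Subgroup.mem_normalizer_iff.mp hSn x, hTR]
    have e : T * S * x * (T * S)⁻¹ = T * (S * x * S⁻¹) * T⁻¹ := by group
    rw [e]

end Normalizers

/-! ### The standard symplectic form over the field of two elements -/

section SymplecticForm

/-- The standard alternating form over the field of two elements. -/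
noncomputable def standardForm (n : ℕ) :
    (Fin n ⊕ Fin n → ZMod 2) →ₗ[ZMod 2] (Fin n ⊕ Fin n → ZMod 2) →ₗ[ZMod 2] ZMod 2 :=
  Matrix.toLinearMap₂' (ZMod 2) (Matrix.J (Fin n) (ZMod 2))

lemma standardForm_apply {n : ℕ} (v w : Fin n ⊕ Fin n → ZMod 2) :
    standardForm n v w = dotProduct v (Matrix.mulVec (Matrix.J (Fin n) (ZMod 2)) w) :=
  Matrix.toLinearMap₂'_apply' _ _ _

lemma standardForm_eq {n : ℕ} (v w : Fin n ⊕ Fin n → ZMod 2) :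
    standardForm n v w = ∑ i, (v (Sum.inl i) * w (Sum.inr i) + v (Sum.inr i) * w (Sum.inl i)) := by
  rw [standardForm_apply, Matrix.J, Matrix.fromBlocks_mulVec]
  simp [dotProduct, Fintype.sum_sum_type, Finset.sum_add_distrib, Matrix.neg_mulVec]

lemma standardForm_self {n : ℕ} (v : Fin n ⊕ Fin n → ZMod 2) : standardForm n v v = 0 := by
  rw [standardForm_eq]
  refine Finset.sum_eq_zero fun i _ => ?_
  rw [mul_comm (v (Sum.inr i)), CharTwo.add_self_eq_zero]

lemma standardForm_symm {n : ℕ} (v w : Fin n ⊕ Fin n → ZMod 2) :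
    standardForm n v w = standardForm n w v := by
  rw [standardForm_eq, standardForm_eq]
  exact Finset.sum_congr rfl fun i _ => by ring

lemma standardForm_nondegenerate {n : ℕ} (v : Fin n ⊕ Fin n → ZMod 2)
    (hv : ∀ w, standardForm n v w = 0) : v = 0 := by
  funext i
  rcases i with i | i
  · have := hv (Pi.single (Sum.inr i) 1)
    rw [standardForm_eq] at this
    simpa [Pi.single_apply] using this
  · have := hv (Pi.single (Sum.inl i) 1)
    rw [standardForm_eq] at this
    simpa [Pi.single_apply] using this

lemma mem_symplecticGroup_iff {n : ℕ} (A : Matrix (Fin n ⊕ Fin n) (Fin n ⊕ Fin n) (ZMod 2)) :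
    A ∈ Matrix.symplecticGroup (Fin n) (ZMod 2) ↔
      ∀ v w, standardForm n (A.mulVec v) (A.mulVec w) = standardForm n v w := by
  have key : ∀ v w, standardForm n (A.mulVec v) (A.mulVec w) =
      dotProduct v (Matrix.mulVec (A.transpose * Matrix.J (Fin n) (ZMod 2) * A) w) := by
    intro v w
    rw [standardForm_apply, Matrix.mulVec_mulVec, Matrix.mul_assoc,
      ← Matrix.mulVec_mulVec (M := A.transpose),
      Matrix.dotProduct_mulVec v, Matrix.vecMul_transpose]
  rw [SymplecticGroup.mem_iff']
  constructor
  · intro h v w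
    rw [key, h, standardForm_apply]
  · intro h
    have h1 : Matrix.toLinearMap₂' (ZMod 2) (A.transpose * Matrix.J (Fin n) (ZMod 2) * A) =
        standardForm n := by
      refine LinearMap.ext fun v => LinearMap.ext fun w => ?_
      rw [Matrix.toLinearMap₂'_apply', ← key, h]
    rwa [standardForm, EmbeddingLike.apply_eq_iff_eq] at h1

end SymplecticForm

/-! ### Groups of symplectic type with all scalars -/

section Saturated

variable {F V : Type*} [Field F] [AddCommGroup V] [Module F V] [Nontrivial V]
  {E : Type*} [AddCommGroup E] [Module (ZMod 2) E]
  {R R' : Subgroup (V ≃ₗ[F] V)} {B B' : E →ₗ[ZMod 2] E →ₗ[ZMod 2] ZMod 2}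
  {w w' : E → V ≃ₗ[F] V}

/-- A frame of a group that contains all scalars, with squares `1` and `-1`. -/
structure IsSaturatedFrame (R : Subgroup (V ≃ₗ[F] V)) (B : E →ₗ[ZMod 2] E →ₗ[ZMod 2] ZMod 2)
    (w : E → V ≃ₗ[F] V) : Prop extends IsFrame R B w where
  sq : ∀ a, ∃ c : F, c * c = 1 ∧ toEnd (w a) * toEnd (w a) = c • 1
  mem_of_smul : ∀ (x : V ≃ₗ[F] V) (a : E) (c : F), toEnd x = c • toEnd (w a) → x ∈ R

/-- No quadratic condition on `φ` is needed: the groups absorb whatever scalars the intertwining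
relation produces. -/
lemma IsSaturatedFrame.mem_iff_conj_mem (h : IsSaturatedFrame R B w)
    (h' : IsSaturatedFrame R' B' w') {T : V ≃ₗ[F] V} {φ : E → E} (hφ : Function.Surjective φ)
    (hT : ∀ a, ∃ c : F, toEnd T * toEnd (w a) = c • (toEnd (w' (φ a)) * toEnd T))
    (x : V ≃ₗ[F] V) : x ∈ R ↔ T * x * T⁻¹ ∈ R' := by
  constructor
  · intro hx
    obtain ⟨a, k, hk⟩ := h.exists_eq x hx
    obtain ⟨c, hc⟩ := hT a
    refine h'.mem_of_smul _ (φ a) (k * c) ?_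
    rw [toEnd_mul, toEnd_mul, hk, mul_smul_comm, hc, smul_smul, smul_mul_assoc, mul_assoc,
      toEnd_mul_inv, mul_one]
  · intro hx
    obtain ⟨b, k, hk⟩ := h'.exists_eq _ hx
    obtain ⟨a, rfl⟩ := hφ b
    obtain ⟨c, hc⟩ := hT a
    have hc0 : c ≠ 0 := ne_zero_of_toEnd_eq (x := T * w a) hc
    refine h.mem_of_smul _ a (k * c⁻¹) ?_
    have e1 : toEnd (T * x) = k • (toEnd (w' (φ a)) * toEnd T) := by
      rw [← smul_mul_assoc, ← hk, ← toEnd_mul]; congr 1; group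
    have e2 : toEnd (T * x) = (k * c⁻¹) • (toEnd T * toEnd (w a)) := by
      rw [hc, smul_smul, mul_assoc, inv_mul_cancel₀ hc0, mul_one, e1]
    have e3 := congrArg (toEnd T⁻¹ * ·) e2
    simp only [toEnd_mul, mul_smul_comm] at e3
    rwa [← mul_assoc, ← mul_assoc, toEnd_inv_mul, one_mul, one_mul] at e3

/-- Squares of frame elements are ±1, so the product of two such scalars is a square once -1 is;
only the alternating form has to be preserved. -/
lemma IsSaturatedFrame.exists_intertwiner [FiniteDimensional F V] (h : IsSaturatedFrame R B w)
    (h' : IsSaturatedFrame R' B' w') (hneg : IsSquare (-1 : F)) (φ : E → E)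
    (hsymm : ∀ a b, B a b = B b a) (hφ : ∀ a b, B' (φ a) (φ b) = B a b) :
    ∃ T : V ≃ₗ[F] V, ∀ a, ∃ c : F, toEnd T * toEnd (w a) = c • (toEnd (w' (φ a)) * toEnd T) := by
  refine Stingray.exists_intertwiner h.toIsFrame h'.toIsFrame φ hsymm hφ fun a => ?_
  obtain ⟨c, hc, hc'⟩ := h.sq a
  obtain ⟨d, hd, hd'⟩ := h'.sq (φ a)
  have hcd : (c * d) * (c * d) = 1 := by linear_combination d * d * hc + hd
  have hsq : IsSquare (c * d) := by
    rcases mul_self_eq_one_iff.mp hcd with h1 | h1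
    · rw [h1]; exact IsSquare.one
    · rwa [h1]
  obtain ⟨m, hm⟩ := hsq
  exact ⟨c, d, m, hm, hc', hd'⟩

/-- The normaliser of the group of a saturated frame as an extension by the symplectic group. -/
theorem IsSaturatedFrame.exists_hom_normalizer [FiniteDimensional F V] {n : ℕ}
    {w : (Fin n ⊕ Fin n → ZMod 2) → V ≃ₗ[F] V} (h2 : (2 : F) ≠ 0) (hneg : IsSquare (-1 : F))
    (h : IsSaturatedFrame R (standardForm n) w) {M : Subgroup (V ≃ₗ[F] V)}
    (hM : M = Subgroup.normalizer (R : Set (V ≃ₗ[F] V))) :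
    ∃ Ψ : M →* Matrix.symplecticGroup (Fin n) (ZMod 2),
      Function.Surjective Ψ ∧ Ψ.ker = R.subgroupOf M := by
  subst hM
  obtain ⟨Φ, hΦ⟩ := h.toIsFrame.exists_hom h2
  let μ : ((Fin n ⊕ Fin n → ZMod 2) ≃ₗ[ZMod 2] (Fin n ⊕ Fin n → ZMod 2)) →*
      Matrix (Fin n ⊕ Fin n) (Fin n ⊕ Fin n) (ZMod 2) :=
    (LinearMap.toMatrixAlgEquiv' (R := ZMod 2) (n := Fin n ⊕ Fin n) : _ →* _).comp
      LinearEquiv.automorphismGroup.toLinearMapMonoidHom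
  have hμ : ∀ g v, (μ g).mulVec v = g v := fun g v => by
    change (LinearMap.toMatrix' g.toLinearMap).mulVec v = _
    rw [LinearMap.toMatrix'_mulVec]; rfl
  let Ψ : Subgroup.normalizer (R : Set (V ≃ₗ[F] V)) →* Matrix.symplecticGroup (Fin n) (ZMod 2) :=
    (μ.comp Φ).codRestrict _ fun T => by
      rw [mem_symplecticGroup_iff]
      intro v w
      rw [MonoidHom.comp_apply, hμ, hμ]
      exact (hΦ T).form_eq h2 h.toIsFrame v w
  have hΨ : ∀ T v, ((Ψ T : Matrix.symplecticGroup (Fin n) (ZMod 2)) :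
      Matrix (Fin n ⊕ Fin n) (Fin n ⊕ Fin n) (ZMod 2)).mulVec v = Φ T v := fun T v => hμ _ v
  refine ⟨Ψ, fun A => ?_, ?_⟩
  · obtain ⟨T, hT⟩ := h.exists_intertwiner h hneg
      (fun v => (A : Matrix (Fin n ⊕ Fin n) (Fin n ⊕ Fin n) (ZMod 2)).mulVec v)
      standardForm_symm ((mem_symplecticGroup_iff _).mp A.2)
    have hsurj : Function.Surjective
        (fun v => (A : Matrix (Fin n ⊕ Fin n) (Fin n ⊕ Fin n) (ZMod 2)).mulVec v) := by
      intro v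
      refine ⟨((A⁻¹ : Matrix.symplecticGroup (Fin n) (ZMod 2)) :
        Matrix (Fin n ⊕ Fin n) (Fin n ⊕ Fin n) (ZMod 2)).mulVec v, ?_⟩
      dsimp only
      rw [Matrix.mulVec_mulVec]
      have := congrArg Subtype.val (mul_inv_cancel A)
      rw [Submonoid.coe_mul] at this
      rw [this, Submonoid.coe_one, Matrix.one_mulVec]
    have hTn := Subgroup.mem_normalizer_iff.mpr (h.mem_iff_conj_mem h hsurj hT)
    refine ⟨⟨T, hTn⟩, ?_⟩
    apply Subtype.ext
    apply Matrix.toLin'.injective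
    refine LinearMap.ext fun v => ?_
    rw [Matrix.toLin'_apply, Matrix.toLin'_apply, hΨ]
    exact Induces.unique h2 h.toIsFrame (hΦ ⟨T, hTn⟩) hT v
  · ext T
    rw [MonoidHom.mem_ker, Subgroup.mem_subgroupOf]
    constructor
    · intro hT
      have hid : Induces w (T : V ≃ₗ[F] V) id := by
        have e : (Φ T : (Fin n ⊕ Fin n → ZMod 2) → (Fin n ⊕ Fin n → ZMod 2)) = id := by
          funext v
          rw [← hΨ, hT, Submonoid.coe_one, Matrix.one_mulVec, id]
        have := hΦ T
        rwa [e] at this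
      obtain ⟨b, c, hc⟩ := h.exists_eq_smul_of_induces_id h2 standardForm_symm hid
      exact h.mem_of_smul _ b c hc
    · intro hT
      have hid := h.toIsFrame.induces_id (h.exists_eq _ hT)
      apply Subtype.ext
      apply Matrix.toLin'.injective
      refine LinearMap.ext fun v => ?_
      rw [Matrix.toLin'_apply, Matrix.toLin'_apply, hΨ, Submonoid.coe_one, Matrix.one_mulVec]
      exact Induces.unique h2 h.toIsFrame (hΦ T) hid v

/-- Commutators are central of order at most 2, so [y, x²] = [y, x]² = 1. -/
lemma sq_mem_center_of_commutator {R : Type*} [Group R] (hc : Nat.card (commutator R) = 2)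
    (x : R) : x ^ 2 ∈ Subgroup.center R := by
  have hle := le_center_of_card_two (commutator R) hc
  rw [Subgroup.mem_center_iff]
  intro y
  set z := ⁅y, x⁆ with hz
  have hzm : z ∈ commutator R := mem_commutator R y x
  have hzc := Subgroup.mem_center_iff.mp (hle hzm)
  have hz2 : z * z = 1 := by
    have : (⟨z, hzm⟩ : commutator R) ^ 2 = 1 := by rw [← hc]; exact pow_card_eq_one'
    rw [← pow_two]
    exact congrArg Subtype.val this
  have hyx : y * x = z * (x * y) := by rw [hz, commutatorElement_def]; group
  calc y * x ^ 2 = y * x * x := by rw [pow_two, mul_assoc]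
    _ = z * x * (y * x) := by rw [hyx, mul_assoc z, mul_assoc x, mul_assoc z, hyx]
    _ = z * z * (x * x * y) := by
        rw [hyx, mul_assoc z x, ← mul_assoc x z, hzc x]; simp only [mul_assoc]
    _ = x ^ 2 * y := by rw [hz2, one_mul, pow_two]

/-- The product of a group of symplectic type with the scalars has a saturated frame. -/
lemma IsFourCircExtraspecial.exists_isSaturatedFrame [FiniteDimensional F V] [Finite F] {n : ℕ}
    (hdvd : 2 ∣ Nat.card F - 1) (hV : Module.finrank F V = 2 ^ n)
    (hR : IsFourCircExtraspecial n R) :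
    ∃ w : (Fin n ⊕ Fin n → ZMod 2) → V ≃ₗ[F] V,
      IsSaturatedFrame (R ⊔ Subgroup.center (V ≃ₗ[F] V)) (standardForm n) w := by
  have h := IsHeisenberg.of_isFourCircExtraspecial hdvd hV hR
  obtain ⟨-, -, -, hc2, hexp⟩ := hR
  obtain ⟨B, w₀, hw₀, hB, -⟩ := h.exists_isFrame (sq_mem_center_of_commutator hc2)
    (Fin n ⊕ Fin n → ZMod 2) (by simp [two_mul])
  -- A change of coordinates makes the commutator form standard.
  obtain ⟨S, hS⟩ := exists_isometry_of_alternating (standardForm n) standardForm_self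
    standardForm_nondegenerate B hB hw₀.nondeg rfl
  have hw := hw₀.comp S (standardForm n) hS
  have hcenter : ∀ z ∈ Subgroup.center (V ≃ₗ[F] V), ∃ c : F, toEnd z = c • 1 := fun z hz =>
    exists_scalar_of_commute h.span_eq_top _ fun y _ =>
      congrArg toEnd (Subgroup.mem_center_iff.mp hz y).symm
  refine ⟨w₀ ∘ S, ⟨⟨fun a => Subgroup.mem_sup_left (hw.mem a), fun x hx => ?_, hw.mul, hw.comm,
    hw.span, hw.nondeg⟩, fun a => ?_, fun x a c hx => ?_⟩⟩
  · obtain ⟨y, hy, z, hz, rfl⟩ := Subgroup.mem_sup_of_normal_right.mp hx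
    obtain ⟨a, c, hc⟩ := hw.exists_eq y hy
    obtain ⟨k, hk⟩ := hcenter z hz
    exact ⟨a, c * k, by rw [toEnd_mul, hc, hk, smul_mul_smul_comm, mul_one]⟩
  · set x : R := ⟨(w₀ ∘ S) a, hw.mem a⟩ with hx
    obtain ⟨c, hc⟩ := h.exists_scalar_of_mem_center (sq_mem_center_of_commutator hc2 x)
    have hc' : toEnd ((w₀ ∘ S) a) * toEnd ((w₀ ∘ S) a) = c • 1 := by
      rw [← hc, pow_two]; rfl
    refine ⟨c, ?_, hc'⟩
    have h4 : x ^ 2 * x ^ 2 = 1 := by 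
      rw [← pow_add, show 2 + 2 = Monoid.exponent R from hexp.symm]
      exact Monoid.pow_exponent_eq_one x
    apply smul_one_injective (V := V)
    have : toEnd ((x ^ 2 * x ^ 2 : R) : V ≃ₗ[F] V) = (c * c) • 1 := by
      rw [Subgroup.coe_mul, toEnd_mul, hc, smul_mul_smul_comm, mul_one]
    rw [← this, h4, one_smul]; rfl
  · have e := toEnd_mul_inv_of_smul hx
    have hxe : x = (w₀ ∘ S) a * (((w₀ ∘ S) a)⁻¹ * x) := by group
    have e' : toEnd (((w₀ ∘ S) a)⁻¹ * x) = c • 1 := by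
      rw [toEnd_mul, hx, mul_smul_comm, toEnd_inv_mul]
    rw [hxe]
    refine Subgroup.mul_mem_sup (hw.mem a) (Subgroup.mem_center_iff.mpr fun y => ?_)
    apply toEnd_injective
    rw [toEnd_mul, toEnd_mul (_ * x), e']
    simp

end Saturated

/-! ### Weyl systems and the groups they generate -/

section WeylSystems

variable {F V : Type*} [Field F] [AddCommGroup V] [Module F V]
  {E : Type*} [AddCommGroup E] [Module (ZMod 2) E]
  {β : E →ₗ[ZMod 2] E →ₗ[ZMod 2] ZMod 2} {w : E → V ≃ₗ[F] V}

/-- A projective representation of the elementary abelian `2`-group `E` with cocycle given by the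
bilinear form `β`, whose commutator form is nondegenerate. -/
structure IsWeyl (β : E →ₗ[ZMod 2] E →ₗ[ZMod 2] ZMod 2) (w : E → V ≃ₗ[F] V) : Prop where
  mul : ∀ a b, toEnd (w a) * toEnd (w b) = sgn F (β a b) • toEnd (w (a + b))
  nondeg : ∀ a, (∀ b, β a b + β b a = 0) → a = 0

lemma IsWeyl.comm (h : IsWeyl β w) (a b : E) :
    toEnd (w a) * toEnd (w b) = sgn F (β a b + β b a) • (toEnd (w b) * toEnd (w a)) := by
  rw [h.mul a b, h.mul b a, add_comm b a, smul_smul, sgn_add, mul_assoc, sgn_mul_self, mul_one]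

lemma IsWeyl.map_zero (h : IsWeyl β w) : w 0 = 1 := by
  have h1 := h.mul 0 0
  rw [LinearMap.map_zero, sgn_zero, one_smul, add_zero, ← toEnd_mul] at h1
  exact mul_eq_left.mp (toEnd_injective h1)

lemma IsWeyl.sq (h : IsWeyl β w) (a : E) :
    toEnd (w a) * toEnd (w a) = sgn F (β a a) • 1 := by
  rw [h.mul, ZModModule.add_self, h.map_zero]; rfl

lemma IsWeyl.eq_zero_of_commute [Nontrivial V] (h2 : (2 : F) ≠ 0) (h : IsWeyl β w) {a : E}
    (ha : ∀ b, toEnd (w a) * toEnd (w b) = toEnd (w b) * toEnd (w a)) : a = 0 := by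
  refine h.nondeg a fun b => ?_
  rw [← sgn_eq_one h2]
  have h1 := h.comm a b
  rw [ha, ← sub_eq_zero] at h1
  nth_rewrite 1 [← one_smul F (toEnd (w b) * toEnd (w a))] at h1
  rw [← sub_smul, ← toEnd_mul] at h1
  exact (sub_eq_zero.mp ((smul_eq_zero.mp h1).resolve_right (toEnd_ne_zero _))).symm

/-- Proportionality makes `w (a + b)` a scalar, which commutes with everything; over F₂ the
resulting `a + b = 0` means `a = b`. -/
lemma IsWeyl.eq_of_smul [Nontrivial V] (h2 : (2 : F) ≠ 0) (h : IsWeyl β w) {a b : E} {c : F}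
    (hab : toEnd (w a) = c • toEnd (w b)) : a = b := by
  have h0 : a + b = 0 := by
    refine h.eq_zero_of_commute h2 fun x => ?_
    have e : toEnd (w (a + b)) = (sgn F (β a b) * (c * sgn F (β b b))) • 1 := by
      have := h.mul a b
      rw [hab, smul_mul_assoc, h.sq, smul_smul] at this
      rw [mul_smul, this, smul_smul, sgn_mul_self, one_smul]
    rw [e]; simp
  rw [← ZModModule.neg_eq_self b]
  exact eq_neg_of_add_eq_zero_left h0

lemma exists_unit_sgn {C : Subgroup Fˣ} (hC : -1 ∈ C) (z : ZMod 2) : ∃ u ∈ C, (u : F) = sgn F z := by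
  rcases zmod_two_cases z with rfl | rfl
  · exact ⟨1, one_mem C, by simp [sgn_zero]⟩
  · exact ⟨-1, hC, by simp [sgn_one]⟩

/-- The multiples of the `w a` for `a ∈ W` by scalars in `C`. -/
def weylGroup (h : IsWeyl β w) (C : Subgroup Fˣ) (hC : -1 ∈ C) (W : Submodule (ZMod 2) E) :
    Subgroup (V ≃ₗ[F] V) where
  carrier := {x | ∃ a ∈ W, ∃ c ∈ C, toEnd x = (c : F) • toEnd (w a)}
  one_mem' := ⟨0, W.zero_mem, 1, one_mem C, by rw [h.map_zero, Units.val_one, one_smul]⟩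
  mul_mem' := by
    rintro x y ⟨a, ha, c, hc, hx⟩ ⟨b, hb, d, hd, hy⟩
    obtain ⟨u, hu, hu'⟩ := exists_unit_sgn hC (β a b)
    refine ⟨a + b, W.add_mem ha hb, c * d * u, mul_mem (mul_mem hc hd) hu, ?_⟩
    rw [toEnd_mul, hx, hy, smul_mul_smul_comm, h.mul, smul_smul, ← hu']
    simp
  inv_mem' := by
    rintro x ⟨a, ha, c, hc, hx⟩
    obtain ⟨u, hu, hu'⟩ := exists_unit_sgn hC (β a a)
    refine ⟨a, ha, c⁻¹ * u, mul_mem (inv_mem hc) hu, ?_⟩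
    have e : toEnd x * (((c⁻¹ * u : Fˣ) : F) • toEnd (w a)) = 1 := by
      rw [hx, smul_mul_smul_comm, h.sq, smul_smul, Units.val_mul, hu', ← mul_assoc,
        mul_assoc, sgn_mul_self, mul_one, ← Units.val_mul, mul_inv_cancel, Units.val_one, one_smul]
    calc toEnd x⁻¹ = toEnd x⁻¹ * (toEnd x * (((c⁻¹ * u : Fˣ) : F) • toEnd (w a))) := by
          rw [e, mul_one]
      _ = _ := by rw [← mul_assoc, toEnd_inv_mul, one_mul]

variable {C : Subgroup Fˣ} {hC : -1 ∈ C} {W : Submodule (ZMod 2) E}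

lemma mem_weylGroup {h : IsWeyl β w} {x : V ≃ₗ[F] V} :
    x ∈ weylGroup h C hC W ↔ ∃ a ∈ W, ∃ c ∈ C, toEnd x = (c : F) • toEnd (w a) := Iff.rfl

lemma card_weylGroup [Nontrivial V] (h2 : (2 : F) ≠ 0) (h : IsWeyl β w) :
    Nat.card (weylGroup h C hC W) = Nat.card W * Nat.card C := by
  have hf : ∀ p : W × C, toEnd (scalarEquiv V ((p.2 : Fˣ) : F) (Units.ne_zero _) * w p.1) =
      ((p.2 : Fˣ) : F) • toEnd (w p.1) := fun p => by
    rw [toEnd_mul, toEnd_scalarEquiv, smul_mul_assoc, one_mul]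
  let f : W × C → weylGroup h C hC W := fun p =>
    ⟨scalarEquiv V ((p.2 : Fˣ) : F) (Units.ne_zero _) * w p.1, p.1, p.1.2, p.2, p.2.2, hf p⟩
  rw [← Nat.card_prod]
  refine (Nat.card_congr (Equiv.ofBijective f ⟨?_, ?_⟩)).symm
  · rintro ⟨a, c⟩ ⟨b, d⟩ hab
    have h1 : toEnd (f (a, c) : V ≃ₗ[F] V) = toEnd (f (b, d) : V ≃ₗ[F] V) := by rw [hab]
    change toEnd (scalarEquiv V ((c : Fˣ) : F) (Units.ne_zero _) * w a) =
      toEnd (scalarEquiv V ((d : Fˣ) : F) (Units.ne_zero _) * w b) at h1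
    rw [hf (a, c), hf (b, d)] at h1
    have h3 : toEnd (w a) = (((c⁻¹ * d : C) : Fˣ) : F) • toEnd (w b) := by
      have : (((c⁻¹ * d : C) : Fˣ) : F) = ((c : Fˣ) : F)⁻¹ * ((d : Fˣ) : F) := by simp
      rw [this, mul_smul, ← h1, smul_smul, inv_mul_cancel₀ (Units.ne_zero _), one_smul]
    have h4 : a = b := Subtype.ext (h.eq_of_smul h2 h3)
    subst h4
    have h5 : c = d := by
      rw [← sub_eq_zero, ← sub_smul] at h1
      exact Subtype.ext (Units.ext
        (sub_eq_zero.mp ((smul_eq_zero.mp h1).resolve_right (toEnd_ne_zero _))))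
    rw [h5]
  · rintro ⟨x, a, ha, c, hc, hx⟩
    refine ⟨(⟨a, ha⟩, ⟨c, hc⟩), Subtype.ext (toEnd_injective ?_)⟩
    rw [hx]
    exact hf (⟨a, ha⟩, ⟨c, hc⟩)

lemma IsWeyl.mem (h : IsWeyl β w) (a : E) : w a ∈ weylGroup h C hC ⊤ :=
  ⟨a, Submodule.mem_top, 1, one_mem C, by rw [Units.val_one, one_smul]⟩

/-- The scalars in the Weyl group. -/
noncomputable def weylScalars (h : IsWeyl β w) (C : Subgroup Fˣ) (hC : -1 ∈ C) :
    C →* weylGroup h C hC (⊤ : Submodule (ZMod 2) E) where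
  toFun c := ⟨scalarEquiv V ((c : Fˣ) : F) (Units.ne_zero _), 0, Submodule.mem_top, c, c.2, by
    rw [toEnd_scalarEquiv, h.map_zero]; rfl⟩
  map_one' := Subtype.ext (toEnd_injective (by
    change toEnd (scalarEquiv V _ _) = toEnd 1
    rw [toEnd_scalarEquiv, OneMemClass.coe_one, Units.val_one, one_smul]; rfl))
  map_mul' c d := Subtype.ext (toEnd_injective (by
    change toEnd (scalarEquiv V _ _) = toEnd (scalarEquiv V _ _ * scalarEquiv V _ _)
    rw [toEnd_mul, toEnd_scalarEquiv, toEnd_scalarEquiv, toEnd_scalarEquiv, smul_mul_smul_comm]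
    simp))

lemma toEnd_weylScalars (h : IsWeyl β w) (c : C) :
    toEnd (weylScalars h C hC c : V ≃ₗ[F] V) = ((c : Fˣ) : F) • 1 := toEnd_scalarEquiv _ _

lemma weylScalars_injective [Nontrivial V] (h : IsWeyl β w) :
    Function.Injective (weylScalars h C hC) := by
  intro c d hcd
  have h1 := toEnd_weylScalars (hC := hC) h c
  rw [hcd, toEnd_weylScalars] at h1
  exact Subtype.ext (Units.ext (smul_one_injective (V := V) h1).symm)

/-- An element commuting with every `w b` has index 0 by nondegeneracy, so it is a scalar. -/
lemma center_weylGroup [Nontrivial V] (h2 : (2 : F) ≠ 0) (h : IsWeyl β w) :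
    Subgroup.center (weylGroup h C hC ⊤) = (weylScalars h C hC).range := by
  ext x
  constructor
  · intro hx
    obtain ⟨x, a, ha, c, hc, hxc⟩ := x
    have ha : a = 0 := by
      refine h.eq_zero_of_commute h2 fun b => ?_
      have h1 := Subgroup.mem_center_iff.mp hx ⟨w b, h.mem b⟩
      have h3 : toEnd (w b) * toEnd x = toEnd x * toEnd (w b) :=
        congrArg (fun y : weylGroup h C hC ⊤ => toEnd (y : V ≃ₗ[F] V)) h1
      rw [hxc, mul_smul_comm, smul_mul_assoc, ← sub_eq_zero, ← smul_sub] at h3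
      exact (sub_eq_zero.mp ((smul_eq_zero.mp h3).resolve_left (Units.ne_zero c))).symm
    refine ⟨⟨c, hc⟩, Subtype.ext (toEnd_injective ?_)⟩
    rw [toEnd_weylScalars, hxc, ha, h.map_zero]; rfl
  · rintro ⟨c, rfl⟩
    rw [Subgroup.mem_center_iff]
    intro y
    apply Subtype.ext
    apply toEnd_injective
    rw [Subgroup.coe_mul, Subgroup.coe_mul, toEnd_mul, toEnd_mul, toEnd_weylScalars]
    simp

lemma card_center_weylGroup [Nontrivial V] (h2 : (2 : F) ≠ 0) (h : IsWeyl β w) :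
    Nat.card (Subgroup.center (weylGroup h C hC ⊤)) = Nat.card C := by
  rw [center_weylGroup h2 h]
  exact (Nat.card_congr (MonoidHom.ofInjective (weylScalars_injective h)).toEquiv).symm

lemma IsWeyl.exists_sgn_eq_neg_one [Nontrivial E] (h : IsWeyl β w) :
    ∃ a b, β a b + β b a = 1 := by
  obtain ⟨a, ha⟩ := exists_ne (0 : E)
  by_contra hcon
  push Not at hcon
  refine ha (h.nondeg a fun b => ?_)
  by_contra h0
  exact hcon a b (zmod_two_ne_zero.mp h0)

/-- Commutators of multiples of `w a` and `w b` are signs, and nondegeneracy makes -1 occur. -/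
lemma commutator_weylGroup [Nontrivial V] [Nontrivial E] (h : IsWeyl β w) :
    commutator (weylGroup h C hC ⊤) = Subgroup.zpowers (weylScalars h C hC ⟨-1, hC⟩) := by
  have key : ∀ x y : weylGroup h C hC ⊤, ∀ a b : E, ∀ c d : Fˣ,
      toEnd (x : V ≃ₗ[F] V) = (c : F) • toEnd (w a) →
      toEnd (y : V ≃ₗ[F] V) = (d : F) • toEnd (w b) →
      toEnd ((⁅x, y⁆ : weylGroup h C hC ⊤) : V ≃ₗ[F] V) = sgn F (β a b + β b a) • 1 := by
    intro x y a b c d hx hy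
    have e1 : toEnd (x * y : V ≃ₗ[F] V) = sgn F (β a b + β b a) • toEnd (y * x : V ≃ₗ[F] V) := by
      rw [toEnd_mul, toEnd_mul, hx, hy, smul_mul_smul_comm, smul_mul_smul_comm, h.comm a b,
        smul_comm, mul_comm (c : F)]
    have e2 : ((⁅x, y⁆ : weylGroup h C hC ⊤) : V ≃ₗ[F] V) =
        (x * y : V ≃ₗ[F] V) * (y * x : V ≃ₗ[F] V)⁻¹ := by
      rw [commutatorElement_def]
      simp [mul_assoc]
    rw [e2]
    exact toEnd_mul_inv_of_smul e1
  apply le_antisymm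
  · rw [commutator_def, Subgroup.commutator_le]
    rintro x - y -
    obtain ⟨a, -, c, -, hx⟩ := x.2
    obtain ⟨b, -, d, -, hy⟩ := y.2
    have e := key x y a b c d hx hy
    rcases zmod_two_cases (β a b + β b a) with h0 | h0
    · rw [h0, sgn_zero, one_smul] at e
      have : ⁅x, y⁆ = 1 := Subtype.ext (toEnd_injective e)
      rw [this]
      exact one_mem _
    · rw [h0, sgn_one] at e
      have : ⁅x, y⁆ = weylScalars h C hC ⟨-1, hC⟩ := Subtype.ext (toEnd_injective (by
        rw [e, toEnd_weylScalars]; simp))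
      rw [this]
      exact Subgroup.mem_zpowers _
  · rw [Subgroup.zpowers_le]
    obtain ⟨a, b, hab⟩ := h.exists_sgn_eq_neg_one
    let x : weylGroup h C hC ⊤ := ⟨w a, h.mem a⟩
    let y : weylGroup h C hC ⊤ := ⟨w b, h.mem b⟩
    have e := key x y a b 1 1 (by simp [x]) (by simp [y])
    rw [hab, sgn_one] at e
    have : weylScalars h C hC ⟨-1, hC⟩ = ⁅x, y⁆ :=
      Subtype.ext (toEnd_injective (by rw [e, toEnd_weylScalars]; simp))
    rw [this]
    exact mem_commutator _ _ _

lemma orderOf_neg_one_units (h2 : (2 : F) ≠ 0) : orderOf (-1 : Fˣ) = 2 := by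
  refine orderOf_eq_prime (by simp) fun h => h2 ?_
  have : (-1 : F) = 1 := by simpa using congrArg Units.val h
  linear_combination -this

lemma card_commutator_weylGroup [Nontrivial V] [Nontrivial E] (h2 : (2 : F) ≠ 0)
    (h : IsWeyl β w) : Nat.card (commutator (weylGroup h C hC ⊤)) = 2 := by
  rw [commutator_weylGroup, Nat.card_zpowers, orderOf_injective _ (weylScalars_injective h),
    Subgroup.orderOf_mk, orderOf_neg_one_units h2]

/-- Squares are the scalars c² · (±1), so fourth powers are trivial, and some `w a` has square -1.
-/
lemma exponent_weylGroup [Nontrivial V] [Nontrivial E] (h2 : (2 : F) ≠ 0)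
    (h : IsWeyl β w) (hC4 : ∀ c ∈ C, c ^ 4 = 1) : Monoid.exponent (weylGroup h C hC ⊤) = 4 := by
  have hsq : ∀ x : weylGroup h C hC ⊤, ∀ a : E, ∀ c : Fˣ,
      toEnd (x : V ≃ₗ[F] V) = (c : F) • toEnd (w a) →
      toEnd ((x ^ 2 : weylGroup h C hC ⊤) : V ≃ₗ[F] V) = ((c : F) * c * sgn F (β a a)) • 1 := by
    intro x a c hx
    rw [pow_two, Subgroup.coe_mul, toEnd_mul, hx, smul_mul_smul_comm, h.sq, smul_smul]
  have hdvd : Monoid.exponent (weylGroup h C hC ⊤) ∣ 4 := by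
    rw [Monoid.exponent_dvd_iff_forall_pow_eq_one]
    intro x
    obtain ⟨a, -, c, hc, hx⟩ := x.2
    apply Subtype.ext
    apply toEnd_injective
    rw [show 4 = 2 * 2 from rfl, pow_mul, pow_two, Subgroup.coe_mul, toEnd_mul, hsq x a c hx,
      smul_mul_smul_comm]
    have h4 : (c : F) ^ 4 = 1 := by
      rw [← Units.val_pow_eq_pow_val, hC4 c hc, Units.val_one]
    have e : (c : F) * c * sgn F (β a a) * (c * c * sgn F (β a a)) = 1 := by
      have := sgn_mul_self (F := F) (β a a)
      linear_combination (c : F) ^ 4 * this + h4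
    rw [e, one_smul, mul_one]; rfl
  -- If `β` vanished on the diagonal it would be alternating, and the commutator form would be zero.
  obtain ⟨a, ha⟩ : ∃ a, β a a = 1 := by
    by_contra hcon
    push Not at hcon
    have h0 : ∀ a, β a a = 0 := fun a => by
      by_contra h0
      exact hcon a (zmod_two_ne_zero.mp h0)
    obtain ⟨a, b, hab⟩ := h.exists_sgn_eq_neg_one
    have := h0 (a + b)
    simp only [map_add, LinearMap.add_apply, h0, zero_add, add_zero] at this
    rw [add_comm, this] at hab
    exact zero_ne_one hab
  have hndvd : ¬ Monoid.exponent (weylGroup h C hC ⊤) ∣ 2 := by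
    rw [Monoid.exponent_dvd_iff_forall_pow_eq_one]
    intro hcon
    have h1 := hsq ⟨w a, h.mem a⟩ a 1 (by simp)
    rw [hcon, ha, sgn_one] at h1
    have h3 : (1 : F) = ((1 : Fˣ) : F) * ((1 : Fˣ) : F) * -1 := smul_one_injective (V := V) (by
      rw [one_smul]
      exact h1)
    rw [Units.val_one] at h3
    exact h2 (by linear_combination h3)
  have hle := Nat.le_of_dvd (by norm_num) hdvd
  interval_cases hexp : Monoid.exponent (weylGroup h C hC ⊤)
  · simp at hdvd
  · exact absurd (by norm_num) hndvd
  · exact absurd (dvd_refl 2) hndvd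
  · norm_num at hdvd
  · rfl

/-- The Weyl group with scalars `1` and `-1` is extraspecial. -/
lemma IsWeyl.isExtraspecial [Nontrivial V] [Nontrivial E] (h2 : (2 : F) ≠ 0) (h : IsWeyl β w)
    {n : ℕ} (hE : Nat.card E = 2 ^ (2 * n)) :
    IsExtraspecial 2 n (weylGroup h (Subgroup.zpowers (-1)) (Subgroup.mem_zpowers _) ⊤) := by
  have hcard : Nat.card (Subgroup.zpowers (-1 : Fˣ)) = 2 := by
    rw [Nat.card_zpowers, orderOf_neg_one_units h2]
  have hcc : commutator (weylGroup h (Subgroup.zpowers (-1)) (Subgroup.mem_zpowers _) ⊤) =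
      Subgroup.center _ := by
    have hle := le_center_of_card_two _ (card_commutator_weylGroup h2 h
      (C := Subgroup.zpowers (-1)) (hC := Subgroup.mem_zpowers _))
    have hcen := card_center_weylGroup (C := Subgroup.zpowers (-1)) (hC := Subgroup.mem_zpowers _)
      h2 h
    have : Finite (Subgroup.center
        (weylGroup h (Subgroup.zpowers (-1)) (Subgroup.mem_zpowers _) ⊤)) :=
      Nat.finite_of_card_ne_zero (by rw [hcen, hcard]; norm_num)
    exact Subgroup.eq_of_le_of_card_ge hle (by
      rw [hcen, hcard, card_commutator_weylGroup h2 h])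
  refine ⟨?_, ?_, hcc, sq_mem_center_of_commutator (card_commutator_weylGroup h2 h), ?_⟩
  · rw [card_weylGroup h2, hcard, Nat.card_congr (Submodule.topEquiv (R := ZMod 2) (M := E)).toEquiv,
      hE, pow_add, pow_one, mul_comm]
  · rw [card_center_weylGroup h2, hcard]
  · rw [exponent_weylGroup h2 h]
    · rfl
    · rintro _ ⟨k, rfl⟩
      change ((-1 : Fˣ) ^ k) ^ 4 = 1
      rw [← zpow_natCast, ← zpow_mul, mul_comm, zpow_mul]
      norm_num

/-- The Weyl group with four scalars is of symplectic type. -/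
lemma IsWeyl.isFourCircExtraspecial [Nontrivial V] [Nontrivial E] (h2 : (2 : F) ≠ 0)
    (h : IsWeyl β w) {n : ℕ} (hE : Nat.card E = 2 ^ (2 * n)) {ζ : Fˣ} (hζ : ζ ^ 2 = -1)
    (hm : -1 ∈ Subgroup.zpowers ζ) :
    IsFourCircExtraspecial n (weylGroup h (Subgroup.zpowers ζ) hm ⊤) := by
  have hne : (-1 : Fˣ) ≠ 1 := fun h1 => by
    have h3 := orderOf_neg_one_units h2
    rw [h1, orderOf_one] at h3
    norm_num at h3
  have hord : orderOf ζ = 4 := by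
    have : Fact (Nat.Prime 2) := ⟨Nat.prime_two⟩
    refine orderOf_eq_prime_pow (p := 2) (n := 1) ?_ ?_
    · rw [pow_one, hζ]; exact hne
    · rw [pow_succ, pow_one, pow_mul, hζ]; simp
  have hcard : Nat.card (Subgroup.zpowers ζ) = 4 := by rw [Nat.card_zpowers, hord]
  refine ⟨?_, ?_, ?_, card_commutator_weylGroup h2 h, ?_⟩
  · rw [card_weylGroup h2, hcard, Nat.card_congr (Submodule.topEquiv (R := ZMod 2) (M := E)).toEquiv,
      hE, pow_add, mul_comm]
    norm_num
  · rw [center_weylGroup h2 h]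
    exact isCyclic_of_surjective _ (MonoidHom.rangeRestrict_surjective (weylScalars h _ _))
  · rw [card_center_weylGroup h2, hcard]
  · rw [exponent_weylGroup h2 h]
    intro c hc
    have := orderOf_dvd_of_mem_zpowers hc
    rw [hord] at this
    exact orderOf_dvd_iff_pow_eq_one.mp this

/-- A subspace on which the squares vanish gives an elementary abelian subgroup. -/
lemma IsWeyl.exists_elementaryAbelian [Nontrivial V] (h2 : (2 : F) ≠ 0) (h : IsWeyl β w) {n : ℕ}
    (hW : Nat.card W = 2 ^ n) (hβ : ∀ a ∈ W, β a a = 0) :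
    ∃ A : Subgroup (weylGroup h (Subgroup.zpowers (-1)) (Subgroup.mem_zpowers _) ⊤),
      Nat.card A = 2 ^ (n + 1) ∧ ∀ x ∈ A, x ^ 2 = 1 := by
  have hle : weylGroup h (Subgroup.zpowers (-1)) (Subgroup.mem_zpowers _) W ≤
      weylGroup h (Subgroup.zpowers (-1)) (Subgroup.mem_zpowers _) ⊤ := by
    rintro x ⟨a, -, c, hc, hx⟩
    exact ⟨a, Submodule.mem_top, c, hc, hx⟩
  refine ⟨(weylGroup h (Subgroup.zpowers (-1)) (Subgroup.mem_zpowers _) W).subgroupOf _, ?_, ?_⟩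
  · rw [Nat.card_congr (Subgroup.subgroupOfEquivOfLe hle).toEquiv, card_weylGroup h2, hW,
      Nat.card_zpowers, orderOf_neg_one_units h2, pow_succ]
  · rintro x hx
    obtain ⟨a, ha, c, hc, hx⟩ := mem_weylGroup.mp (Subgroup.mem_subgroupOf.mp hx)
    apply Subtype.ext
    apply toEnd_injective
    rw [pow_two, Subgroup.coe_mul, toEnd_mul, hx, smul_mul_smul_comm, h.sq, hβ a ha, sgn_zero,
      one_smul]
    have hcc : c * c = 1 := by
      have := orderOf_dvd_of_mem_zpowers hc
      rw [orderOf_neg_one_units h2] at this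
      rw [← pow_two]
      exact orderOf_dvd_iff_pow_eq_one.mp this
    rw [← Units.val_mul, hcc, Units.val_one, one_smul]; rfl

lemma weylGroup_le (h : IsWeyl β w) {G : Subgroup (V ≃ₗ[F] V)} (hG : ∀ a, w a ∈ G)
    (hneg : ∀ x : V ≃ₗ[F] V, ∀ c : F, c * c = 1 → toEnd x = c • 1 → x ∈ G) :
    weylGroup h (Subgroup.zpowers (-1)) (Subgroup.mem_zpowers _) ⊤ ≤ G := by
  rintro x ⟨a, -, c, hc, hx⟩
  have h1 : x * (w a)⁻¹ ∈ G := by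
    refine hneg _ c ?_ (toEnd_mul_inv_of_smul hx)
    obtain ⟨k, rfl⟩ := hc
    change (((-1 : Fˣ) ^ k : Fˣ) : F) * (((-1 : Fˣ) ^ k : Fˣ) : F) = 1
    rw [← Units.val_mul, ← zpow_add, Even.neg_one_zpow ⟨k, rfl⟩, Units.val_one]
  rwa [Subgroup.mul_mem_cancel_right _ (inv_mem (hG a))] at h1

/-- Transport of a Weyl system along a linear equivalence. -/
lemma IsWeyl.conj {V' : Type*} [AddCommGroup V'] [Module F V'] (h : IsWeyl β w) (θ : V ≃ₗ[F] V') :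
    IsWeyl β (fun a => (θ.symm.trans (w a)).trans θ) where
  mul a b := by
    ext v
    have := LinearMap.congr_fun (h.mul a b) (θ.symm v)
    change θ (w a (θ.symm (θ (w b (θ.symm v))))) = sgn F (β a b) • θ (w (a + b) (θ.symm v))
    rw [θ.symm_apply_apply, ← map_smul]
    exact congrArg θ this
  nondeg := h.nondeg

/-- A system of endomorphisms with the Weyl relations consists of automorphisms. -/
lemma exists_isWeyl {D : E → Module.End F V} (h0 : D 0 = 1)
    (hD : ∀ a b, D a * D b = sgn F (β a b) • D (a + b))
    (hβ : ∀ a, (∀ b, β a b + β b a = 0) → a = 0) :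
    ∃ w : E → V ≃ₗ[F] V, (∀ a, toEnd (w a) = D a) ∧ IsWeyl β w := by
  have hsq : ∀ a, D a * D a = sgn F (β a a) • 1 := fun a => by
    rw [hD, ZModModule.add_self, h0]
  let w : E → V ≃ₗ[F] V := fun a => LinearEquiv.ofLinearMap (D a) (sgn F (β a a) • D a)
    (by change D a * (sgn F (β a a) • D a) = 1
        rw [mul_smul_comm, hsq, smul_smul, sgn_mul_self, one_smul])
    (by change (sgn F (β a a) • D a) * D a = 1
        rw [smul_mul_assoc, hsq, smul_smul, sgn_mul_self, one_smul])
  have hw : ∀ a, toEnd (w a) = D a := fun a => by ext v; rfl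
  exact ⟨w, hw, fun a b => by rw [hw, hw, hw, hD], hβ⟩

end WeylSystems

/-! ### Tensor product models -/

section Models

variable {F : Type*} [Field F] {K E₁ : Type*} [AddCommGroup K] [Module F K]
  [AddCommGroup E₁] [Module (ZMod 2) E₁]

/-- The cocycle of the tensor product of a Weyl system with a Heisenberg system. -/
def modelCocycle (β₁ : E₁ →ₗ[ZMod 2] E₁ →ₗ[ZMod 2] ZMod 2) (m : ℕ) :
    (E₁ × ((Fin m → ZMod 2) × (Fin m → ZMod 2))) →ₗ[ZMod 2]
      (E₁ × ((Fin m → ZMod 2) × (Fin m → ZMod 2))) →ₗ[ZMod 2] ZMod 2 :=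
  LinearMap.mk₂ (ZMod 2) (fun x y => β₁ x.1 y.1 + dotProduct x.2.1 y.2.2)
    (fun x x' y => by simp [add_dotProduct]; ring)
    (fun c x y => by simp [smul_dotProduct, mul_add])
    (fun x y y' => by simp [dotProduct_add]; ring)
    (fun c x y => by simp [dotProduct_smul, mul_add])

lemma modelCocycle_apply (β₁ : E₁ →ₗ[ZMod 2] E₁ →ₗ[ZMod 2] ZMod 2) (m : ℕ)
    (x y : E₁ × ((Fin m → ZMod 2) × (Fin m → ZMod 2))) :
    modelCocycle β₁ m x y = β₁ x.1 y.1 + dotProduct x.2.1 y.2.2 := rfl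

/-- The operators of the tensor product of a Weyl system with a Heisenberg system. -/
def modelOperator (M : E₁ → Module.End F K) (m : ℕ)
    (x : E₁ × ((Fin m → ZMod 2) × (Fin m → ZMod 2))) : Module.End F ((Fin m → ZMod 2) → K) where
  toFun f t := sgn F (dotProduct x.2.2 t) • M x.1 (f (t + x.2.1))
  map_add' f g := by ext t; simp
  map_smul' c f := by ext t; simp [smul_comm c]

lemma modelOperator_apply (M : E₁ → Module.End F K) (m : ℕ)
    (x : E₁ × ((Fin m → ZMod 2) × (Fin m → ZMod 2))) (f : (Fin m → ZMod 2) → K)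
    (t : Fin m → ZMod 2) :
    modelOperator M m x f t = sgn F (dotProduct x.2.2 t) • M x.1 (f (t + x.2.1)) := rfl

/-- The product form on a space of functions. -/
def sumForm (b : K →ₗ[F] K →ₗ[F] F) (m : ℕ) :
    ((Fin m → ZMod 2) → K) →ₗ[F] ((Fin m → ZMod 2) → K) →ₗ[F] F :=
  LinearMap.mk₂ F (fun f g => ∑ t, b (f t) (g t))
    (fun f f' g => by simp [Finset.sum_add_distrib])
    (fun c f g => by simp [Finset.mul_sum])
    (fun f g g' => by simp [Finset.sum_add_distrib])
    (fun c f g => by simp [Finset.mul_sum])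

lemma sumForm_apply (b : K →ₗ[F] K →ₗ[F] F) (m : ℕ) (f g : (Fin m → ZMod 2) → K) :
    sumForm b m f g = ∑ t, b (f t) (g t) := rfl

lemma sumForm_nondegenerate {b : K →ₗ[F] K →ₗ[F] F} (hb : ∀ v, (∀ w, b v w = 0) → v = 0) (m : ℕ)
    (f : (Fin m → ZMod 2) → K) (hf : ∀ g, sumForm b m f g = 0) : f = 0 := by
  funext t
  refine hb _ fun v => ?_
  have h := hf (Pi.single t v)
  rw [sumForm_apply, Finset.sum_eq_single t] at h
  · simpa using h
  · intro s _ hs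
    simp [Pi.single_eq_of_ne hs]
  · simp

/-- The tensor product of a Weyl system with a Heisenberg system. -/
theorem exists_model {β₁ : E₁ →ₗ[ZMod 2] E₁ →ₗ[ZMod 2] ZMod 2} {M : E₁ → Module.End F K}
    (h0 : M 0 = 1) (hM : ∀ a b, M a * M b = sgn F (β₁ a b) • M (a + b))
    (hβ₁ : ∀ a, (∀ b, β₁ a b + β₁ b a = 0) → a = 0) {b : K →ₗ[F] K →ₗ[F] F}
    (hb : ∀ a v w, b (M a v) (M a w) = b v w) (m : ℕ) :
    ∃ w : E₁ × ((Fin m → ZMod 2) × (Fin m → ZMod 2)) →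
        ((Fin m → ZMod 2) → K) ≃ₗ[F] ((Fin m → ZMod 2) → K),
      IsWeyl (modelCocycle β₁ m) w ∧
        ∀ a f g, sumForm b m (w a f) (w a g) = sumForm b m f g := by
  obtain ⟨w, hw, hW⟩ := exists_isWeyl (β := modelCocycle β₁ m) (D := modelOperator M m) (by
      refine LinearMap.ext fun f => ?_
      funext t
      rw [modelOperator_apply]
      simp [h0, sgn_zero]) (by
      intro x y
      refine LinearMap.ext fun f => ?_
      funext t
      rw [LinearMap.smul_apply, Pi.smul_apply, Module.End.mul_apply, modelOperator_apply,
        modelOperator_apply, modelOperator_apply, map_smul, modelCocycle_apply,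
        ← Module.End.mul_apply, hM, LinearMap.smul_apply, smul_smul, smul_smul, smul_smul]
      have e : t + x.2.1 + y.2.1 = t + (x + y).2.1 := by
        rw [Prod.snd_add, Prod.fst_add, add_assoc]
      have e' : sgn F (dotProduct x.2.2 t) * sgn F (dotProduct y.2.2 (t + x.2.1)) *
          sgn F (β₁ x.1 y.1) = sgn F (β₁ x.1 y.1 + dotProduct x.2.1 y.2.2) *
          sgn F (dotProduct (x + y).2.2 t) := by
        rw [dotProduct_add, Prod.snd_add, Prod.snd_add, add_dotProduct,
          dotProduct_comm x.2.1 y.2.2]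
        simp only [sgn_add]
        ring
      rw [e, e']
      rfl) (by
      rintro ⟨c, a, b⟩ h
      have hc : c = 0 := hβ₁ c fun c' => by
        have := h (c', 0, 0)
        simpa [modelCocycle_apply] using this
      have ha : a = 0 := by
        funext i
        have := h (0, 0, Pi.single i 1)
        simpa [modelCocycle_apply] using this
      have hb : b = 0 := by
        funext i
        have := h (0, Pi.single i 1, 0)
        simpa [modelCocycle_apply] using this
      rw [hc, ha, hb]; rfl)
  refine ⟨w, hW, fun x f g => ?_⟩
  have hwx : ∀ f, w x f = modelOperator M m x f := fun f => LinearMap.congr_fun (hw x) f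
  -- Reindexing the sum by the translation absorbs the shift, and each sign occurs twice.
  rw [hwx, hwx, sumForm_apply, sumForm_apply, ← Equiv.sum_comp (Equiv.addRight x.2.1)]
  refine Finset.sum_congr rfl fun t _ => ?_
  rw [modelOperator_apply, modelOperator_apply, map_smul, map_smul, LinearMap.smul_apply, hb,
    smul_eq_mul, smul_eq_mul, ← mul_assoc, sgn_mul_self, one_mul, Equiv.coe_addRight, add_assoc,
    ZModModule.add_self, add_zero]

end Models

/-! ### The quaternion group on a plane -/

section QuaternionModel

variable {F : Type*} [Field F]

/-- The determinant form on the plane. -/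
def planeForm (F : Type*) [Field F] : (F × F) →ₗ[F] (F × F) →ₗ[F] F :=
  LinearMap.mk₂ F (fun v w => v.1 * w.2 - v.2 * w.1)
    (fun v v' w => by simp; ring) (fun c v w => by simp; ring)
    (fun v w w' => by simp; ring) (fun c v w => by simp; ring)

lemma planeForm_apply (v w : F × F) : planeForm F v w = v.1 * w.2 - v.2 * w.1 := rfl

/-- The cocycle of the quaternion group. -/
def quaternionCocycle : (ZMod 2 × ZMod 2) →ₗ[ZMod 2] (ZMod 2 × ZMod 2) →ₗ[ZMod 2] ZMod 2 :=
  LinearMap.mk₂ (ZMod 2) (fun x y => x.1 * y.1 + x.2 * y.1 + x.2 * y.2)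
    (fun x x' y => by simp; ring) (fun c x y => by simp; ring)
    (fun x y y' => by simp; ring) (fun c x y => by simp; ring)

lemma quaternionCocycle_apply (x y : ZMod 2 × ZMod 2) :
    quaternionCocycle x y = x.1 * y.1 + x.2 * y.1 + x.2 * y.2 := rfl

/-- A representation of the quaternion group on the plane. -/
def quaternionOperator (α β : F) (x : ZMod 2 × ZMod 2) : Module.End F (F × F) where
  toFun v :=
    let u : F × F := if x.2 = 0 then v else (α * v.1 + β * v.2, β * v.1 - α * v.2)
    if x.1 = 0 then u else (u.2, -u.1)
  map_add' v w := by
    split_ifs <;> ext <;> simp <;> ring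
  map_smul' c v := by
    split_ifs <;> ext <;> simp <;> ring

lemma quaternionOperator_apply (α β : F) (x : ZMod 2 × ZMod 2) (v : F × F) :
    quaternionOperator α β x v =
      let u : F × F := if x.2 = 0 then v else (α * v.1 + β * v.2, β * v.1 - α * v.2)
      if x.1 = 0 then u else (u.2, -u.1) := rfl

/-- The generators (0 1; -1 0) and (α β; β -α) anticommute and have square -1, the latter by `h`;
the cocycle records the signs from sorting the product. -/
lemma quaternionOperator_mul {α β : F} (h : α * α + β * β = -1) (x y : ZMod 2 × ZMod 2) :
    quaternionOperator α β x * quaternionOperator α β y =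
      sgn F (quaternionCocycle x y) • quaternionOperator α β (x + y) := by
  have h11 : (1 : ZMod 2) + 1 = 0 := rfl
  obtain ⟨a, b⟩ := x
  obtain ⟨c, d⟩ := y
  refine LinearMap.ext fun v => ?_
  obtain ⟨v₁, v₂⟩ := v
  rw [LinearMap.smul_apply, Module.End.mul_apply, quaternionOperator_apply,
    quaternionOperator_apply, quaternionOperator_apply, quaternionCocycle_apply]
  rcases zmod_two_cases a with rfl | rfl <;> rcases zmod_two_cases b with rfl | rfl <;>
    rcases zmod_two_cases c with rfl | rfl <;> rcases zmod_two_cases d with rfl | rfl <;>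
    simp [sgn_zero, sgn_one, h11] <;> (try constructor) <;>
    first
    | ring1
    | linear_combination v₁ * h
    | linear_combination -v₁ * h
    | linear_combination v₂ * h
    | linear_combination -v₂ * h

/-- Both generators have determinant 1. -/
lemma quaternionOperator_form {α β : F} (h : α * α + β * β = -1) (x : ZMod 2 × ZMod 2)
    (v w : F × F) : planeForm F (quaternionOperator α β x v) (quaternionOperator α β x w) =
      planeForm F v w := by
  rw [planeForm_apply, planeForm_apply, quaternionOperator_apply, quaternionOperator_apply]
  by_cases h1 : x.1 = 0 <;> by_cases h2 : x.2 = 0 <;> simp only [h1, h2, if_true, if_false]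
  · linear_combination (v.2 * w.1 - v.1 * w.2) * h
  · ring
  · linear_combination (v.2 * w.1 - v.1 * w.2) * h

end QuaternionModel

/-! ### Invariant forms and the type of the group -/

section Types

variable {F V : Type*} [Field F] [AddCommGroup V] [Module F V] [FiniteDimensional F V]
  {E : Type*} [AddCommGroup E] [Module (ZMod 2) E] [FiniteDimensional (ZMod 2) E]

/-- An extraspecial group of symplectic isometries is of minus type. -/
lemma IsQuadraticFrame.not_hasHalfSingular [Nontrivial V] (h2 : (2 : F) ≠ 0)
    {R : Subgroup (V ≃ₗ[F] V)} {Q : QuadraticForm (ZMod 2) E} {w : E → V ≃ₗ[F] V}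
    (h : IsQuadraticFrame R Q w) {B : V →ₗ[F] V →ₗ[F] F} (hB : ∀ v, B v v = 0)
    (hnd : ∀ v, (∀ w, B v w = 0) → v = 0) (hRG : R ≤ formIsometries (fun v w => B v w)) :
    ¬ HasHalfSingular Q := by
  rintro ⟨W, hW, hW0⟩
  have hiso : ∀ a ∈ W, ∀ b ∈ W, Q.polarBilin a b = 0 := by
    intro a ha b hb
    have h1 := quadratic_add Q a b
    rw [hW0 a ha, hW0 b hb, hW0 _ (W.add_mem ha hb)] at h1
    simpa using h1.symm
  have hperp : W = perp Q.polarBilin W := by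
    have hle : W ≤ perp Q.polarBilin W := fun v hv => mem_perp.mpr fun w hw => hiso w hw v hv
    have h3 := finrank_add_finrank_perp Q.polarBilin h.nondegenerate.right W
    exact Submodule.eq_of_le_of_finrank_eq hle (by omega)
  -- The `w a` with `a ∈ W` are commuting involutions or the identity, so they share an eigenvector
  -- `v`; the aim is to show that `v` is in the radical of `B`.
  obtain ⟨v, hv, hev⟩ := exists_common_eigenvector (fun a : W => toEnd (w a))
    (fun a b => by rw [h.comm, hiso a a.2 b b.2, sgn_zero, one_smul])
    (fun a => ⟨1, by rw [h.sq, hW0 a a.2, sgn_zero, one_mul]⟩)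
  have hsq : ∀ a ∈ W, ∃ μ : F, μ * μ = 1 ∧ w a v = μ • v := by
    intro a ha
    obtain ⟨μ, hμ⟩ := hev ⟨a, ha⟩
    refine ⟨μ, ?_, hμ⟩
    have h1 : w a (w a v) = v := by
      have h3 := LinearMap.congr_fun (h.sq a) v
      rw [hW0 a ha, sgn_zero, one_smul] at h3
      exact h3
    have hμ' : w a v = μ • v := hμ
    rw [hμ', map_smul, hμ', smul_smul] at h1
    have h3 : (μ * μ - 1) • v = 0 := by rw [sub_smul, h1, one_smul, sub_self]
    exact sub_eq_zero.mp ((smul_eq_zero.mp h3).resolve_right hv)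
  -- For `c ∈ W` the form is alternating. For `c ∉ W = W^⊥` some `w a` with `a ∈ W` anticommutes
  -- with `w c`, and invariance under it gives B(v, w c v) = -B(v, w c v).
  have hzero : ∀ c, B v (w c v) = 0 := by
    intro c
    by_cases hc : c ∈ W
    · obtain ⟨μ, -, hμ⟩ := hsq c hc
      rw [hμ, map_smul, hB, smul_zero]
    · rw [hperp, mem_perp] at hc
      push Not at hc
      obtain ⟨a, ha, hac⟩ := hc
      obtain ⟨μ, hμμ, hμ⟩ := hsq a ha
      have h1 : B (w a v) (w a (w c v)) = B v (w c v) := hRG (h.mem a) v (w c v)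
      have h3 := LinearMap.congr_fun (h.comm a c) v
      rw [zmod_two_ne_zero.mp hac, sgn_one] at h3
      have h4 : w a (w c v) = (-1 : F) • w c (w a v) := h3
      rw [h4, hμ, map_smul (w c), map_smul, map_smul, map_smul, LinearMap.smul_apply] at h1
      simp only [smul_eq_mul] at h1
      have h5 : 2 * B v (w c v) = 0 := by
        linear_combination -h1 - B v (w c v) * hμμ
      exact (mul_eq_zero.mp h5).resolve_left h2
  refine hv (hnd v fun u => ?_)
  have hall : ∀ S : Module.End F V, B v (S v) = 0 := by
    intro S
    have hS : S ∈ Submodule.span F (toEnd '' Set.range w) := by rw [h.span]; trivial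
    induction hS using Submodule.span_induction with
    | mem x hx =>
      obtain ⟨_, ⟨c, rfl⟩, rfl⟩ := hx
      exact hzero c
    | zero => simp
    | add x y _ _ hx hy => rw [LinearMap.add_apply, map_add, hx, hy, add_zero]
    | smul c x _ hx => rw [LinearMap.smul_apply, map_smul, hx, smul_zero]
  obtain ⟨ℓ, hℓ⟩ := Module.Projective.exists_dual_eq_one F hv
  have := hall (LinearMap.smulRight ℓ u)
  simpa [hℓ] using this

/-- A form with an antisymmetric involution has a totally isotropic subspace of half the
dimension. -/
lemma exists_isotropic_of_involution (h2 : (2 : F) ≠ 0) (b : V →ₗ[F] V →ₗ[F] F)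
    (hnd : ∀ v, (∀ w, b w v = 0) → v = 0) (S : Module.End F V) (hS : S * S = 1)
    (hb : ∀ v w, b (S v) w = -b v (S w)) :
    ∃ W : Submodule F V, 2 * Module.finrank F W = Module.finrank F V ∧
      ∀ v ∈ W, ∀ w ∈ W, b v w = 0 := by
  have hSS : ∀ v, S (S v) = v := fun v => LinearMap.congr_fun hS v
  -- The eigenspaces for 1 and -1 are isotropic, hence of at most half the dimension each, and they
  -- span `V`.
  have hiso : ∀ c : F, c * c = 1 → ∀ v ∈ Module.End.eigenspace S c,
      ∀ w ∈ Module.End.eigenspace S c, b v w = 0 := by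
    intro c hc v hv w hw
    rw [Module.End.mem_eigenspace_iff] at hv hw
    have h1 := hb v w
    rw [hv, hw, map_smul, map_smul, LinearMap.smul_apply, smul_eq_mul] at h1
    have hc0 : c ≠ 0 := left_ne_zero_of_mul_eq_one hc
    have h3 : (2 * c) * b v w = 0 := by linear_combination h1
    exact (mul_eq_zero.mp h3).resolve_left (mul_ne_zero h2 hc0)
  have hsup : Module.End.eigenspace S (1 : F) ⊔ Module.End.eigenspace S (-1 : F) = ⊤ := by
    rw [eq_top_iff]
    intro v _
    have e : v = (2 : F)⁻¹ • (v + S v) + (2 : F)⁻¹ • (v - S v) := by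
      rw [← smul_add, show v + S v + (v - S v) = (2 : F) • v by rw [two_smul]; abel, smul_smul,
        inv_mul_cancel₀ h2, one_smul]
    rw [e]
    refine Submodule.add_mem_sup ?_ ?_
    · rw [Module.End.mem_eigenspace_iff, map_smul, map_add, hSS, one_smul, add_comm]
    · rw [Module.End.mem_eigenspace_iff, map_smul, map_sub, hSS, neg_smul, one_smul, ← smul_neg,
        neg_sub]
  have h1 := two_mul_finrank_le_of_isotropic b hnd _ (hiso 1 (one_mul 1))
  have h3 := two_mul_finrank_le_of_isotropic b hnd _ (hiso (-1) (by ring))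
  have h4 := Submodule.finrank_add_le_finrank_add_finrank (Module.End.eigenspace S (1 : F))
    (Module.End.eigenspace S (-1 : F))
  rw [hsup, finrank_top] at h4
  exact ⟨_, by omega, hiso 1 (one_mul 1)⟩

/-- A Weyl system of isometries containing a quaternion group forces an isotropic subspace of half
the dimension. -/
lemma IsWeyl.exists_isotropic (h2 : (2 : F) ≠ 0) {β : E →ₗ[ZMod 2] E →ₗ[ZMod 2] ZMod 2}
    {w : E → V ≃ₗ[F] V} (h : IsWeyl β w) (b : V →ₗ[F] V →ₗ[F] F)
    (hnd : ∀ v, (∀ w, b w v = 0) → v = 0) (hb : ∀ a v u, b (w a v) (w a u) = b v u) {x y : E}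
    (hx : β x x = 1) (hy : β y y = 1) (hxy : β x y + β y x = 1) {α γ : F}
    (hαγ : α * α + γ * γ = -1) :
    ∃ W : Submodule F V, 2 * Module.finrank F W = Module.finrank F V ∧
      ∀ v ∈ W, ∀ w ∈ W, b v w = 0 := by
  have hsq : ∀ a, β a a = 1 → toEnd (w a) * toEnd (w a) = (-1 : F) • 1 := fun a ha => by
    rw [h.sq, ha, sgn_one]
  have hanti : ∀ a, β a a = 1 → ∀ v u, b (toEnd (w a) v) u = -b v (toEnd (w a) u) := by
    intro a ha v u
    have h1 : b (w a (w a v)) (w a u) = b (w a v) u := hb a (w a v) u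
    have h3 : w a (w a v) = (-1 : F) • v := LinearMap.congr_fun (hsq a ha) v
    rw [h3, neg_smul, one_smul, map_neg, LinearMap.neg_apply] at h1
    exact h1.symm
  -- `w x` and `w y` are skew, anticommute and have square -1, so this combination is skew with
  -- square -(α² + γ²) = 1.
  refine exists_isotropic_of_involution h2 b hnd (α • toEnd (w x) + γ • toEnd (w y)) ?_ ?_
  · have hc := h.comm x y
    rw [hxy, sgn_one, neg_smul, one_smul] at hc
    rw [add_mul, mul_add, mul_add, smul_mul_smul_comm, smul_mul_smul_comm, smul_mul_smul_comm,
      smul_mul_smul_comm, hsq x hx, hsq y hy, hc, smul_neg, mul_comm γ α, smul_smul, smul_smul]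
    have e : α * α * -1 + γ * γ * -1 = 1 := by linear_combination -hαγ
    calc _ = (α * α * -1 + γ * γ * -1) • (1 : Module.End F V) := by rw [add_smul]; abel
      _ = 1 := by rw [e, one_smul]
  · intro v u
    simp only [LinearMap.add_apply, LinearMap.smul_apply, map_add, map_smul, hanti x hx,
      hanti y hy, smul_eq_mul]
    ring

end Types

/-! ### Existence of the groups inside the classical groups -/

section Existence

variable {F V : Type*} [Field F] [Finite F] [AddCommGroup V] [Module F V] [FiniteDimensional F V]

lemma exists_sq_add_sq_eq_neg_one (F : Type*) [Field F] [Finite F] :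
    ∃ α γ : F, α * α + γ * γ = -1 := by
  obtain ⟨p, hp⟩ := CharP.exists F
  have : NeZero p := ⟨CharP.char_ne_zero_of_finite F p⟩
  obtain ⟨a, b, h⟩ := CharP.sq_add_sq F p (-1)
  exact ⟨a, b, by rw [← pow_two, ← pow_two, h]; simp⟩

/-- The Heisenberg system on the space of functions on an elementary abelian `2`-group. -/
lemma exists_heisenberg_system (F : Type*) [Field F] (n : ℕ) :
    ∃ w : PUnit.{1} × ((Fin n → ZMod 2) × (Fin n → ZMod 2)) →
        ((Fin n → ZMod 2) → F) ≃ₗ[F] ((Fin n → ZMod 2) → F),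
      IsWeyl (modelCocycle 0 n) w ∧ ∀ a f g, sumForm (LinearMap.mul F F) n (w a f) (w a g) =
        sumForm (LinearMap.mul F F) n f g :=
  exists_model (M := fun _ => 1) rfl (fun a b => by simp [sgn_zero])
    (fun a _ => Subsingleton.elim _ _) (fun a v w => rfl) n

lemma card_model (n : ℕ) :
    Nat.card (PUnit.{1} × ((Fin n → ZMod 2) × (Fin n → ZMod 2))) = 2 ^ (2 * n) := by
  simp [two_mul, pow_add]

lemma finrank_functions (F : Type*) [Field F] (n : ℕ) :
    Module.finrank F ((Fin n → ZMod 2) → F) = 2 ^ n := by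
  simp

lemma finrank_functions_plane (F : Type*) [Field F] (n : ℕ) :
    Module.finrank F ((Fin n → ZMod 2) → F × F) = 2 ^ (n + 1) := by
  rw [Module.finrank_pi_fintype]
  simp [pow_succ]

lemma nontrivial_of_card_pow {E : Type*} {n : ℕ} (hn : 1 ≤ n) (hE : Nat.card E = 2 ^ (2 * n)) :
    Nontrivial E := by
  have : Finite E := Nat.finite_of_card_ne_zero (by rw [hE]; positivity)
  rw [← Finite.one_lt_card_iff_nontrivial, hE]
  exact Nat.one_lt_two_pow (by omega)

/-- The standard symmetric form on the space of functions is of plus type. -/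
lemma isPlusType_sumForm (h2 : (2 : F) ≠ 0) {n : ℕ} (hn : 2 ≤ n) :
    IsPlusType (LinearMap.BilinMap.toQuadraticMap (sumForm (LinearMap.mul F F) n)) := by
  have hsymm : ∀ f g, sumForm (LinearMap.mul F F) n f g = sumForm (LinearMap.mul F F) n g f :=
    fun f g => Finset.sum_congr rfl fun t _ => mul_comm _ _
  have hnd := sumForm_nondegenerate (b := LinearMap.mul F F)
    (fun v hv => by simpa using hv 1) n
  refine ⟨?_, ?_, ?_⟩
  · rw [finrank_functions]
    exact (Nat.even_pow.mpr ⟨even_two, by omega⟩)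
  · intro f hf
    refine hnd f fun g => ?_
    have h1 := hf g
    rw [LinearMap.BilinMap.polar_toQuadraticMap, hsymm g f, ← two_mul] at h1
    exact (mul_eq_zero.mp h1).resolve_left h2
  · obtain ⟨w, hw, hb⟩ := exists_heisenberg_system F n
    obtain ⟨α, γ, hαγ⟩ := exists_sq_add_sq_eq_neg_one F
    -- Two coordinates suffice for a pair of anticommuting operators of square -1, to which
    -- `IsWeyl.exists_isotropic` applies.
    let i : Fin n := ⟨0, by omega⟩
    let j : Fin n := ⟨1, by omega⟩
    have hij : i ≠ j := by simp [i, j]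
    obtain ⟨W, hW, hW0⟩ := hw.exists_isotropic h2 (sumForm (LinearMap.mul F F) n)
      (fun v hv => hnd v fun u => by rw [hsymm]; exact hv u) hb
      (x := (0, Pi.single i 1, Pi.single i 1))
      (y := (0, Pi.single j 1, Pi.single i 1 + Pi.single j 1))
      (by simp [modelCocycle_apply]) (by simp [modelCocycle_apply, hij])
      (by simp [modelCocycle_apply, hij, hij.symm]) hαγ
    exact ⟨W, hW, fun v hv => hW0 v hv v hv⟩

/-- Extraspecial groups of plus type in orthogonal groups of plus type. -/
theorem exists_isExtraspecialPlus (h2 : (2 : F) ≠ 0) {n : ℕ} (hn : 2 ≤ n)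
    (hV : Module.finrank F V = 2 ^ n) {Q : QuadraticForm F V} (hQ : IsPlusType Q) :
    ∃ R : Subgroup (V ≃ₗ[F] V), R ≤ quadraticIsometries Q ∧ IsExtraspecialPlus n R := by
  obtain ⟨w, hw, hb⟩ := exists_heisenberg_system F n
  obtain ⟨θ, hθ⟩ := exists_isometry_of_isPlusType (isPlusType_sumForm (F := F) h2 hn) hQ (by
    rw [finrank_functions, hV])
  have hw' := hw.conj θ
  have : Nontrivial V := Module.nontrivial_of_finrank_pos (R := F) (by rw [hV]; positivity)
  have := nontrivial_of_card_pow (by omega : 1 ≤ n) (card_model n)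
  refine ⟨_, weylGroup_le hw' (fun a v => ?_) (fun x c hc hx v => ?_),
    hw'.isExtraspecial h2 (card_model n), ?_⟩
  · change Q (θ (w a (θ.symm v))) = Q v
    rw [hθ, LinearMap.BilinMap.toQuadraticMap_apply, hb, ← LinearMap.BilinMap.toQuadraticMap_apply,
      ← hθ, θ.apply_symm_apply]
  · have : x v = c • v := LinearMap.congr_fun hx v
    rw [this, QuadraticMap.map_smul, hc, one_smul]
  · let ι : (Fin n → ZMod 2) →ₗ[ZMod 2] PUnit.{1} × ((Fin n → ZMod 2) × (Fin n → ZMod 2)) :=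
      LinearMap.inr _ _ _ ∘ₗ LinearMap.inr _ _ _
    have hι : Function.Injective ι := LinearMap.inr_injective.comp LinearMap.inr_injective
    refine hw'.exists_elementaryAbelian h2 (W := LinearMap.range ι) ?_ ?_
    · rw [← Nat.card_congr (LinearEquiv.ofInjective ι hι).toEquiv]
      simp
    · rintro _ ⟨b, rfl⟩
      simp [ι, modelCocycle_apply]

/-- Extraspecial groups in symplectic groups. -/
theorem exists_isExtraspecial_symplectic (h2 : (2 : F) ≠ 0) {n : ℕ} (hn : 1 ≤ n)
    (hV : Module.finrank F V = 2 ^ n) {B : V →ₗ[F] V →ₗ[F] F} (hB : ∀ v, B v v = 0)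
    (hnd : ∀ v, (∀ w, B v w = 0) → v = 0) :
    ∃ R : Subgroup (V ≃ₗ[F] V), R ≤ formIsometries (fun v w => B v w) ∧
      IsExtraspecial 2 n R := by
  obtain ⟨m, rfl⟩ : ∃ m, n = m + 1 := ⟨n - 1, by omega⟩
  obtain ⟨α, γ, hαγ⟩ := exists_sq_add_sq_eq_neg_one F
  -- The plane valued model preserves an alternating form, and all such forms of one dimension are
  -- isometric.
  obtain ⟨w, hw, hb⟩ := exists_model (β₁ := quaternionCocycle) (M := quaternionOperator α γ)
    (b := planeForm F) (by
      refine LinearMap.ext fun v => ?_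
      rw [quaternionOperator_apply]; simp) (quaternionOperator_mul hαγ) (by decide)
      (quaternionOperator_form hαγ) m
  obtain ⟨θ, hθ⟩ := exists_isometry_of_alternating (sumForm (planeForm F) m)
    (fun f => Finset.sum_eq_zero fun t _ => by rw [planeForm_apply]; ring)
    (sumForm_nondegenerate (fun v hv => by
      have h1 := hv (0, 1)
      have h3 := hv (1, 0)
      rw [planeForm_apply] at h1 h3
      ext
      · simpa using h1
      · simpa using h3) m) B hB hnd (by rw [finrank_functions_plane, hV])
  have hw' := hw.conj θ
  have hcard : Nat.card ((ZMod 2 × ZMod 2) × ((Fin m → ZMod 2) × (Fin m → ZMod 2))) =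
      2 ^ (2 * (m + 1)) := by
    simp
    ring
  have : Nontrivial V := Module.nontrivial_of_finrank_pos (R := F) (by rw [hV]; positivity)
  have := nontrivial_of_card_pow (by omega : 1 ≤ m + 1) hcard
  refine ⟨_, weylGroup_le hw' (fun a u v => ?_) (fun x c hc hx => ?_),
    hw'.isExtraspecial h2 hcard⟩
  · change B (θ (w a (θ.symm u))) (θ (w a (θ.symm v))) = B u v
    rw [hθ, hb, ← hθ, θ.apply_symm_apply, θ.apply_symm_apply]
  · rw [mem_formIsometries_iff_isSimilarity, ← hc]
    exact isSimilarity_of_toEnd_eq hx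

/-- Groups of symplectic type in general linear groups. -/
theorem exists_isFourCircExtraspecial (h2 : (2 : F) ≠ 0) (hneg : IsSquare (-1 : F)) {n : ℕ}
    (hn : 1 ≤ n) (hV : Module.finrank F V = 2 ^ n) :
    ∃ R : Subgroup (V ≃ₗ[F] V), IsFourCircExtraspecial n R := by
  obtain ⟨w, hw, -⟩ := exists_heisenberg_system F n
  have hw' := hw.conj (LinearEquiv.ofFinrankEq _ V (by rw [finrank_functions, hV]))
  have : Nontrivial V := Module.nontrivial_of_finrank_pos (R := F) (by rw [hV]; positivity)
  have := nontrivial_of_card_pow hn (card_model n)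
  obtain ⟨i, hi⟩ := hneg
  have hi0 : i ≠ 0 := by
    rintro rfl
    rw [mul_zero] at hi
    exact one_ne_zero (neg_eq_zero.mp hi)
  have hζ : (Units.mk0 i hi0) ^ 2 = -1 := Units.ext (by simp [pow_two, ← hi])
  exact ⟨_, hw'.isFourCircExtraspecial h2 (card_model n) hζ
    (hζ ▸ pow_mem (Subgroup.mem_zpowers _) 2)⟩

end Existence

/-! ### The table subgroups -/

section Tables

variable {F V : Type*} [Field F] [Finite F] [AddCommGroup V] [Module F V] [FiniteDimensional F V]
  {q n : ℕ} {B : V →ₗ[F] V →ₗ[F] F} {R R' : Subgroup (V ≃ₗ[F] V)}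

lemma isSquare_two_iff_mod (hF : Nat.card F = q) :
    IsSquare (2 : F) ↔ q % 8 ≠ 3 ∧ q % 8 ≠ 5 := by
  have := Fintype.ofFinite F
  rw [FiniteField.isSquare_two_iff, ← Nat.card_eq_fintype_card, hF]

lemma IsQuadraticFrame.isOrthogonalExtension [Nontrivial V] (hF : Nat.card F = q)
    (h2 : (2 : F) ≠ 0) (hn : 4 ≤ n) {Q : QuadraticForm (ZMod 2) (Space2 n)}
    {w : Space2 n → V ≃ₗ[F] V} (h : IsQuadraticFrame R Q w)
    (hnd : ∀ v, (∀ w, B v w = 0) → v = 0) (hRG : R ≤ formIsometries (fun v w => B v w)) :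
    IsOrthogonalExtension q n
      (formIsometries (fun v w => B v w) ⊓ Subgroup.normalizer (R : Set (V ≃ₗ[F] V))) R Q := by
  obtain ⟨Ψ, hker, hsq, hnsq⟩ := h.exists_hom_normalizer h2 (by
    rw [Module.finrank_fin_fun]; omega) hnd hRG
  have hle : R ≤ formIsometries (fun v w => B v w) ⊓
      Subgroup.normalizer (R : Set (V ≃ₗ[F] V)) := le_inf hRG Subgroup.le_normalizer
  have h2' := isSquare_two_iff_mod hF
  refine ⟨fun hq => ⟨hle, Ψ, hsq ?_, hker⟩, fun hq => ⟨hle, Ψ, hnsq ?_, hker⟩⟩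
  · rw [h2']; omega
  · rw [h2']; omega

lemma exists_conj_of_isometry [Nontrivial V] (hF : Nat.card F = q)
    (h2 : (2 : F) ≠ 0) (hn : 4 ≤ n) {Q Q' : QuadraticForm (ZMod 2) (Space2 n)}
    {w w' : Space2 n → V ≃ₗ[F] V} (h : IsQuadraticFrame R Q w) (h' : IsQuadraticFrame R' Q' w')
    (hnd : ∀ v, (∀ w, B v w = 0) → v = 0) (hRG : R ≤ formIsometries (fun v w => B v w))
    (hRG' : R' ≤ formIsometries (fun v w => B v w)) (φ : Space2 n ≃ₗ[ZMod 2] Space2 n)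
    (hφ : ∀ a, Q' (φ a) = Q a) {G : Subgroup (V ≃ₗ[F] V)}
    (hG : G = formIsometries (fun v w => B v w)) :
    (∃ x ∈ Subgroup.normalizer (G : Set (V ≃ₗ[F] V)),
      G ⊓ Subgroup.normalizer (R' : Set (V ≃ₗ[F] V)) =
        conjSubgroup x (G ⊓ Subgroup.normalizer (R : Set (V ≃ₗ[F] V)))) ∧
    (q % 8 = 3 ∨ q % 8 = 5 → ∃ x ∈ G,
      G ⊓ Subgroup.normalizer (R' : Set (V ≃ₗ[F] V)) =
        conjSubgroup x (G ⊓ Subgroup.normalizer (R : Set (V ≃ₗ[F] V)))) := by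
  subst hG
  obtain ⟨⟨x, hx, hxR⟩, hsq⟩ := h.exists_conj h2 h' (by rw [Module.finrank_fin_fun]; omega)
    hnd hRG hRG' φ hφ
  refine ⟨⟨x, hx, conjSubgroup_inf_normalizer hx hxR⟩, fun hq => ?_⟩
  obtain ⟨y, hy, hyR⟩ := hsq (by rw [isSquare_two_iff_mod hF]; omega)
  exact ⟨y, hy, conjSubgroup_inf_normalizer (Subgroup.le_normalizer hy) hyR⟩

lemma IsExtraspecialMinus.exists_frame (hdvd : 2 ∣ Nat.card F - 1)
    (hV : Module.finrank F V = 2 ^ n) (hR : IsExtraspecialMinus n R) :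
    ∃ (Q : QuadraticForm (ZMod 2) (Space2 n)) (w : Space2 n → V ≃ₗ[F] V),
      IsQuadraticFrame R Q w ∧ IsMinusType Q := by
  have : Nontrivial V := Module.nontrivial_of_finrank_pos (R := F) (by rw [hV]; positivity)
  obtain ⟨Q, w, h⟩ := hR.1.exists_isQuadraticFrame hdvd hV
  refine ⟨Q, w, h, by simp, h.nondegenerate, fun hQ => hR.2 ?_⟩
  exact h.exists_subgroup_of_hasHalfSingular (two_ne_zero_of_dvd_card hdvd) (by simp) hQ

lemma IsExtraspecialPlus.exists_frame (hdvd : 2 ∣ Nat.card F - 1)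
    (hV : Module.finrank F V = 2 ^ n) (hR : IsExtraspecialPlus n R) :
    ∃ (Q : QuadraticForm (ZMod 2) (Space2 n)) (w : Space2 n → V ≃ₗ[F] V),
      IsQuadraticFrame R Q w ∧ IsPlusType Q := by
  have : Nontrivial V := Module.nontrivial_of_finrank_pos (R := F) (by rw [hV]; positivity)
  obtain ⟨Q, w, h⟩ := hR.1.exists_isQuadraticFrame hdvd hV
  obtain ⟨A, hA, hA2⟩ := hR.2
  obtain ⟨W, hW, hW0, -⟩ := h.hasHalfSingular_of_subgroup (two_ne_zero_of_dvd_card hdvd)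
    (n := n) (by simp) A hA hA2
  exact ⟨Q, w, h, by simp, h.nondegenerate, W, hW, hW0⟩

/-- An elementary abelian subgroup of order 2^(n+1) would give a singular subspace of half the
dimension, which an invariant alternating form forbids. -/
lemma isExtraspecialMinus_of_le (hdvd : 2 ∣ Nat.card F - 1) (hV : Module.finrank F V = 2 ^ n)
    (hR : IsExtraspecial 2 n R) (hB : ∀ v, B v v = 0) (hnd : ∀ v, (∀ w, B v w = 0) → v = 0)
    (hRG : R ≤ formIsometries (fun v w => B v w)) : IsExtraspecialMinus n R := by
  have : Nontrivial V := Module.nontrivial_of_finrank_pos (R := F) (by rw [hV]; positivity)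
  have h2 := two_ne_zero_of_dvd_card hdvd
  obtain ⟨Q, w, h⟩ := hR.exists_isQuadraticFrame hdvd hV
  refine ⟨hR, ?_⟩
  rintro ⟨A, hA, hA2⟩
  obtain ⟨W, hW, hW0, -⟩ := h.hasHalfSingular_of_subgroup h2 (n := n) (by simp) A hA hA2
  exact h.not_hasHalfSingular h2 hB hnd hRG ⟨W, hW, hW0⟩

/-- When 2 is invertible a quadratic form is determined by its polar form, so the orthogonal case
reduces to bilinear forms. -/
lemma quadraticIsometries_eq (h2 : (2 : F) ≠ 0) (Q : QuadraticForm F V) :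
    quadraticIsometries Q = formIsometries (fun v w => Q.polarBilin v w) := by
  ext g
  constructor
  · intro hg v w
    change QuadraticMap.polar Q (g v) (g w) = QuadraticMap.polar Q v w
    rw [QuadraticMap.polar, QuadraticMap.polar, ← map_add, hg, hg, hg]
  · intro hg v
    have h1 : QuadraticMap.polar Q (g v) (g v) = QuadraticMap.polar Q v v := hg v v
    rw [QuadraticMap.polar_self, QuadraticMap.polar_self, two_nsmul, two_nsmul, ← two_mul,
      ← two_mul] at h1
    exact mul_left_cancel₀ h2 h1

/-- The table subgroups exist. -/
theorem exists_isTableSubgroup {X : ClassicalType} {G : Subgroup (V ≃ₗ[F] V)}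
    (hG : IsClassicalGroup q G X) (hV : Module.finrank F V = 2 ^ n) (hn : 4 ≤ n) (hq : Odd q)
    (hX : (X = .L ∧ q % 4 = 1) ∨ X = .Sp ∨ X = .OPlus) : ∃ M, IsTableSubgroup q n G M X := by
  have : Nontrivial V := Module.nontrivial_of_finrank_pos (R := F) (by rw [hV]; positivity)
  have hdvd' : 2 ∣ q - 1 := (Nat.Odd.sub_odd hq odd_one).two_dvd
  rcases hX with ⟨rfl, hq4⟩ | rfl | rfl
  · obtain ⟨hF, rfl⟩ := hG
    have hdvd : 2 ∣ Nat.card F - 1 := hF.symm ▸ hdvd'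
    have h2 := two_ne_zero_of_dvd_card hdvd
    have hneg : IsSquare (-1 : F) := by
      have := Fintype.ofFinite F
      rw [FiniteField.isSquare_neg_one_iff, ← Nat.card_eq_fintype_card, hF]
      omega
    obtain ⟨R₀, hR₀⟩ := exists_isFourCircExtraspecial (V := V) h2 hneg (by omega) hV
    obtain ⟨w, hw⟩ := hR₀.exists_isSaturatedFrame hdvd hV
    exact ⟨_, hq4, R₀, _, le_top, hR₀, rfl, rfl, hw.exists_hom_normalizer h2 hneg (top_inf_eq _)⟩
  · obtain ⟨hF, B, hB, hnd, rfl⟩ := hG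
    have hdvd : 2 ∣ Nat.card F - 1 := hF.symm ▸ hdvd'
    have h2 := two_ne_zero_of_dvd_card hdvd
    obtain ⟨R, hRG, hR⟩ := exists_isExtraspecial_symplectic h2 (by omega : 1 ≤ n) hV hB hnd
    have hR' := isExtraspecialMinus_of_le hdvd hV hR hB hnd hRG
    obtain ⟨Q, w, hw, hQ⟩ := hR'.exists_frame hdvd hV
    exact ⟨_, R, hRG, hR', rfl, Q, hQ, hw.isOrthogonalExtension hF h2 hn hnd hRG⟩
  · obtain ⟨hF, Q₀, hQ₀, rfl⟩ := hG
    have hdvd : 2 ∣ Nat.card F - 1 := hF.symm ▸ hdvd'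
    have h2 := two_ne_zero_of_dvd_card hdvd
    obtain ⟨R, hRG, hR⟩ := exists_isExtraspecialPlus h2 (by omega : 2 ≤ n) hV hQ₀
    obtain ⟨Q, w, hw, hQ⟩ := hR.exists_frame hdvd hV
    have h := hw.isOrthogonalExtension (B := Q₀.polarBilin) hF h2 hn hQ₀.2.1
      (quadraticIsometries_eq h2 Q₀ ▸ hRG)
    rw [← quadraticIsometries_eq h2 Q₀] at h
    exact ⟨_, R, hRG, hR, rfl, Q, hQ, h⟩

/-- The table subgroups are conjugate. -/
theorem IsTableSubgroup.exists_conj {X : ClassicalType} {G M M' : Subgroup (V ≃ₗ[F] V)}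
    (hG : IsClassicalGroup q G X) (hV : Module.finrank F V = 2 ^ n) (hn : 4 ≤ n) (hq : Odd q)
    (hM : IsTableSubgroup q n G M X) (hM' : IsTableSubgroup q n G M' X) :
    (∃ x ∈ Subgroup.normalizer (G : Set (V ≃ₗ[F] V)), M' = conjSubgroup x M) ∧
      (X = .L ∨ q % 8 = 3 ∨ q % 8 = 5 → ∃ x ∈ G, M' = conjSubgroup x M) := by
  have : Nontrivial V := Module.nontrivial_of_finrank_pos (R := F) (by rw [hV]; positivity)
  have hdvd' : 2 ∣ q - 1 := (Nat.Odd.sub_odd hq odd_one).two_dvd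
  cases X with
  | L =>
    obtain ⟨hF, rfl⟩ := hG
    have hdvd : 2 ∣ Nat.card F - 1 := hF.symm ▸ hdvd'
    obtain ⟨hq4, R₀, R, -, hR₀, rfl, rfl, -⟩ := hM
    obtain ⟨-, R₀', R', -, hR₀', rfl, rfl, -⟩ := hM'
    have hneg : IsSquare (-1 : F) := by
      have := Fintype.ofFinite F
      rw [FiniteField.isSquare_neg_one_iff, ← Nat.card_eq_fintype_card, hF]
      omega
    obtain ⟨w, hw⟩ := hR₀.exists_isSaturatedFrame hdvd hV
    obtain ⟨w', hw'⟩ := hR₀'.exists_isSaturatedFrame hdvd hV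
    -- Both frames carry the standard form, so the identity of the index space is intertwined, by an
    -- element of GL(V) = G.
    obtain ⟨T, hT⟩ := hw.exists_intertwiner hw' hneg id standardForm_symm (fun a b => rfl)
    have hTR := hw.mem_iff_conj_mem hw' Function.surjective_id hT
    have hTn : T ∈ Subgroup.normalizer ((⊤ : Subgroup (V ≃ₗ[F] V)) : Set (V ≃ₗ[F] V)) :=
      Subgroup.le_normalizer (Subgroup.mem_top T)
    have key := conjSubgroup_inf_normalizer hTn hTR
    exact ⟨⟨T, hTn, key⟩, fun _ => ⟨T, Subgroup.mem_top T, key⟩⟩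
  | U => exact hM.elim
  | Sp =>
    obtain ⟨hF, B, hB, hnd, hG⟩ := hG
    have hdvd : 2 ∣ Nat.card F - 1 := hF.symm ▸ hdvd'
    obtain ⟨R, hRG, hR, rfl, -⟩ := hM
    obtain ⟨R', hRG', hR', rfl, -⟩ := hM'
    obtain ⟨Q, w, hw, hQ⟩ := hR.exists_frame hdvd hV
    obtain ⟨Q', w', hw', hQ'⟩ := hR'.exists_frame hdvd hV
    obtain ⟨φ, hφ⟩ := exists_isometry_of_isMinusType hQ hQ' rfl
    obtain ⟨h1, h3⟩ := exists_conj_of_isometry hF (two_ne_zero_of_dvd_card hdvd) hn hw hw' hnd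
      (hG ▸ hRG) (hG ▸ hRG') φ hφ hG
    exact ⟨h1, fun h => h3 (h.resolve_left (by simp))⟩
  | OPlus =>
    obtain ⟨hF, Q₀, hQ₀, hG⟩ := hG
    have hdvd : 2 ∣ Nat.card F - 1 := hF.symm ▸ hdvd'
    have h2 := two_ne_zero_of_dvd_card hdvd
    rw [quadraticIsometries_eq h2] at hG
    obtain ⟨R, hRG, hR, rfl, -⟩ := hM
    obtain ⟨R', hRG', hR', rfl, -⟩ := hM'
    obtain ⟨Q, w, hw, hQ⟩ := hR.exists_frame hdvd hV
    obtain ⟨Q', w', hw', hQ'⟩ := hR'.exists_frame hdvd hV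
    obtain ⟨φ, hφ⟩ := exists_isometry_of_isPlusType hQ hQ' rfl
    obtain ⟨h1, h3⟩ := exists_conj_of_isometry (B := Q₀.polarBilin) hF h2 hn hw hw' hQ₀.2.1
      (hG ▸ hRG) (hG ▸ hRG') φ hφ hG
    exact ⟨h1, fun h => h3 (h.resolve_left (by simp))⟩
  | OMinus => exact hM.elim

end Tables

end Stingray

/-! ### The proposition -/

theorem proposition9p1 {F V : Type*} [Field F] [Finite F] [AddCommGroup V] [Module F V]
    [FiniteDimensional F V] (X : Stingray.ClassicalType) (q d e₁ e₂ r₁ r₂ : ℕ)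
    (G : Subgroup (V ≃ₗ[F] V)) (hG : Stingray.IsClassicalGroup q G X)
    (hV : Module.finrank F V = d) (hd : 8 < d)
    (hsum : e₁ + e₂ = d) (he₂ : 2 ≤ e₂) (he : e₂ ≤ e₁)
    (hparity : Stingray.ParityCondition e₁ e₂ X)
    (hr₁ : Stingray.IsPpd (Nat.card F) e₁ r₁) (hr₂ : Stingray.IsPpd (Nat.card F) e₂ r₂)
    (g₁ g₂ : V ≃ₗ[F] V) (hg₁G : g₁ ∈ G) (hg₂G : g₂ ∈ G)
    (hg₁ : Stingray.IsStingray e₁ g₁) (hg₂ : Stingray.IsStingray e₂ g₂)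
    (ho₁ : orderOf g₁ = r₁) (ho₂ : orderOf g₂ = r₂) :
    -- the cases in which the proportion is zero
    (((¬ ∃ n, 4 ≤ n ∧ d = 2 ^ n) ∨ ¬ (q.Prime ∧ Odd q) ∨
        ¬ ((2 * e₁ = d ∧ 2 * e₂ = d) ∨ (e₁ + 2 = d ∧ e₂ = 2)) ∨
        X = .U ∨ X = .OMinus) →
      Stingray.probSix G e₁ e₂ g₁ g₂ = 0) ∧
    -- the remaining cases
    (0 < Stingray.probSix G e₁ e₂ g₁ g₂ →
      ∃ n, 4 ≤ n ∧ d = 2 ^ n ∧ q.Prime ∧ Odd q ∧ (X = .L ∨ X = .Sp ∨ X = .OPlus) ∧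
        ((2 * e₁ = d ∧ 2 * e₂ = d ∧ r₁ = r₂ ∧
            ((r₁ = e₁ + 1 ∧ r₁ = 2 ^ (n - 1) + 1) ∨ (r₁ = 2 * e₁ + 1 ∧ r₁ = 2 ^ n + 1)) ∧
            (X = .L → Stingray.probSix G e₁ e₂ g₁ g₂ <
              45 / 1024 * (q : ℝ) ^ (-(d : ℝ) ^ 2 / 4)) ∧
            (X = .Sp ∨ X = .OPlus → Stingray.probSix G e₁ e₂ g₁ g₂ <
              45 / 1024 * (q : ℝ) ^ (-(d : ℝ) ^ 2 / 4 + 23 * (d : ℝ) / 10))) ∨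
          (e₁ + 2 = d ∧ e₂ = 2 ∧ 32 ≤ d ∧ 5 ≤ q ∧ q ≠ 7 ∧ n.Prime ∧ Odd n ∧
            (7 ≤ n ∨ (n = 5 ∧ 11 ≤ q)) ∧
            r₁ = e₁ + 1 ∧ r₁ + 1 = 2 ^ n ∧ r₂.Prime ∧ Odd r₂ ∧ r₂ ∣ q + 1 ∧
            (X = .L → Stingray.probSix G e₁ e₂ g₁ g₂ <
              45 / 640 * (q : ℝ) ^ (-(59 / 25) * (d : ℝ) + 8)) ∧
            (X = .Sp ∨ X = .OPlus → 128 ≤ d ∨ 19 ≤ q → Stingray.probSix G e₁ e₂ g₁ g₂ <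
              5.3 * 10 ^ (-3 : ℤ) * (q : ℝ) ^ (-(d : ℝ) + 3)) ∧
            (X = .Sp ∨ X = .OPlus → d = 32 ∧ (q = 11 ∨ q = 13 ∨ q = 17) →
              Stingray.probSix G e₁ e₂ g₁ g₂ < 6.9 * (q : ℝ) ^ (-(d : ℝ) + 3))))) ∧
    -- the subgroups of the sixth category that have to be considered
    (∀ n, 4 ≤ n → d = 2 ^ n → q.Prime → Odd q →
      ((X = .L ∧ q % 4 = 1) ∨ X = .Sp ∨ X = .OPlus) →
      (∃ M, Stingray.IsTableSubgroup q n G M X) ∧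
      (∀ M M', Stingray.IsTableSubgroup q n G M X → Stingray.IsTableSubgroup q n G M' X →
        (∃ x ∈ Subgroup.normalizer (G : Set (V ≃ₗ[F] V)), M' = Stingray.conjSubgroup x M) ∧
        (X = .L ∨ q % 8 = 3 ∨ q % 8 = 5 → ∃ x ∈ G, M' = Stingray.conjSubgroup x M)) ∧
      (∀ p ∈ Stingray.duosSix G e₁ e₂ g₁ g₂,
        ∃ M, Stingray.IsTableSubgroup q n G M X ∧ Subgroup.closure {p.1, p.2} ≤ M)) := by
  have hempty := Stingray.duosSix_eq_empty (G := G) (g₁ := g₁) (g₂ := g₂) (by rw [hV]; exact hd)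
    (by rw [hV]; exact hsum) he₂ he hr₂ ho₂
  have hprob : Stingray.probSix G e₁ e₂ g₁ g₂ = 0 := by
    rw [Stingray.probSix, hempty, Set.ncard_empty, Nat.cast_zero, zero_div]
  -- Emptiness settles the vanishing, makes positivity absurd and leaves no pair to contain; only
  -- existence and conjugacy of the table subgroups remain.
  refine ⟨fun _ => hprob, fun h => absurd hprob h.ne', fun n hn hdn _ hodd hX => ⟨?_, ?_, ?_⟩⟩
  · exact Stingray.exists_isTableSubgroup hG (hV.trans hdn) hn hodd hX
  · exact fun M M' hM hM' => hM.exists_conj hG (hV.trans hdn) hn hodd hM'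
  · intro p hp
    rw [hempty] at hp
    exact hp.elim
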